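/- **Setting.** Let $d\ge 1$, $\varepsilon>0$, $L_q>0$, and let $C,C_0\in\mathbb C^{d\times d}$ be symmetric matrices with positive definite imaginary part. For $q,p\in\mathbb R^d$ put $$g_{(q,p)}(x)=g^{C}_{(q,p)}(x)=(\pi\varepsilon)^{-d/4}\det(\operatorname{Im}C)^{1/4}\exp\Big[\tfrac i\varepsilon\big(\tfrac12(x-q)^TC(x-q)+p^T(x-q)\big)\Big],\qquad x\in\mathbb R^d ,$$ and let $\psi_0=g^{C_0}_{(q_0,p_0)}$ with $q_0,p_0\in\mathbb R^d$. Let $\langle f\mid g\rangle=\int_{\mathbb R^d}\overline{f(y)}\,g(y)\,dy$. Let $U\in\mathbb R^{d\times d}$ be orthogonal (for instance a matrix of eigenvectors of $\operatorname{Im}C$), $M\ge1$, $\Delta q=2L_q/M$, and define the box and the position grid $$\Lambda_x=q_0+U[-L_q,L_q]^d,\qquad q_k=q_0+U\Big(-L_q+\tfrac{2k_n-1}{2}\Delta q\Big)_{n=1}^d,\quad k\in\Gamma_q=\{1,\dots,M\}^d,$$ and $S(x)=\sum_{k\in\Gamma_q}|g_0(x-q_k)|^2$ with $g_0=g_{(0,0)}$.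 For momentum nodes $p_j$ and weights $\omega_j$, $j\in\Gamma_p$, set $g_{j,k}=g_{(q_k,p_j)}$, $$r_{j,k}=\frac{\omega_j}{(2\pi\varepsilon)^d}\langle g_{j,k}\mid\psi_0\rangle,\qquad \psi_{\rm rec}(x)=\frac1{S(x)}\sum_{k\in\Gamma_q}\sum_{j\in\Gamma_p}r_{j,k}\,g_{j,k}(x),\qquad E=\sup_{x\in\Lambda_x}|\psi_0(x)-\psi_{\rm rec}(x)| .$$ The three rules are: * **TcM** (truncation to $\prod_n[p_{0,n}-L_p,p_{0,n}+L_p]$, $L_p>0$, and compound midpoint rule, $N\ge1$): $\Gamma_p=\{1,\dots,N\}^d$, $\Delta p=2L_p/N$, $p_{j,n}=p_{0,n}-L_p+\frac{2j_n-1}{2}\Delta p$, $\omega_j=(\Delta p)^d$. * **RS** (infinite Riemann sums, $\Delta p>0$): $\Gamma_p=\mathbb Z^d$, $p_{j,n}=p_{0,n}+j_n\Delta p$, $\omega_j=(\Delta p)^d$. * **GH** (Gauss–Hermite quadrature, $N\ge1$): $\Gamma_p=\{1,\dots,N\}^d$, $p_{j,n}=p_{0,n}+s_{j_n}\sqrt{2\varepsilon}$,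 $\omega_j=\prod_{n=1}^d e^{s_{j_n}^2}w_{j_n}\sqrt{2\varepsilon}$, where $s_1,\dots,s_N$ are the zeros of the Hermite polynomial $H_N(x)=(-1)^Ne^{x^2}\frac{d^N}{dx^N}e^{-x^2}$ and $w_j=2^{N+1}N!\sqrt\pi/H_{N+1}(s_j)^2$. **Theorem 3.1.** All constants below depend only on $d,\varepsilon,C,C_0,L_q$ and on the further parameters that are named; in particular they do not depend on $q_0,p_0,U,M$. 1. **TcM.** There are $K,c>0$ such that for every $L_p>0$ there are $C^{(T)},C^{(cM)}>0$, depending in addition only on $L_p$, with $C^{(T)}\le Ke^{-cL_p^2}$, such that for all $N\ge1$ $$E^{(TcM)}<C^{(T)}+C^{(cM)}N^{-2}.$$ 2. **RS.** For every integer $s\ge1$ and every $P>0$ there is $C_s^{(RS)}>0$, depending in addition only on $s$ and $P$, such that for all $\Delta p\in(0,P]$, and if $d\le 2s+1$ even for all $\Delta p>0$, the sums over $j\in\mathbb Z^d$ converge absolutely for all $x\in\mathbb R^d$ and $k\in\Gamma_q$, and $$E^{(RS)}<C_s^{(RS)}(\Delta p)^{2s+1}.$$ 3. **GH.** For every integer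 $s\ge1$ there is $C_s^{(GH)}>0$, depending in addition only on $s$, such that for all $N\ge1$ $$E^{(GH)}<C_s^{(GH)}N^{-s/2}.$$ The finite tensor grids (TcM and GH) have $N_d=N^d$ points, and $N^{-2}=N_d^{-2/d}$, $N^{-s/2}=N_d^{-s/(2d)}$ for all $N,s\ge 1$. -/

import Mathlib

namespace WavePacket

/-- The Siegel upper half-space: complex symmetric matrices with positive definite imaginary part. -/
def SiegelUpperHalfSpace (d : ℕ) : Set (Matrix (Fin d) (Fin d) ℂ) :=
  {C | C.IsSymm ∧ (C.map Complex.im).PosDef}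

/-- The Gaussian wave packet `g_z^{C,ε}` with phase space centre `z = (q, p)`,
`(π ε)^(-d/4) det(Im C)^(1/4) exp((i/ε) ((x-q)ᵀ C (x-q) / 2 + pᵀ (x-q)))`.
Points of `ℝ^d` are coordinate vectors; no norm on them is used, and the volume on
`Fin d → ℝ` is Lebesgue measure. -/
noncomputable def packet {d : ℕ} (ε : ℝ) (C : Matrix (Fin d) (Fin d) ℂ)
    (q p x : Fin d → ℝ) : ℂ :=
  (((Real.pi * ε) ^ (-(d : ℝ) / 4) * (C.map Complex.im).det ^ ((1 : ℝ) / 4) : ℝ) : ℂ) *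
    Complex.exp ((Complex.I / (ε : ℂ)) *
      ((1 / 2 : ℂ) * ((fun n => ((x n - q n : ℝ) : ℂ)) ⬝ᵥ
          (C.mulVec fun n => ((x n - q n : ℝ) : ℂ)))
        + ((p ⬝ᵥ (x - q) : ℝ) : ℂ)))

/-- The `L²` inner product `⟨f | g⟩`, antilinear in the first argument. -/
noncomputable def braket {d : ℕ} (f g : (Fin d → ℝ) → ℂ) : ℂ :=
  ∫ y, (starRingEnd ℂ) (f y) * g y

/-- The box `q₀ + U [-L, L]^d`. -/
def posBox {d : ℕ} (U : Matrix (Fin d) (Fin d) ℝ) (q₀ : Fin d → ℝ) (L : ℝ) :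
    Set (Fin d → ℝ) :=
  (fun y => q₀ + U.mulVec y) '' Set.Icc (fun _ => -L) (fun _ => L)

/-- The uniform position grid with `M` midpoints per direction of `q₀ + U [-L, L]^d`.
An index `k n : Fin M` stands for the one-based index `k n + 1`, so that `(2 (k n + 1) - 1) / 2`
becomes `(2 (k n) + 1) / 2`; the spacing is `2 L / M`. -/
noncomputable def posGrid {d : ℕ} (U : Matrix (Fin d) (Fin d) ℝ) (q₀ : Fin d → ℝ) (L : ℝ)
    (M : ℕ) (k : Fin d → Fin M) : Fin d → ℝ :=
  q₀ + U.mulVec fun n => -L + (2 * ((k n : ℕ) : ℝ) + 1) / 2 * (2 * L / M)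

/-- The summation curve `S(x) = ∑_k |g_0(x - q_k)|²`. -/
noncomputable def sumCurve {d : ℕ} {κ : Type} [Fintype κ] (ε : ℝ)
    (C : Matrix (Fin d) (Fin d) ℂ) (q : κ → Fin d → ℝ) (x : Fin d → ℝ) : ℝ :=
  ∑ k, ‖packet ε C 0 0 (x - q k)‖ ^ 2

/-- The `(j, k)` summand `r_{j,k} g_{j,k}(x)`, where `g_{j,k} = g_{(q_k, p_j)}` and
`r_{j,k} = ω_j (2 π ε)^(-d) ⟨g_{j,k} | ψ⟩`, for momentum nodes `p_j` and weights `ω_j`. -/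
noncomputable def recTerm {d : ℕ} {ι κ : Type} (ε : ℝ) (C : Matrix (Fin d) (Fin d) ℂ)
    (ψ : (Fin d → ℝ) → ℂ) (q : κ → Fin d → ℝ) (p : ι → Fin d → ℝ) (ω : ι → ℝ)
    (x : Fin d → ℝ) (k : κ) (j : ι) : ℂ :=
  ((ω j / (2 * Real.pi * ε) ^ d : ℝ) : ℂ) * braket (packet ε C (q k) (p j)) ψ *
    packet ε C (q k) (p j) x

/-- The reconstruction `S(x)⁻¹ ∑_k ∑_j r_{j,k} g_{j,k}(x)`. The sum over `j` is an ordinary finite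
sum when `ι` is finite. -/
noncomputable def psiRec {d : ℕ} {ι κ : Type} [Fintype κ] (ε : ℝ)
    (C : Matrix (Fin d) (Fin d) ℂ) (ψ : (Fin d → ℝ) → ℂ) (q : κ → Fin d → ℝ)
    (p : ι → Fin d → ℝ) (ω : ι → ℝ) (x : Fin d → ℝ) : ℂ :=
  (1 / (sumCurve ε C q x : ℂ)) * ∑ k, ∑' j, recTerm ε C ψ q p ω x k j

/-- The uniform error `sup_{x ∈ Λ} |ψ(x) - φ(x)|`, as an extended non-negative real. -/
noncomputable def supError {d : ℕ} (Λ : Set (Fin d → ℝ)) (ψ φ : (Fin d → ℝ) → ℂ) : ENNReal :=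
  ⨆ x ∈ Λ, ‖ψ x - φ x‖ₑ

/-- Momentum grid of the truncated compound midpoint rule: the `N` midpoints per direction of
`∏ [p₀ₙ - L, p₀ₙ + L]`, with spacing `2 L / N` (indices shifted as for the position grid). -/
noncomputable def midpointNode {d : ℕ} (p₀ : Fin d → ℝ) (L : ℝ) (N : ℕ)
    (j : Fin d → Fin N) : Fin d → ℝ :=
  fun n => p₀ n - L + (2 * ((j n : ℕ) : ℝ) + 1) / 2 * (2 * L / N)

/-- Infinite uniform momentum grid of spacing `h`. -/
def riemannNode {d : ℕ} (p₀ : Fin d → ℝ) (h : ℝ) (j : Fin d → ℤ) : Fin d → ℝ :=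
  fun n => p₀ n + (j n : ℝ) * h

/-- The (physicists) Hermite polynomials. -/
noncomputable def hermitePoly : ℕ → Polynomial ℝ
  | 0 => 1
  | n + 1 => 2 * Polynomial.X * hermitePoly n - Polynomial.derivative (hermitePoly n)

/-- Rodrigues formula: `H_n(x) = (-1)^n exp(x²) (d/dx)^n exp(-x²)`. -/
theorem hermitePoly_eval (n : ℕ) (x : ℝ) :
    (hermitePoly n).eval x =
      (-1) ^ n * Real.exp (x ^ 2) * iteratedDeriv n (fun y => Real.exp (-y ^ 2)) x := by
  have key : ∀ n : ℕ, iteratedDeriv n (fun y : ℝ => Real.exp (-y ^ 2)) =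
      fun y => (-1) ^ n * ((hermitePoly n).eval y * Real.exp (-y ^ 2)) := by
    intro n
    induction n with
    | zero => simp [hermitePoly]
    | succ n ih =>
      rw [iteratedDeriv_succ, ih]
      funext y
      have h1 : HasDerivAt (fun y : ℝ => Real.exp (-y ^ 2))
          (Real.exp (-y ^ 2) * (-(2 * y))) y := by
        have := ((hasDerivAt_pow 2 y).neg).exp
        simpa using this
      have h2 := (((hermitePoly n).hasDerivAt y).mul h1).const_mul ((-1 : ℝ) ^ n)
      refine h2.deriv.trans ?_
      simp [hermitePoly, pow_succ]
      ring
  rw [key n]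
  have h : Real.exp (x ^ 2) * Real.exp (-x ^ 2) = 1 := by
    rw [← Real.exp_add]; simp
  have h' : ((-1 : ℝ) ^ n) * (-1) ^ n = 1 := by
    rw [← mul_pow]; simp
  linear_combination -(Polynomial.eval x (hermitePoly n)) * h' * Real.exp (x ^ 2) *
    Real.exp (-x ^ 2) - (Polynomial.eval x (hermitePoly n)) * h

/-- The zeros of the `N`th Hermite polynomial. They replace the index `j ∈ {1, …, N}` of the nodes
`s_j` of the Gauss-Hermite rule. -/
noncomputable def hermiteZeros (N : ℕ) : Finset ℝ := (hermitePoly N).roots.toFinset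

/-- Gauss-Hermite weight `2^(N+1) N! √π / H_{N+1}(s)²` at a node `s`. -/
noncomputable def hermiteWeight (N : ℕ) (s : ℝ) : ℝ :=
  2 ^ (N + 1) * (N.factorial : ℝ) * √Real.pi / (hermitePoly (N + 1)).eval s ^ 2

/-- Transformed Gauss-Hermite nodes `p₀ₙ + s_{jₙ} √(2 ε)`. -/
noncomputable def hermiteNode {d : ℕ} (ε : ℝ) (p₀ : Fin d → ℝ) (N : ℕ)
    (j : Fin d → hermiteZeros N) : Fin d → ℝ :=
  fun n => p₀ n + (j n : ℝ) * √(2 * ε)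

/-- Transformed tensor weights `∏ₙ exp(s_{jₙ}²) w_{jₙ} √(2 ε)`. -/
noncomputable def hermiteTensorWeight {d : ℕ} (ε : ℝ) (N : ℕ)
    (j : Fin d → hermiteZeros N) : ℝ :=
  ∏ n, Real.exp ((j n : ℝ) ^ 2) * hermiteWeight N (j n) * √(2 * ε)

end WavePacket

namespace WavePacket

open Polynomial MeasureTheory

/-! ### Hermite polynomials and Gauss-Hermite quadrature -/

/-! The position grid causes no error at all. By Fourier inversion, integrating (2πε)^(-d)
⟨g_{(q,p)} | ψ₀⟩ g_{(q,p)}(x) over all momenta p gives |g_{(q,0)}(x)|² ψ₀(x); summing over the grid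
points q_k and dividing by S(x) returns ψ₀(x), whatever U and M are. Hence E only measures how well
the rule in p integrates one explicit family of functions.

Up to a factor of modulus |g_{(q_k,0)}(x)|, each summand is a weight times `momentumKernel` at p_j -
p₀ (`recTerm_eq`), and the kernel depends on position only through q_k - q₀ and x - q₀, which stay
in a fixed cube. It is a plane wave times the Fourier transform of a complex Gaussian. Diagonalizing
the real and imaginary parts of the exponent simultaneously gives it in closed form, so it is entire
in p and bounded by A exp(-a |Re z|²) on the tube |Im zₙ| ≤ 1, uniformly over the cube
(`exists_tubeGaussian_momentumKernel`). Since |g| is bounded below on compact sets, averaging over k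
preserves the quadrature error with a constant free of M (`norm_weighted_sub_le`,
`exists_supError_le`).

Replacing one coordinate at a time reduces the tensor rule to dimension one, provided the rule has
non-negative weights and sums Gaussians stably (`StableRule`). The one-dimensional errors come from
analyticity in a strip. For the midpoint rule, Cauchy estimates bound the second derivative and the
cut tail is Gaussian. For Riemann sums, Poisson summation leaves only the nonzero frequencies, and
the Fourier transform decays faster than any power.

For Gauss-Hermite, f is a superposition of waves exp(-b u² + 2πiξu) with rapidly decaying amplitude
in ξ. The rule is exact up to degree 2N - 1, so on each wave it only sees a Taylor remainder. That
remainder grows like exp(θ u²) with θ < 1, and the rule stays bounded on such functions because it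
never overestimates a moment (`gaussHermite_pow_mul_hermitePoly_le`). Waves with ξ² large compared
with N are handled by the decay of the amplitude (`exists_norm_hermiteDefect_gaussWave_le`). -/

theorem derivative_hermitePoly (n : ℕ) :
    derivative (hermitePoly n) = 2 * (n : ℝ[X]) * hermitePoly (n - 1) := by
  induction n with
  | zero => simp [hermitePoly]
  | succ n ih =>
    cases n with
    | zero => simp [hermitePoly]
    | succ m =>
      rw [hermitePoly, derivative_sub, derivative_mul, ih]
      have h2 : derivative (2 * X : ℝ[X]) = 2 := by
        simp [derivative_mul]
      have h3 : derivative (2 * ((m + 1 : ℕ) : ℝ[X]) * hermitePoly m)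
          = 2 * ((m + 1 : ℕ) : ℝ[X]) * derivative (hermitePoly m) := by
        have : (2 * ((m + 1 : ℕ) : ℝ[X])) = C (2 * ((m + 1 : ℕ) : ℝ)) := by
          simp [show (C 2 : ℝ[X]) = 2 from rfl]
        rw [this, derivative_C_mul]
      simp only [Nat.add_sub_cancel]
      rw [h2, h3]
      have h4 : hermitePoly (m + 1) = 2 * X * hermitePoly m - derivative (hermitePoly m) := rfl
      rw [h4]
      push_cast
      ring

/-- The three-term recurrence. At n = 0 the truncated index `n - 1` is harmless because its
coefficient vanishes. -/
theorem hermitePoly_succ (n : ℕ) :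
    hermitePoly (n + 1) = 2 * X * hermitePoly n - 2 * (n : ℝ[X]) * hermitePoly (n - 1) := by
  rw [hermitePoly, derivative_hermitePoly]

theorem natDegree_hermitePoly_le (n : ℕ) : (hermitePoly n).natDegree ≤ n := by
  induction n with
  | zero => simp [hermitePoly]
  | succ n ih =>
    rw [hermitePoly]
    refine (natDegree_sub_le _ _).trans (max_le ?_ ?_)
    · refine natDegree_mul_le.trans ?_
      have : (2 * X : ℝ[X]).natDegree ≤ 1 := (natDegree_C_mul_le (2 : ℝ) X).trans natDegree_X_le
      omega
    · exact (natDegree_derivative_le _).trans (by omega)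

theorem coeff_hermitePoly_self (n : ℕ) : (hermitePoly n).coeff n = 2 ^ n := by
  induction n with
  | zero => simp [hermitePoly]
  | succ n ih =>
    rw [hermitePoly, coeff_sub, coeff_derivative,
      coeff_eq_zero_of_natDegree_lt (n := n + 1 + 1)
        ((natDegree_hermitePoly_le n).trans_lt (by omega)), mul_assoc, mul_comm X,
      ← mul_assoc, coeff_mul_X]
    have : (2 : ℝ[X]) = C 2 := rfl
    rw [this, coeff_C_mul, ih]
    ring

theorem natDegree_hermitePoly (n : ℕ) : (hermitePoly n).natDegree = n :=
  le_antisymm (natDegree_hermitePoly_le n)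
    (le_natDegree_of_ne_zero (by rw [coeff_hermitePoly_self]; positivity))

theorem hermitePoly_ne_zero (n : ℕ) : hermitePoly n ≠ 0 := fun h => by
  have := coeff_hermitePoly_self n
  rw [h, coeff_zero] at this
  exact absurd this.symm (by positivity)

/-- The Christoffel-Darboux formula. -/
theorem christoffel_darboux {K : Type*} [Field K] [Algebra ℝ K] [CharZero K] (n : ℕ) (z w : K) :
    (z - w) * ∑ k ∈ Finset.range (n + 1),
        aeval z (hermitePoly k) * aeval w (hermitePoly k) / (2 ^ k * (k.factorial : K)) =
      (aeval z (hermitePoly (n + 1)) * aeval w (hermitePoly n) -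
        aeval z (hermitePoly n) * aeval w (hermitePoly (n + 1))) /
        (2 ^ (n + 1) * (n.factorial : K)) := by
  have h2 : ∀ y : K, aeval y (2 : ℝ[X]) = 2 := fun y => map_ofNat _ 2
  induction n with
  | zero => simp [hermitePoly, h2]; ring
  | succ n ih =>
    rw [Finset.sum_range_succ, mul_add, ih]
    have e : ∀ y : K, aeval y (hermitePoly (n + 2)) = 2 * y * aeval y (hermitePoly (n + 1)) -
        2 * ((n : K) + 1) * aeval y (hermitePoly n) := by
      intro y
      rw [hermitePoly_succ (n + 1)]
      simp [h2]
    rw [e, e]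
    have h1 : (n.factorial : K) ≠ 0 := by exact_mod_cast n.factorial_ne_zero
    have h2 : (n : K) + 1 ≠ 0 := by exact_mod_cast n.succ_ne_zero
    rw [Nat.factorial_succ]
    push_cast
    field_simp
    ring

/-! ### Simplicity and reality of the Hermite zeros -/

/-- The three-term recurrence pushes a common zero of neighbours down to H₀ = 1. -/
theorem hermitePoly_no_common_zero (n : ℕ) (x : ℝ) (h : (hermitePoly n).eval x = 0)
    (h' : (hermitePoly (n + 1)).eval x = 0) : False := by
  induction n with
  | zero => simp [hermitePoly] at h
  | succ n ih =>
    refine ih ?_ h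
    rw [hermitePoly_succ (n + 1)] at h'
    simp only [eval_sub, eval_mul, h, Nat.add_sub_cancel, mul_zero, zero_sub, neg_eq_zero,
      mul_eq_zero] at h'
    rcases h' with h' | h'
    · exfalso
      rw [eval_natCast] at h'
      norm_num at h'
      norm_cast at h'
    · exact h'

theorem separable_hermitePoly_root (N : ℕ) (s : ℝ) (h : (hermitePoly N).eval s = 0) :
    (derivative (hermitePoly N)).eval s ≠ 0 := by
  intro h'
  refine hermitePoly_no_common_zero N s h ?_
  rw [hermitePoly]
  simp [h, h']

/-- Christoffel-Darboux at z and its conjugate: the right side vanishes at a zero, while the sum on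
the left is a positive combination of |H_k(z)|² whose k = 0 term is 1. So z equals its conjugate. -/
theorem hermitePoly_root_real (N : ℕ) (z : ℂ) (h : aeval z (hermitePoly N) = 0) : z.im = 0 := by
  cases N with
  | zero => simp [hermitePoly] at h
  | succ n =>
    have hc : ∀ k, aeval (starRingEnd ℂ z) (hermitePoly k)
        = starRingEnd ℂ (aeval z (hermitePoly k)) := by
      intro k
      exact Polynomial.aeval_conj _ _
    have key := christoffel_darboux n z (starRingEnd ℂ z)
    rw [hc (n + 1), h] at key
    simp only [map_zero, zero_mul, mul_zero, sub_zero, zero_div, mul_eq_zero] at key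
    rcases key with key | key
    · have := congrArg Complex.im key
      simp at this
      linarith
    · exfalso
      have h2 : ∀ k : ℕ, aeval z (hermitePoly k) * aeval (starRingEnd ℂ z) (hermitePoly k) /
          (2 ^ k * (k.factorial : ℂ)) =
          ((Complex.normSq (aeval z (hermitePoly k)) / (2 ^ k * (k.factorial : ℝ)) : ℝ) : ℂ) := by
        intro k
        rw [hc k, Complex.mul_conj]
        push_cast
        rfl
      simp_rw [h2] at key
      rw [← Complex.ofReal_sum, Complex.ofReal_eq_zero] at key
      have h3 := (Finset.sum_eq_zero_iff_of_nonneg (fun k _ => div_nonneg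
        (Complex.normSq_nonneg (aeval z (hermitePoly k))) (by positivity))).1 key 0 (by simp)
      simp [hermitePoly] at h3

theorem splits_hermitePoly (N : ℕ) : (hermitePoly N).Splits := by
  refine Splits.of_splits_map (algebraMap ℝ ℂ) (IsAlgClosed.splits _) ?_
  intro z hz
  rw [mem_roots_map (hermitePoly_ne_zero N)] at hz
  refine ⟨z.re, ?_⟩
  have := hermitePoly_root_real N z hz
  apply Complex.ext <;> simp [this]

theorem card_hermiteZeros (N : ℕ) : (hermiteZeros N).card = N := by
  have hn : (hermitePoly N).roots.Nodup := by
    rw [Multiset.nodup_iff_count_le_one]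
    intro a
    rw [count_roots]
    by_contra! h
    rw [one_lt_rootMultiplicity_iff_isRoot (hermitePoly_ne_zero N)] at h
    exact separable_hermitePoly_root N a h.1 h.2
  rw [hermiteZeros, Multiset.toFinset_card_of_nodup hn,
    splits_iff_card_roots.1 (splits_hermitePoly N), natDegree_hermitePoly]

theorem mem_hermiteZeros {N : ℕ} {s : ℝ} :
    s ∈ hermiteZeros N ↔ (hermitePoly N).eval s = 0 := by
  simp [hermiteZeros, mem_roots (hermitePoly_ne_zero N)]

/-! ### Gaussian means and orthogonality -/

theorem integrable_pow_mul_exp_neg_mul_sq {b : ℝ} (hb : 0 < b) (n : ℕ) :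
    Integrable fun x : ℝ => x ^ n * Real.exp (-b * x ^ 2) := by
  have h : (-1 : ℝ) < n := by
    have : (0 : ℝ) ≤ n := n.cast_nonneg
    linarith
  simpa using integrable_rpow_mul_exp_neg_mul_sq hb h

theorem integrable_eval_mul_exp_neg_sq (p : ℝ[X]) :
    Integrable fun x : ℝ => p.eval x * Real.exp (-x ^ 2) := by
  induction p using Polynomial.induction_on' with
  | add p q hp hq =>
    simp only [eval_add, add_mul]
    exact hp.add hq
  | monomial n a =>
    have := (integrable_pow_mul_exp_neg_mul_sq one_pos n).const_mul a
    simpa [mul_assoc] using this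

/-- Integration of polynomials against `exp (-x²)`. -/
noncomputable def gaussMean : ℝ[X] →ₗ[ℝ] ℝ where
  toFun p := ∫ x : ℝ, p.eval x * Real.exp (-x ^ 2)
  map_add' p q := by
    simp only [eval_add, add_mul]
    exact integral_add (integrable_eval_mul_exp_neg_sq p) (integrable_eval_mul_exp_neg_sq q)
  map_smul' a p := by
    simp [mul_assoc, integral_const_mul]

theorem gaussMean_apply (p : ℝ[X]) :
    gaussMean p = ∫ x : ℝ, p.eval x * Real.exp (-x ^ 2) := rfl

/-- Integration by parts: the derivative of p(x) exp(-x²) has integral zero. -/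
theorem gaussMean_two_X_mul (p : ℝ[X]) : gaussMean (2 * X * p) = gaussMean (derivative p) := by
  have hd : ∀ x : ℝ, HasDerivAt (fun x : ℝ => p.eval x * Real.exp (-x ^ 2))
      ((derivative p - 2 * X * p).eval x * Real.exp (-x ^ 2)) x := by
    intro x
    have h1 : HasDerivAt (fun y : ℝ => Real.exp (-y ^ 2))
        (Real.exp (-x ^ 2) * (-(2 * x))) x := by
      have := ((hasDerivAt_pow 2 x).neg).exp
      simpa using this
    refine ((p.hasDerivAt x).mul h1).congr_deriv ?_
    simp only [eval_sub, eval_mul, eval_X, eval_ofNat]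
    ring
  have := integral_eq_zero_of_hasDerivAt_of_integrable hd
    (integrable_eval_mul_exp_neg_sq _) (integrable_eval_mul_exp_neg_sq p)
  rw [← gaussMean_apply, map_sub, sub_eq_zero] at this
  exact this.symm

/-- Under the Gaussian mean, multiplication by H_n is the adjoint form of n-fold differentiation;
orthogonality to lower degrees follows at once. -/
theorem gaussMean_hermitePoly_mul (n : ℕ) (p : ℝ[X]) :
    gaussMean (hermitePoly n * p) = gaussMean (derivative^[n] p) := by
  induction n generalizing p with
  | zero => simp [hermitePoly]
  | succ n ih =>
    rw [Function.iterate_succ_apply, ← ih, hermitePoly, sub_mul, map_sub, mul_assoc,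
      gaussMean_two_X_mul, derivative_mul, map_add]
    ring

theorem gaussMean_hermitePoly_mul_eq_zero {n : ℕ} {p : ℝ[X]} (h : p.natDegree < n) :
    gaussMean (hermitePoly n * p) = 0 := by
  rw [gaussMean_hermitePoly_mul, iterate_derivative_eq_zero h, map_zero]

theorem gaussMean_one : gaussMean 1 = √Real.pi := by
  rw [gaussMean_apply]
  simpa using integral_gaussian 1

theorem gaussMean_hermitePoly {n : ℕ} (hn : 0 < n) : gaussMean (hermitePoly n) = 0 := by
  simpa using gaussMean_hermitePoly_mul_eq_zero (n := n) (p := 1) (by simpa using hn)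

/-- The Gauss-Hermite rule applied to a function. -/
noncomputable def gaussHermite (N : ℕ) (f : ℝ → ℝ) : ℝ :=
  ∑ s ∈ hermiteZeros N, hermiteWeight N s * f s

/-- The Christoffel-Darboux kernel. -/
noncomputable def hermiteKernel (N : ℕ) (s : ℝ) : ℝ[X] :=
  ∑ k ∈ Finset.range N, C ((hermitePoly k).eval s / (2 ^ k * (k.factorial : ℝ))) * hermitePoly k

/-! ### Weights and exactness of the Gauss-Hermite rule -/

/-- At a zero s one of the two Christoffel-Darboux products drops out, so the kernel is a multiple
of the Lagrange polynomial H_{n+1}/(X - s). -/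
theorem X_sub_mul_hermiteKernel (n : ℕ) {s : ℝ} (hs : (hermitePoly (n + 1)).eval s = 0) :
    (X - C s) * hermiteKernel (n + 1) s =
      C ((hermitePoly n).eval s / (2 ^ (n + 1) * (n.factorial : ℝ))) * hermitePoly (n + 1) := by
  refine Polynomial.funext fun x => ?_
  have := christoffel_darboux n x s
  simp only [coe_aeval_eq_eval, hs, mul_zero, sub_zero] at this
  simp only [hermiteKernel, eval_mul, eval_sub, eval_X, eval_C, eval_finsetSum]
  rw [show ∀ a b c : ℝ, a / b * c = c * a / b from fun a b c => by ring, ← this]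
  congr 1
  exact Finset.sum_congr rfl fun k _ => by ring

/-- Differentiate the preceding identity at s; there H'_{n+1} = 2(n+1)H_n and H_{n+2} = -2(n+1)H_n,
so everything is expressed through H_{n+2}(s). -/
theorem eval_hermiteKernel_self (n : ℕ) {s : ℝ} (hs : (hermitePoly (n + 1)).eval s = 0) :
    (hermiteKernel (n + 1) s).eval s =
      (hermitePoly (n + 2)).eval s ^ 2 / (2 ^ (n + 2) * ((n + 1).factorial : ℝ)) := by
  have h := congrArg (fun p => (derivative p).eval s) (X_sub_mul_hermiteKernel n hs)
  simp only [derivative_mul, derivative_sub, derivative_X, derivative_C, sub_zero, one_mul,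
    eval_add, eval_mul, eval_sub, eval_X, eval_C, sub_self, zero_mul, add_zero,
    derivative_hermitePoly (n + 1), Nat.add_sub_cancel, zero_add] at h
  rw [h, hermitePoly_succ (n + 1)]
  simp only [eval_sub, eval_mul, hs, Nat.add_sub_cancel, mul_zero, zero_sub, eval_natCast]
  have h2 : (2 : ℝ[X]).eval s = 2 := by simp
  rw [h2, Nat.factorial_succ]
  push_cast
  have h1 : (n.factorial : ℝ) ≠ 0 := by positivity
  have h3 : (n : ℝ) + 1 ≠ 0 := by positivity
  field_simp
  ring

theorem eval_hermiteKernel_self_pos (n : ℕ) {s : ℝ} (hs : (hermitePoly (n + 1)).eval s = 0) :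
    0 < (hermiteKernel (n + 1) s).eval s := by
  rw [eval_hermiteKernel_self n hs]
  have : (hermitePoly (n + 2)).eval s ≠ 0 := fun h => hermitePoly_no_common_zero _ s hs h
  positivity

/-- Identifies the prescribed weight with the Christoffel number, which is what makes the rule
interpolatory. -/
theorem hermiteWeight_eq (n : ℕ) {s : ℝ} (hs : (hermitePoly (n + 1)).eval s = 0) :
    hermiteWeight (n + 1) s = √Real.pi / (hermiteKernel (n + 1) s).eval s := by
  rw [eval_hermiteKernel_self n hs, hermiteWeight, div_div_eq_mul_div]
  ring

theorem hermiteWeight_nonneg (N : ℕ) (s : ℝ) : 0 ≤ hermiteWeight N s := by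
  unfold hermiteWeight
  positivity

theorem eval_hermiteKernel_of_ne (n : ℕ) {s t : ℝ} (hs : (hermitePoly (n + 1)).eval s = 0)
    (ht : (hermitePoly (n + 1)).eval t = 0) (hst : t ≠ s) :
    (hermiteKernel (n + 1) s).eval t = 0 := by
  have h := congrArg (fun p => p.eval t) (X_sub_mul_hermiteKernel n hs)
  simp only [eval_mul, ht, mul_zero, eval_sub, eval_X, eval_C, mul_eq_zero, sub_eq_zero] at h
  exact h.resolve_left hst

theorem natDegree_hermiteKernel_le (n : ℕ) (s : ℝ) : (hermiteKernel (n + 1) s).natDegree ≤ n := by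
  refine natDegree_sum_le_of_forall_le _ _ fun k hk => ?_
  refine (natDegree_C_mul_le _ _).trans ?_
  rw [natDegree_hermitePoly]
  exact Nat.lt_succ_iff.1 (Finset.mem_range.1 hk)

theorem gaussMean_hermiteKernel (n : ℕ) (s : ℝ) : gaussMean (hermiteKernel (n + 1) s) = √Real.pi := by
  rw [hermiteKernel, map_sum, Finset.sum_range_succ', Finset.sum_eq_zero]
  · simp [hermitePoly, gaussMean_one]
  · intro k _
    rw [C_mul', map_smul, gaussMean_hermitePoly k.succ_pos, smul_zero]

/-- Lagrange interpolation at the n + 1 zeros, with kernels normalized at their own node as basis.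
Each kernel has mean √π, since only its constant term is not orthogonal to 1. -/
theorem gaussMean_eq_of_natDegree_le {n : ℕ} {p : ℝ[X]} (hp : p.natDegree ≤ n) :
    gaussMean p = gaussHermite (n + 1) fun x => p.eval x := by
  have hroot : ∀ s ∈ hermiteZeros (n + 1), (hermitePoly (n + 1)).eval s = 0 :=
    fun s hs => mem_hermiteZeros.1 hs
  have h : p = ∑ s ∈ hermiteZeros (n + 1),
      C (p.eval s / (hermiteKernel (n + 1) s).eval s) * hermiteKernel (n + 1) s := by
    refine eq_of_degrees_lt_of_eval_finset_eq (hermiteZeros (n + 1)) ?_ ?_ ?_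
    · rw [card_hermiteZeros]
      exact degree_le_natDegree.trans_lt (by exact_mod_cast Nat.lt_succ_of_le hp)
    · rw [card_hermiteZeros]
      refine degree_le_natDegree.trans_lt ?_
      refine Nat.cast_lt.2 (Nat.lt_succ_of_le (natDegree_sum_le_of_forall_le _ _ fun s _ => ?_))
      exact (natDegree_C_mul_le _ _).trans (natDegree_hermiteKernel_le n s)
    · intro t ht
      rw [eval_finsetSum, Finset.sum_eq_single t]
      · rw [eval_mul, eval_C, div_mul_cancel₀ _ (eval_hermiteKernel_self_pos n (hroot t ht)).ne']
      · intro s hs hst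
        rw [eval_mul, eval_hermiteKernel_of_ne n (hroot s hs) (hroot t ht) hst.symm, mul_zero]
      · exact fun h => absurd ht h
  conv_lhs => rw [h]
  rw [map_sum, gaussHermite]
  refine Finset.sum_congr rfl fun s hs => ?_
  rw [C_mul', map_smul, gaussMean_hermiteKernel, hermiteWeight_eq n (hroot s hs), smul_eq_mul]
  ring

/-- The `N`-point Gauss-Hermite rule is exact for polynomials of degree less than `2 N`. -/
theorem gaussHermite_exact {N : ℕ} {p : ℝ[X]} (hp : p.natDegree < 2 * N) :
    gaussHermite N (fun x => p.eval x) = gaussMean p := by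
  obtain ⟨n, rfl⟩ : ∃ n, N = n + 1 := ⟨N - 1, by omega⟩
  set H := hermitePoly (n + 1) with hH
  have hdiv : p = H * (p / H) + p % H := (EuclideanDomain.div_add_mod p H).symm
  -- Gauss's argument: the quotient by H_{n+1} has degree at most n, so H times it has mean zero,
  -- and it is invisible to the rule because H vanishes at the nodes.
  have hq : (p / H).natDegree < n + 1 := by
    by_cases hle : H.degree ≤ p.degree
    · have h0 : p / H ≠ 0 := by
        rw [Ne, Polynomial.div_eq_zero_iff (hermitePoly_ne_zero _)]
        exact not_lt.2 hle
      have h1 : (p % H + H * (p / H)).natDegree = H.natDegree + (p / H).natDegree := by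
        rw [EuclideanDomain.mod_add_div, ← natDegree_mul (hermitePoly_ne_zero _) h0]
        refine (natDegree_eq_of_degree_eq ?_).symm
        rw [degree_mul, degree_add_div (hermitePoly_ne_zero _) hle]
      rw [EuclideanDomain.mod_add_div, show H.natDegree = n + 1 from natDegree_hermitePoly _] at h1
      omega
    · rw [(Polynomial.div_eq_zero_iff (hermitePoly_ne_zero _)).2 (not_le.1 hle)]
      simp
  have hr : (p % H).natDegree ≤ n := by
    have := natDegree_mod_lt p (q := H) (by rw [hH, natDegree_hermitePoly]; omega)
    rw [hH, natDegree_hermitePoly] at this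
    exact Nat.lt_succ_iff.1 this
  have h1 : gaussMean p = gaussMean (p % H) := by
    conv_lhs => rw [hdiv, map_add, gaussMean_hermitePoly_mul_eq_zero hq, zero_add]
  rw [h1, gaussMean_eq_of_natDegree_le hr]
  refine Finset.sum_congr rfl fun s hs => ?_
  have : p.eval s = (p % H).eval s := by
    conv_lhs => rw [hdiv]
    rw [eval_add, eval_mul, hH, mem_hermiteZeros.1 hs, zero_mul, zero_add]
  simp only [this]

/-! ### Stability of the Gauss-Hermite rule -/

theorem X_mul_hermitePoly (k : ℕ) :
    X * hermitePoly k = C (1 / 2) * hermitePoly (k + 1) + C (k : ℝ) * hermitePoly (k - 1) := by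
  rw [hermitePoly_succ]
  have : (2 : ℝ[X]) = C 2 := rfl
  have h2 : (C (1 / 2) * C 2 : ℝ[X]) = 1 := by rw [← C_mul]; norm_num
  rw [this, C_eq_natCast]
  linear_combination (-(X * hermitePoly k) + (k : ℝ[X]) * hermitePoly (k - 1)) * h2

/-- Multiplication by X acts on the Hermite basis with non-negative coefficients, and the means of
the basis elements themselves are non-negative. -/
theorem gaussMean_pow_mul_hermitePoly_nonneg (m k : ℕ) :
    0 ≤ gaussMean (X ^ m * hermitePoly k) := by
  induction m generalizing k with
  | zero =>
    rcases Nat.eq_zero_or_pos k with rfl | hk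
    · simp [hermitePoly, gaussMean_one, Real.sqrt_nonneg]
    · simp [gaussMean_hermitePoly hk]
  | succ m ih =>
    have : X ^ (m + 1) * hermitePoly k = (1 / 2 : ℝ) • (X ^ m * hermitePoly (k + 1))
        + (k : ℝ) • (X ^ m * hermitePoly (k - 1)) := by
      rw [pow_succ, mul_assoc, X_mul_hermitePoly, ← C_mul', ← C_mul']
      ring
    rw [this, map_add, map_smul, map_smul, smul_eq_mul, smul_eq_mul]
    have := ih (k + 1)
    have := ih (k - 1)
    positivity

/-- Rule and integral obey the same recursion in m with non-negative coefficients. They differ only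
when the index reaches N: the rule then sees zero, the integral a non-negative number. -/
theorem gaussHermite_pow_mul_hermitePoly_le (m : ℕ) {N k : ℕ} (hk : k < N) :
    gaussHermite N (fun x => (X ^ m * hermitePoly k).eval x) ≤
      gaussMean (X ^ m * hermitePoly k) := by
  induction m generalizing k with
  | zero =>
    refine (gaussHermite_exact ?_).le
    rw [pow_zero, one_mul, natDegree_hermitePoly]
    omega
  | succ m ih =>
    have e : X ^ (m + 1) * hermitePoly k = (1 / 2 : ℝ) • (X ^ m * hermitePoly (k + 1))
        + (k : ℝ) • (X ^ m * hermitePoly (k - 1)) := by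
      rw [pow_succ, mul_assoc, X_mul_hermitePoly, ← C_mul', ← C_mul']
      ring
    have e2 : gaussHermite N (fun x => (X ^ (m + 1) * hermitePoly k).eval x) =
        1 / 2 * gaussHermite N (fun x => (X ^ m * hermitePoly (k + 1)).eval x)
        + k * gaussHermite N (fun x => (X ^ m * hermitePoly (k - 1)).eval x) := by
      simp only [gaussHermite, Finset.mul_sum, ← Finset.sum_add_distrib]
      refine Finset.sum_congr rfl fun s _ => ?_
      rw [e, eval_add, eval_smul, eval_smul, smul_eq_mul, smul_eq_mul]
      ring
    rw [e2, e, map_add, map_smul, map_smul, smul_eq_mul, smul_eq_mul]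
    refine add_le_add (mul_le_mul_of_nonneg_left ?_ (by norm_num))
      (mul_le_mul_of_nonneg_left (ih (by omega)) k.cast_nonneg)
    -- The boundary index k + 1 = N is the only source of strict inequality.
    rcases (Nat.succ_le_of_lt hk).lt_or_eq with h | h
    · exact ih h
    · have : gaussHermite N (fun x => (X ^ m * hermitePoly (k + 1)).eval x) = 0 := by
        refine Finset.sum_eq_zero fun s hs => ?_
        have h0 := mem_hermiteZeros.1 hs
        rw [← h] at h0
        simp only [eval_mul, h0, mul_zero]
      rw [this]
      exact gaussMean_pow_mul_hermitePoly_nonneg _ _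

theorem gaussHermite_pow_le (m : ℕ) {N : ℕ} (hN : 0 < N) :
    gaussHermite N (fun x => x ^ m) ≤ ∫ x : ℝ, x ^ m * Real.exp (-x ^ 2) := by
  simpa [hermitePoly, gaussMean_apply] using gaussHermite_pow_mul_hermitePoly_le m hN

/-- The Gauss-Hermite rule underestimates the integral of `exp ((θ - 1) x²)`. -/
theorem gaussHermite_exp_le {θ : ℝ} (h0 : 0 ≤ θ) (h1 : θ < 1) {N : ℕ} (hN : 0 < N) :
    gaussHermite N (fun x => Real.exp (θ * x ^ 2)) ≤ √(Real.pi / (1 - θ)) := by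
  -- The power series of exp(θ x²) has non-negative coefficients, so the moment inequality applies
  -- term by term to its partial sums.
  have hlim : Filter.Tendsto (fun n : ℕ => gaussHermite N fun x =>
      ∑ i ∈ Finset.range n, (θ * x ^ 2) ^ i / (i.factorial : ℝ)) Filter.atTop
      (nhds (gaussHermite N (fun x => Real.exp (θ * x ^ 2)))) := by
    refine tendsto_finsetSum _ fun s _ => Filter.Tendsto.const_mul _ ?_
    rw [Real.exp_eq_exp_ℝ]
    exact (NormedSpace.expSeries_div_hasSum_exp (θ * s ^ 2)).tendsto_sum_nat
  refine le_of_tendsto' hlim fun n => ?_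
  have hint : ∀ i : ℕ, Integrable fun x : ℝ =>
      θ ^ i / (i.factorial : ℝ) * (x ^ (2 * i) * Real.exp (-x ^ 2)) := fun i => by
    simpa using (integrable_pow_mul_exp_neg_mul_sq one_pos (2 * i)).const_mul
      (θ ^ i / (i.factorial : ℝ))
  have step : (gaussHermite N fun x => ∑ i ∈ Finset.range n, (θ * x ^ 2) ^ i / (i.factorial : ℝ))
      = ∑ i ∈ Finset.range n, θ ^ i / (i.factorial : ℝ) * gaussHermite N (fun x => x ^ (2 * i)) := by
    simp only [gaussHermite, Finset.mul_sum]
    rw [Finset.sum_comm]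
    refine Finset.sum_congr rfl fun i _ => Finset.sum_congr rfl fun s _ => ?_
    rw [mul_pow, ← pow_mul]
    ring
  rw [step]
  calc _ ≤ ∑ i ∈ Finset.range n, θ ^ i / (i.factorial : ℝ) *
        ∫ x : ℝ, x ^ (2 * i) * Real.exp (-x ^ 2) :=
        Finset.sum_le_sum fun i _ => mul_le_mul_of_nonneg_left (gaussHermite_pow_le _ hN)
          (by positivity)
    _ = ∫ x : ℝ, ∑ i ∈ Finset.range n,
          θ ^ i / (i.factorial : ℝ) * (x ^ (2 * i) * Real.exp (-x ^ 2)) := by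
        rw [integral_finsetSum _ fun i _ => hint i]
        simp only [integral_const_mul]
    _ ≤ ∫ x : ℝ, Real.exp (-(1 - θ) * x ^ 2) := by
        refine integral_mono (integrable_finsetSum _ fun i _ => hint i)
          (integrable_exp_neg_mul_sq (by linarith)) fun x => ?_
        have hs : ∑ i ∈ Finset.range n, (θ * x ^ 2) ^ i / (i.factorial : ℝ)
            ≤ Real.exp (θ * x ^ 2) :=
          Real.sum_le_exp_of_nonneg (by positivity) n
        calc _ = (∑ i ∈ Finset.range n, (θ * x ^ 2) ^ i / (i.factorial : ℝ))
              * Real.exp (-x ^ 2) := by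
              rw [Finset.sum_mul]
              refine Finset.sum_congr rfl fun i _ => ?_
              rw [mul_pow, ← pow_mul]
              ring
          _ ≤ Real.exp (θ * x ^ 2) * Real.exp (-x ^ 2) := by gcongr
          _ = _ := by rw [← Real.exp_add]; ring_nf
    _ = _ := integral_gaussian _


/-! ### Entire functions with Gaussian decay in a horizontal strip -/

/-- Entire functions bounded by `A exp (-c (Re z)²)` in the strip `|Im z| ≤ ρ`. -/
structure StripGaussian (c ρ A : ℝ) (f : ℂ → ℂ) : Prop where
  differentiable : Differentiable ℂ f
  bound : ∀ z : ℂ, |z.im| ≤ ρ → ‖f z‖ ≤ A * Real.exp (-c * z.re ^ 2)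

/-- Lets the Cauchy estimates for f bound real derivatives of its restriction. -/
theorem iteratedDeriv_comp_ofReal {f : ℂ → ℂ} (hf : Differentiable ℂ f) (n : ℕ) :
    iteratedDeriv n (fun x : ℝ => f x) = fun x : ℝ => iteratedDeriv n f x := by
  induction n with
  | zero => simp
  | succ n ih =>
    rw [iteratedDeriv_succ, ih]
    funext x
    rw [iteratedDeriv_succ]
    have hd : DifferentiableAt ℂ (iteratedDeriv n f) x :=
      (hf.contDiff (n := ⊤)).differentiable_iteratedDeriv n (by exact_mod_cast WithTop.coe_lt_top _) x
    exact hd.hasDerivAt.comp_ofReal.deriv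

namespace StripGaussian

variable {c ρ A : ℝ} {f : ℂ → ℂ}

theorem norm_ofReal_le (h : StripGaussian c ρ A f) (hρ : 0 ≤ ρ) (x : ℝ) :
    ‖f x‖ ≤ A * Real.exp (-c * x ^ 2) := by
  simpa using h.bound x (by simpa using hρ)

theorem nonneg (h : StripGaussian c ρ A f) (hρ : 0 ≤ ρ) : 0 ≤ A := by
  simpa using (norm_nonneg _).trans (h.norm_ofReal_le hρ 0)

theorem continuous_ofReal (h : StripGaussian c ρ A f) : Continuous fun x : ℝ => f x :=
  h.differentiable.continuous.comp Complex.continuous_ofReal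

theorem contDiff_ofReal (h : StripGaussian c ρ A f) (n : WithTop ℕ∞) :
    ContDiff ℝ n fun x : ℝ => f x :=
  (h.differentiable.contDiff.restrict_scalars ℝ).comp Complex.ofRealCLM.contDiff

/-- Cauchy estimates on the circle of radius ρ about x, which stays in the strip. -/
theorem norm_iteratedDeriv_le (h : StripGaussian c ρ A f) (hρ : 0 < ρ) (hc : 0 ≤ c) (n : ℕ)
    (x : ℝ) : ‖iteratedDeriv n (fun x : ℝ => f x) x‖ ≤
      n.factorial / ρ ^ n * Real.exp (c * ρ ^ 2) * A * Real.exp (-(c / 2) * x ^ 2) := by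
  rw [iteratedDeriv_comp_ofReal h.differentiable]
  have hb : ∀ z ∈ Metric.sphere (x : ℂ) ρ, ‖f z‖ ≤
      A * (Real.exp (c * ρ ^ 2) * Real.exp (-(c / 2) * x ^ 2)) := by
    intro z hz
    rw [mem_sphere_iff_norm] at hz
    have h1 : |(z - x).im| ≤ ρ := hz ▸ Complex.abs_im_le_norm _
    have h2 : |(z - x).re| ≤ ρ := hz ▸ Complex.abs_re_le_norm _
    simp only [Complex.sub_im, Complex.ofReal_im, sub_zero, Complex.sub_re, Complex.ofReal_re]
      at h1 h2
    refine (h.bound z h1).trans (mul_le_mul_of_nonneg_left ?_ (h.nonneg hρ.le))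
    rw [← Real.exp_add, Real.exp_le_exp]
    have h3 : (z.re - x) ^ 2 ≤ ρ ^ 2 := sq_le_sq' (abs_le.1 h2).1 (abs_le.1 h2).2
    -- Moving by at most ρ costs half of the Gaussian rate and a factor exp(c ρ²).
    have h4 : x ^ 2 / 2 - ρ ^ 2 ≤ z.re ^ 2 := by nlinarith [sq_nonneg (2 * z.re - x)]
    nlinarith [mul_le_mul_of_nonneg_left h4 hc]
  refine (Complex.norm_iteratedDeriv_le_of_forall_mem_sphere_norm_le n hρ
    h.differentiable.diffContOnCl hb).trans (le_of_eq ?_)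
  ring

theorem integrable_iteratedDeriv (h : StripGaussian c ρ A f) (hρ : 0 < ρ) (hc : 0 < c) (n : ℕ) :
    Integrable (iteratedDeriv n fun x : ℝ => f x) := by
  refine ((integrable_exp_neg_mul_sq (half_pos hc)).const_mul
    (n.factorial / ρ ^ n * Real.exp (c * ρ ^ 2) * A)).mono' ?_
    (Filter.Eventually.of_forall fun x => h.norm_iteratedDeriv_le hρ hc.le n x)
  exact ((h.contDiff_ofReal ⊤).continuous_iteratedDeriv n le_top).aestronglyMeasurable

theorem integrable_ofReal (h : StripGaussian c ρ A f) (hρ : 0 < ρ) (hc : 0 < c) :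
    Integrable fun x : ℝ => f x := by
  simpa using h.integrable_iteratedDeriv hρ hc 0

theorem norm_integral_le (h : StripGaussian c ρ A f) (hρ : 0 < ρ) (hc : 0 < c) :
    ‖∫ x : ℝ, f x‖ ≤ A * √(Real.pi / c) := by
  refine (norm_integral_le_of_norm_le ((integrable_exp_neg_mul_sq hc).const_mul A)
    (Filter.Eventually.of_forall fun x => h.norm_ofReal_le hρ.le x)).trans (le_of_eq ?_)
  rw [integral_const_mul, integral_gaussian]

open FourierTransform in
-- Each derivative becomes a factor 2πiξ, and the transform is bounded by the L¹ norm; the surplus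
-- 2π ≥ 1 is dropped.
theorem pow_mul_norm_fourier_le (h : StripGaussian c ρ A f) (hρ : 0 < ρ) (hc : 0 < c) (n : ℕ)
    (ξ : ℝ) : |ξ| ^ n * ‖𝓕 (fun x : ℝ => f x) ξ‖ ≤
      n.factorial / ρ ^ n * Real.exp (c * ρ ^ 2) * √(Real.pi / (c / 2)) * A := by
  have h1 := congrFun (Real.fourier_iteratedDeriv (n := n) (N := ⊤)
    (h.contDiff_ofReal _) (fun m _ => h.integrable_iteratedDeriv hρ hc m) le_top) ξ
  have h2 : ‖𝓕 (iteratedDeriv n fun x : ℝ => f x) ξ‖ ≤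
      n.factorial / ρ ^ n * Real.exp (c * ρ ^ 2) * √(Real.pi / (c / 2)) * A := by
    refine (VectorFourier.norm_fourierIntegral_le_integral_norm _ _ _ _ _).trans ?_
    refine (integral_mono (h.integrable_iteratedDeriv hρ hc n).norm
      ((integrable_exp_neg_mul_sq (half_pos hc)).const_mul _)
      (fun x => h.norm_iteratedDeriv_le hρ hc.le n x)).trans (le_of_eq ?_)
    rw [integral_const_mul, integral_gaussian]
    ring
  rw [h1, norm_smul, norm_pow] at h2
  refine le_trans (mul_le_mul_of_nonneg_right (pow_le_pow_left₀ (abs_nonneg _) ?_ n)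
    (norm_nonneg _)) h2
  have : ‖(2 * Real.pi * Complex.I * ξ : ℂ)‖ = 2 * Real.pi * |ξ| := by
    simp [abs_of_pos Real.pi_pos]
  rw [this]
  nlinarith [Real.pi_gt_three, abs_nonneg ξ]

/-- Since Re z² ≤ (Re z)², part of the Gaussian decay can be divided out while the rest survives.
The Gauss-Hermite estimate uses this to split off its own Gaussian. -/
theorem mul_cexp (h : StripGaussian c ρ A f) (hρ : 0 ≤ ρ) {b : ℝ} (hb : 0 ≤ b) :
    StripGaussian (c - b) ρ A fun z => f z * Complex.exp (b * z ^ 2) where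
  differentiable := h.differentiable.mul (by fun_prop)
  bound z hz := by
    rw [norm_mul, Complex.norm_exp]
    have e : ((b : ℂ) * z ^ 2).re = b * (z.re ^ 2 - z.im ^ 2) := by
      simp [sq]
    calc _ ≤ A * Real.exp (-c * z.re ^ 2) * Real.exp (b * z.re ^ 2) := by
          rw [e]
          gcongr
          · exact mul_nonneg (h.nonneg hρ) (Real.exp_pos _).le
          · exact h.bound z hz
          · nlinarith [sq_nonneg z.im]
      _ = _ := by rw [mul_assoc, ← Real.exp_add]; ring_nf

theorem comp_mul (h : StripGaussian c ρ A f) {a : ℝ} (ha : 0 < a) :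
    StripGaussian (c * a ^ 2) (ρ / a) A fun z => f (a * z) where
  differentiable := h.differentiable.comp (by fun_prop)
  bound z hz := by
    have := h.bound (a * z) (by
      rw [le_div_iff₀ ha] at hz
      simpa [abs_mul, abs_of_pos ha, mul_comm] using hz)
    refine this.trans (le_of_eq ?_)
    simp
    ring_nf
    simp

end StripGaussian

theorem stripGaussian_gaussian {c ρ : ℝ} (hc : 0 ≤ c) :
    StripGaussian c ρ (Real.exp (c * ρ ^ 2)) fun z => Complex.exp (-c * z ^ 2) where
  differentiable := by fun_prop
  bound z hz := by
    rw [Complex.norm_exp, ← Real.exp_add, Real.exp_le_exp]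
    have e : (-(c : ℂ) * z ^ 2).re = -c * (z.re ^ 2 - z.im ^ 2) := by
      simp [sq]
    have h3 : z.im ^ 2 ≤ ρ ^ 2 := sq_le_sq' (abs_le.1 hz).1 (abs_le.1 hz).2
    rw [e]
    nlinarith


/-! ### The compound midpoint rule -/

/-- The linear Taylor term at the centre integrates to zero over the symmetric cell; two mean value
inequalities bound the remainder by M a² on a cell of length 2a. -/
theorem norm_midpoint_cell_le {φ : ℝ → ℂ} {M : ℝ} (hφ : ContDiff ℝ 2 φ)
    (hM : ∀ x, ‖iteratedDeriv 2 φ x‖ ≤ M) (m : ℝ) {a : ℝ} (ha : 0 ≤ a) :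
    ‖(2 * a : ℂ) * φ m - ∫ t in (m - a)..(m + a), φ t‖ ≤ 2 * a ^ 3 * M := by
  have hd1 : ∀ x, HasDerivAt φ (deriv φ x) x := fun x =>
    (hφ.differentiable (by norm_num) x).hasDerivAt
  have hd2 : ∀ x, HasDerivAt (deriv φ) (iteratedDeriv 2 φ x) x := fun x => by
    have h := (hφ.differentiable_iteratedDeriv 1 (by norm_num) x).hasDerivAt
    rw [← iteratedDeriv_succ, iteratedDeriv_one] at h
    exact h
  have hM0 : 0 ≤ M := (norm_nonneg _).trans (hM 0)
  set s := Set.Icc (m - a) (m + a) with hs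
  have hms : m ∈ s := ⟨by linarith, by linarith⟩
  have habs : ∀ x ∈ s, |x - m| ≤ a := fun x hx => abs_le.2 ⟨by linarith [hx.1], by linarith [hx.2]⟩
  have h1 : ∀ x ∈ s, ‖deriv φ x - deriv φ m‖ ≤ M * a := fun x hx =>
    ((convex_Icc _ _).norm_image_sub_le_of_norm_hasDerivWithin_le
      (fun y _ => (hd2 y).hasDerivWithinAt) (fun y _ => hM y) hms hx).trans
      (mul_le_mul_of_nonneg_left (habs x hx) hM0)
  have hlin : ∀ x, HasDerivAt (fun x : ℝ => (((x - m : ℝ)) : ℂ) * deriv φ m) (deriv φ m) x := by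
    intro x
    have : HasDerivAt (fun x : ℝ => ((x - m : ℝ) : ℂ)) 1 x := by
      simpa using ((hasDerivAt_id x).sub_const m).ofReal_comp
    simpa using this.mul_const (deriv φ m)
  have h2 : ∀ x ∈ s, ‖φ x - φ m - ((x - m : ℝ) : ℂ) * deriv φ m‖ ≤ M * a * a := by
    intro x hx
    have := ((convex_Icc _ _).norm_image_sub_le_of_norm_hasDerivWithin_le
      (fun y _ => ((hd1 y).sub (hlin y)).hasDerivWithinAt) h1 hms hx).trans
      (mul_le_mul_of_nonneg_left (habs x hx) (by positivity))
    refine le_trans (le_of_eq ?_) this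
    congr 1
    simp
    ring
  have hint : ∫ t in (m - a)..(m + a), ((t - m : ℝ) : ℂ) * deriv φ m = 0 := by
    have h0 : ∫ t in (m - a)..(m + a), (t - m) = 0 := by
      simp [intervalIntegral.integral_sub, integral_id]
      ring
    rw [intervalIntegral.integral_mul_const, intervalIntegral.integral_ofReal, h0]
    simp
  have hc : Continuous φ := hφ.continuous
  have key : ∫ t in (m - a)..(m + a), (φ t - φ m - ((t - m : ℝ) : ℂ) * deriv φ m) =
      (∫ t in (m - a)..(m + a), φ t) - (2 * a : ℂ) * φ m := by
    rw [intervalIntegral.integral_sub, intervalIntegral.integral_sub, hint,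
      intervalIntegral.integral_const]
    · rw [sub_zero, Complex.real_smul]
      congr 2
      push_cast
      ring
    all_goals exact Continuous.intervalIntegrable (by fun_prop) _ _
  rw [norm_sub_rev, ← key]
  refine (intervalIntegral.norm_integral_le_of_norm_le_const (C := M * a * a) ?_).trans
    (le_of_eq ?_)
  · intro x hx
    rw [Set.uIoc_of_le (by linarith)] at hx
    exact h2 x ⟨hx.1.le, hx.2⟩
  · rw [show m + a - (m - a) = 2 * a by ring, abs_of_nonneg (by positivity)]
    ring

theorem norm_midpoint_interval_le {φ : ℝ → ℂ} {M : ℝ} (hφ : ContDiff ℝ 2 φ)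
    (hM : ∀ x, ‖iteratedDeriv 2 φ x‖ ≤ M) {L : ℝ} (hL : 0 < L) {N : ℕ} (hN : 0 < N) :
    ‖(∑ j : Fin N, ((2 * L / N : ℝ) : ℂ) * φ (-L + (2 * ((j : ℕ) : ℝ) + 1) / 2 * (2 * L / N))) -
      ∫ t in (-L)..L, φ t‖ ≤ 2 * L ^ 3 * M / N ^ 2 := by
  have hN' : (0 : ℝ) < N := Nat.cast_pos.2 hN
  set H : ℝ := 2 * L / N with hH
  have hsum := intervalIntegral.sum_integral_adjacent_intervals (μ := volume) (f := φ)
    (a := fun k : ℕ => -L + k * H) (n := N)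
    (fun k _ => hφ.continuous.intervalIntegrable _ _)
  have e1 : -L + ((0 : ℕ) : ℝ) * H = -L := by simp
  have e2 : -L + (N : ℝ) * H = L := by rw [hH]; field_simp; ring
  simp only [e1, e2] at hsum
  rw [← hsum, Fin.sum_univ_eq_sum_range
    (fun j : ℕ => (H : ℂ) * φ (-L + (2 * (j : ℝ) + 1) / 2 * H)) N, ← Finset.sum_sub_distrib]
  refine (norm_sum_le _ _).trans ((Finset.sum_le_card_nsmul _ _ (2 * (H / 2) ^ 3 * M)
    fun j _ => ?_).trans (le_of_eq ?_))
  · have h1 := norm_midpoint_cell_le hφ hM (-L + (2 * (j : ℝ) + 1) / 2 * H) (a := H / 2)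
      (by positivity)
    have e3 : (2 * ((H / 2 : ℝ) : ℂ)) = H := by push_cast; ring
    have e4 : -L + (2 * (j : ℝ) + 1) / 2 * H - H / 2 = -L + j * H := by ring
    have e5 : -L + (2 * (j : ℝ) + 1) / 2 * H + H / 2 = -L + ((j + 1 : ℕ) : ℝ) * H := by
      push_cast; ring
    rwa [e3, e4, e5] at h1
  · rw [Finset.card_range, nsmul_eq_mul, hH]
    field_simp

/-- Error on [-L, L] by the second derivative, plus the discarded tail. Half of the Gaussian rate
makes the tail small, the other half keeps it integrable. -/
theorem StripGaussian.norm_midpoint_sub_integral_le {c ρ A : ℝ} {f : ℂ → ℂ}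
    (h : StripGaussian c ρ A f) (hρ : 0 < ρ) (hc : 0 < c) {L : ℝ} (hL : 0 < L)
    {N : ℕ} (hN : 0 < N) :
    ‖(∑ j : Fin N, ((2 * L / N : ℝ) : ℂ) *
        f ((-L + (2 * ((j : ℕ) : ℝ) + 1) / 2 * (2 * L / N) : ℝ) : ℂ)) - ∫ x : ℝ, f x‖ ≤
      A * (√(Real.pi / (c / 2)) * Real.exp (-(c / 2) * L ^ 2) +
        4 / ρ ^ 2 * Real.exp (c * ρ ^ 2) * L ^ 3 / N ^ 2) := by
  have hA := h.nonneg hρ.le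
  have h1 := norm_midpoint_interval_le (M := 2 / ρ ^ 2 * Real.exp (c * ρ ^ 2) * A)
    (h.contDiff_ofReal 2) (fun x => by
      refine (h.norm_iteratedDeriv_le hρ hc.le 2 x).trans ?_
      have : Real.exp (-(c / 2) * x ^ 2) ≤ 1 := Real.exp_le_one_iff.2 (by nlinarith [sq_nonneg x])
      simpa using mul_le_of_le_one_right (by positivity) this) hL hN
  have h2 : ‖(∫ t in (-L)..L, f t) - ∫ x : ℝ, f x‖ ≤
      A * (√(Real.pi / (c / 2)) * Real.exp (-(c / 2) * L ^ 2)) := by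
    have hi := h.integrable_ofReal hρ hc
    rw [intervalIntegral.integral_of_le (by linarith),
      ← integral_add_compl (measurableSet_Ioc (a := -L) (b := L)) hi, sub_add_cancel_left, norm_neg]
    have hg : Integrable fun x : ℝ => A * Real.exp (-(c / 2) * L ^ 2) *
        Real.exp (-(c / 2) * x ^ 2) := (integrable_exp_neg_mul_sq (half_pos hc)).const_mul _
    refine (norm_integral_le_of_norm_le hg.integrableOn
      ((ae_restrict_iff' measurableSet_Ioc.compl).2 (Filter.Eventually.of_forall
        fun x hx => ?_))).trans ?_
    · refine (h.norm_ofReal_le hρ.le x).trans ?_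
      rw [mul_assoc, ← Real.exp_add]
      refine mul_le_mul_of_nonneg_left (Real.exp_le_exp.2 ?_) hA
      have : L ^ 2 ≤ x ^ 2 := by
        by_contra! hlt
        have := abs_lt_of_sq_lt_sq' hlt hL.le
        exact hx ⟨this.1, this.2.le⟩
      nlinarith
    · refine (setIntegral_le_integral hg (Filter.Eventually.of_forall fun x => by positivity)).trans
        (le_of_eq ?_)
      rw [integral_const_mul, integral_gaussian]
      ring
  have h3 := norm_add_le_of_le h1 h2
  rw [sub_add_sub_cancel] at h3
  refine h3.trans (le_of_eq ?_)
  ring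

/-! ### Infinite Riemann sums -/

theorem summable_exp_neg_mul_int_sq {a : ℝ} (ha : 0 < a) :
    Summable fun j : ℤ => Real.exp (-a * (j : ℝ) ^ 2) := by
  have h := ((isLittleO_exp_neg_mul_sq_cocompact (a := a) (by simpa using ha)
    (-2)).isBigO.comp_tendsto Int.tendsto_coe_cofinite)
  have := summable_of_isBigO (Real.summable_abs_int_rpow one_lt_two) h
  refine this.norm.congr fun j => ?_
  rw [Function.comp_apply, Complex.norm_exp]
  congr 1
  simp [sq]

open FourierTransform in
theorem mul_fourier_comp_mul (φ : ℝ → ℂ) {h : ℝ} (hh : 0 < h) (ξ : ℝ) :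
    (h : ℂ) * 𝓕 (fun x : ℝ => φ (h * x)) ξ = 𝓕 φ (ξ / h) := by
  rw [Real.fourier_real_eq_integral_exp_smul, Real.fourier_real_eq_integral_exp_smul]
  have := Measure.integral_comp_mul_left
    (fun v : ℝ => Complex.exp (↑(-2 * Real.pi * v * (ξ / h)) * Complex.I) • φ v) h
  have e : ∀ x : ℝ, -2 * Real.pi * (h * x) * (ξ / h) = -2 * Real.pi * x * ξ := fun x => by
    field_simp
  simp only [e] at this
  rw [this, abs_of_pos (inv_pos.2 hh), Complex.real_smul, ← mul_assoc]
  have : (h : ℂ) * ((h⁻¹ : ℝ) : ℂ) = 1 := by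
    rw [← Complex.ofReal_mul, mul_inv_cancel₀ hh.ne', Complex.ofReal_one]
  rw [this, one_mul]

open FourierTransform in
/-- Riemann sums over `hℤ` converge faster than any power of `h`. -/
theorem exists_norm_riemann_sub_integral_le {c ρ : ℝ} (hρ : 0 < ρ) (hc : 0 < c) {k : ℕ}
    (hk : 2 ≤ k) : ∃ K > 0, ∀ (A : ℝ) (f : ℂ → ℂ) (h : ℝ), StripGaussian c ρ A f → 0 < h →
      ‖(∑' j : ℤ, (h : ℂ) * f (((j : ℝ) * h : ℝ) : ℂ)) - ∫ x : ℝ, f x‖ ≤ A * (K * h ^ k) := by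
  set K₀ := k.factorial / ρ ^ k * Real.exp (c * ρ ^ 2) * √(Real.pi / (c / 2)) with hK₀
  set Z := ∑' n : ℤ, |1 / (n : ℝ) ^ k| with hZ
  have hZs : Summable fun n : ℤ => |1 / (n : ℝ) ^ k| :=
    (Real.summable_one_div_int_pow.2 (by omega)).abs
  have hK₀p : 0 ≤ K₀ := by positivity
  have hZp : 0 ≤ Z := tsum_nonneg fun _ => abs_nonneg _
  refine ⟨K₀ * Z + 1, by positivity, fun A f h hf hh => ?_⟩
  have hA := hf.nonneg hρ.le
  have hfh := hf.comp_mul hh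
  -- Frequency n/h is at least 1/h in modulus, so k-th power decay of the transform yields the
  -- factor h^k. In Z the index n = 0 contributes nothing, as 1/0 = 0.
  have hFb : ∀ n : ℤ, n ≠ 0 → ‖𝓕 (fun x : ℝ => f x) (n / h)‖ ≤ A * K₀ * h ^ k * |1 / (n : ℝ) ^ k| := by
    intro n hn
    have h1 := hf.pow_mul_norm_fourier_le hρ hc k (n / h)
    have hn' : 0 < |(n : ℝ)| := abs_pos.2 (Int.cast_ne_zero.2 hn)
    rw [abs_div, abs_of_pos hh, div_pow, div_mul_eq_mul_div, div_le_iff₀ (by positivity)] at h1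
    rw [abs_div, abs_one, abs_pow, mul_one_div, le_div_iff₀ (by positivity)]
    rw [← hK₀] at h1
    linarith
  have hsumm : Summable fun n : ℤ => 𝓕 (fun x : ℝ => f x) (n / h) := by
    refine Summable.of_norm_bounded_eventually (g := fun n : ℤ => A * K₀ * h ^ k * |1 / (n : ℝ) ^ k|)
      (hZs.mul_left _) ?_
    filter_upwards [(Set.finite_singleton (0 : ℤ)).compl_mem_cofinite] with n hn
    exact hFb n hn
  have hdecay : (fun x : ℝ => f (h * x)) =O[Filter.cocompact ℝ] fun x : ℝ => |x| ^ (-(2 : ℝ)) := by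
    refine Asymptotics.IsBigO.trans (g := fun x : ℝ => Complex.exp (-((c * h ^ 2 : ℝ) : ℂ) * x ^ 2)) ?_
      (isLittleO_exp_neg_mul_sq_cocompact (by rw [Complex.ofReal_re]; positivity) (-2)).isBigO
    refine Asymptotics.IsBigO.of_bound A (Filter.Eventually.of_forall fun x => ?_)
    refine (hfh.norm_ofReal_le (by positivity) x).trans (le_of_eq ?_)
    rw [Complex.norm_exp]
    congr 2
    simp [sq]
  -- Poisson summation: the zero frequency is the integral itself, so the error is the sum over n ≠
  -- 0.
  have hpoisson := Real.tsum_eq_tsum_fourier_of_rpow_decay_of_summable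
    (f := fun x : ℝ => f (h * x)) (by simpa using hfh.continuous_ofReal) one_lt_two hdecay
    (by
      refine (hsumm.mul_left ((h : ℂ)⁻¹)).congr fun n => ?_
      have := mul_fourier_comp_mul (fun x : ℝ => f x) hh n
      rw [← this]
      simp only [Complex.ofReal_mul]
      rw [inv_mul_cancel_left₀ (Complex.ofReal_ne_zero.2 hh.ne')]) 0
  simp only [zero_add, QuotientAddGroup.mk_zero, fourier_eval_zero, mul_one] at hpoisson
  have e1 : ∑' j : ℤ, (h : ℂ) * f (((j : ℝ) * h : ℝ) : ℂ) =
      ∑' n : ℤ, 𝓕 (fun x : ℝ => f x) (n / h) := by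
    rw [tsum_mul_left]
    have : ∀ j : ℤ, f (((j : ℝ) * h : ℝ) : ℂ) = f (h * ((j : ℝ) : ℂ)) := fun j => by
      congr 1; push_cast; ring
    simp_rw [this]
    rw [hpoisson, ← tsum_mul_left]
    refine tsum_congr fun n => ?_
    have := mul_fourier_comp_mul (fun x : ℝ => f x) hh n
    rw [← this]
    simp only [Complex.ofReal_mul]
  have e2 : 𝓕 (fun x : ℝ => f x) (((0 : ℤ) : ℝ) / h) = ∫ x : ℝ, f x := by
    rw [Real.fourier_real_eq_integral_exp_smul]
    simp
  rw [e1, hsumm.tsum_eq_add_tsum_ite 0, e2, add_sub_cancel_left]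
  have hb : ∀ n : ℤ, ‖(if n = 0 then 0 else 𝓕 (fun x : ℝ => f x) (n / h))‖ ≤
      A * K₀ * h ^ k * |1 / (n : ℝ) ^ k| := by
    intro n
    split_ifs with hn
    · rw [norm_zero]; positivity
    · exact hFb n hn
  refine (tsum_of_norm_bounded (hZs.mul_left _).hasSum hb).trans ?_
  rw [tsum_mul_left, ← hZ]
  have : 0 ≤ A * h ^ k := by positivity
  nlinarith

/-- Gaussian Riemann sums over `hℤ` are bounded by a multiple of `1 + h`. -/
theorem exists_tsum_exp_neg_le {c : ℝ} (hc : 0 < c) : ∃ K > 0, ∀ h : ℝ, 0 < h →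
    ∑' j : ℤ, h * Real.exp (-c * ((j : ℝ) * h) ^ 2) ≤ K * (1 + h) := by
  obtain ⟨K, hK, hb⟩ := exists_norm_riemann_sub_integral_le one_pos hc le_rfl
  set S := ∑' j : ℤ, Real.exp (-c * (j : ℝ) ^ 2) with hS
  have hSs := summable_exp_neg_mul_int_sq hc
  have hS0 : 0 ≤ S := tsum_nonneg fun _ => (Real.exp_pos _).le
  have hG := stripGaussian_gaussian (ρ := 1) hc.le
  have hpi := Real.sqrt_nonneg (Real.pi / c)
  have hE : 0 < Real.exp (c * 1 ^ 2) := Real.exp_pos _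
  set E := Real.exp (c * 1 ^ 2)
  refine ⟨S + √(Real.pi / c) * E + E * K, by positivity, fun h hh => ?_⟩
  rcases le_total h 1 with h1 | h1
  · have h2 := hb _ _ h hG hh
    have h3 := hG.norm_integral_le one_pos hc
    have h4 : ((∑' j : ℤ, h * Real.exp (-c * ((j : ℝ) * h) ^ 2) : ℝ) : ℂ) =
        ∑' j : ℤ, (h : ℂ) * Complex.exp (-c * (((j : ℝ) * h : ℝ) : ℂ) ^ 2) := by
      rw [Complex.ofReal_tsum]
      push_cast
      rfl
    rw [← h4] at h2
    have h5 := norm_le_norm_add_norm_sub' (((∑' j : ℤ, h * Real.exp (-c * ((j : ℝ) * h) ^ 2) : ℝ) : ℂ))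
      (∫ x : ℝ, Complex.exp (-c * (x : ℂ) ^ 2))
    rw [Complex.norm_real] at h5
    have h6 := (le_abs_self _).trans h5
    have h7 : K * h ^ 2 ≤ K := mul_le_of_le_one_right hK.le (pow_le_one₀ hh.le h1)
    have h9 : E * (K * h ^ 2) ≤ E * K := by gcongr
    have h10 : 0 ≤ (S + √(Real.pi / c) * E + E * K) * h := by
      positivity
    nlinarith
  · have h2 : ∑' j : ℤ, h * Real.exp (-c * ((j : ℝ) * h) ^ 2) ≤ h * S := by
      rw [tsum_mul_left]
      refine mul_le_mul_of_nonneg_left (Summable.tsum_le_tsum (fun j => ?_) ?_ hSs) hh.le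
      · refine Real.exp_le_exp.2 ?_
        have : (j : ℝ) ^ 2 * 1 ≤ (j : ℝ) ^ 2 * h ^ 2 :=
          mul_le_mul_of_nonneg_left (one_le_pow₀ h1) (sq_nonneg _)
        rw [mul_pow]
        nlinarith
      · refine (summable_exp_neg_mul_int_sq (a := c * h ^ 2) (by positivity)).congr fun j => ?_
        congr 1
        ring
    refine h2.trans ?_
    have : 0 ≤ (√(Real.pi / c) * E + E * K) * (1 + h) := by
      positivity
    nlinarith


/-! ### The error of the Gauss-Hermite rule -/

/-- The error functional of the `N`-point Gauss-Hermite rule with weight `exp (-x²)`. -/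
noncomputable def hermiteDefect (N : ℕ) (g : ℝ → ℂ) : ℂ :=
  (∑ s ∈ hermiteZeros N, (hermiteWeight N s : ℂ) * g s) - ∫ u : ℝ, g u * (Real.exp (-u ^ 2) : ℂ)

theorem integrable_mul_exp_neg_sq {g : ℝ → ℂ} (hg : Continuous g) {B θ : ℝ} (hθ : θ < 1)
    (h : ∀ u, ‖g u‖ ≤ B * Real.exp (θ * u ^ 2)) :
    Integrable fun u : ℝ => g u * (Real.exp (-u ^ 2) : ℂ) := by
  refine ((integrable_exp_neg_mul_sq (sub_pos.2 hθ)).const_mul B).mono'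
    (Continuous.aestronglyMeasurable (by fun_prop)) (Filter.Eventually.of_forall fun u => ?_)
  rw [norm_mul, Complex.norm_real, Real.norm_of_nonneg (Real.exp_pos _).le]
  refine (mul_le_mul_of_nonneg_right (h u) (Real.exp_pos _).le).trans (le_of_eq ?_)
  rw [mul_assoc, ← Real.exp_add]
  ring_nf

/-- Both the rule and the weighted integral of exp(θ u²) are at most √(π/(1-θ)), so the defect is
controlled on functions of that growth. -/
theorem norm_hermiteDefect_le {g : ℝ → ℂ} {B θ : ℝ} (hB : 0 ≤ B) (h0 : 0 ≤ θ) (h1 : θ < 1)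
    (h : ∀ u, ‖g u‖ ≤ B * Real.exp (θ * u ^ 2)) {N : ℕ} (hN : 0 < N) :
    ‖hermiteDefect N g‖ ≤ 2 * B * √(Real.pi / (1 - θ)) := by
  have e1 : ‖∑ s ∈ hermiteZeros N, (hermiteWeight N s : ℂ) * g s‖ ≤ B * √(Real.pi / (1 - θ)) := by
    refine le_trans ?_ (mul_le_mul_of_nonneg_left (gaussHermite_exp_le h0 h1 hN) hB)
    rw [gaussHermite, Finset.mul_sum]
    refine norm_sum_le_of_le _ fun s _ => ?_
    rw [norm_mul, Complex.norm_real, Real.norm_of_nonneg (hermiteWeight_nonneg _ _)]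
    refine (mul_le_mul_of_nonneg_left (h s) (hermiteWeight_nonneg _ _)).trans (le_of_eq ?_)
    ring
  have e2 : ‖∫ u : ℝ, g u * (Real.exp (-u ^ 2) : ℂ)‖ ≤ B * √(Real.pi / (1 - θ)) := by
    refine (norm_integral_le_of_norm_le
      ((integrable_exp_neg_mul_sq (sub_pos.2 h1)).const_mul B)
      (Filter.Eventually.of_forall fun u => ?_)).trans (le_of_eq ?_)
    · rw [norm_mul, Complex.norm_real, Real.norm_of_nonneg (Real.exp_pos _).le]
      refine (mul_le_mul_of_nonneg_right (h u) (Real.exp_pos _).le).trans (le_of_eq ?_)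
      rw [mul_assoc, ← Real.exp_add]
      ring_nf
    · rw [integral_const_mul, integral_gaussian]
  exact (norm_sub_le_of_le e1 e2).trans (le_of_eq (by ring))

theorem hermiteDefect_polynomial {N : ℕ} {p : ℂ[X]} (hp : p.natDegree < 2 * N) :
    hermiteDefect N (fun u => p.eval (u : ℂ)) = 0 := by
  have hi : ∀ m : ℕ, Integrable fun u : ℝ => p.coeff m * (((u ^ m * Real.exp (-u ^ 2) : ℝ)) : ℂ) := by
    intro m
    have h : Integrable fun u : ℝ => u ^ m * Real.exp (-u ^ 2) := by
      simpa using integrable_pow_mul_exp_neg_mul_sq one_pos m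
    exact h.ofReal.const_mul _
  have e : ∀ u : ℝ, p.eval (u : ℂ) * (Real.exp (-u ^ 2) : ℂ) =
      ∑ m ∈ Finset.range (2 * N), p.coeff m * (((u ^ m * Real.exp (-u ^ 2) : ℝ)) : ℂ) := by
    intro u
    rw [Polynomial.eval_eq_sum_range' hp, Finset.sum_mul]
    refine Finset.sum_congr rfl fun m _ => ?_
    push_cast
    ring
  rw [hermiteDefect]
  simp_rw [e]
  rw [integral_finsetSum _ fun m _ => hi m, sub_eq_zero]
  simp_rw [Polynomial.eval_eq_sum_range' hp, Finset.mul_sum]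
  rw [Finset.sum_comm]
  refine Finset.sum_congr rfl fun m hm => ?_
  rw [integral_const_mul, integral_complex_ofReal]
  have := gaussHermite_exact (N := N) (p := X ^ m) (by
    rw [natDegree_X_pow]; exact Finset.mem_range.1 hm)
  simp only [eval_pow, eval_X, gaussMean_apply] at this
  rw [← this, gaussHermite, Complex.ofReal_sum, Finset.mul_sum]
  refine Finset.sum_congr rfl fun s _ => ?_
  push_cast
  ring

/-! ### Taylor approximation of modulated Gaussians -/

/-- In the tail of the exponential series r^n ≤ r^k termwise. This trades a slightly larger exponent
for geometric decay in n. -/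
theorem exp_sub_sum_le {r t : ℝ} (hr : 1 ≤ r) (ht : 0 ≤ t) (n : ℕ) :
    r ^ n * (Real.exp t - ∑ k ∈ Finset.range n, t ^ k / (k.factorial : ℝ)) ≤ Real.exp (r * t) := by
  have hs : ∀ x : ℝ, HasSum (fun k : ℕ => x ^ k / (k.factorial : ℝ)) (Real.exp x) := fun x => by
    rw [Real.exp_eq_exp_ℝ]
    exact NormedSpace.expSeries_div_hasSum_exp x
  have h1 := (hasSum_nat_add_iff' n).2 (hs t)
  have h2 := (hasSum_nat_add_iff' n).2 (hs (r * t))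
  have h3 := hasSum_le (fun k => ?_) (h1.mul_left (r ^ n)) h2
  · refine h3.trans (sub_le_self _ (Finset.sum_nonneg fun k _ => ?_))
    positivity
  · have : r ^ n ≤ r ^ (k + n) := pow_le_pow_right₀ hr (by omega)
    rw [mul_pow, mul_div_assoc]
    exact mul_le_mul_of_nonneg_right this (by positivity)

theorem norm_cexp_sub_sum_le {r : ℝ} (hr : 1 ≤ r) (a : ℂ) (n : ℕ) :
    ‖Complex.exp a - ∑ k ∈ Finset.range n, a ^ k / (k.factorial : ℂ)‖ ≤
      Real.exp (r * ‖a‖) / r ^ n := by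
  rw [le_div_iff₀ (by positivity)]
  refine le_trans ?_ (exp_sub_sum_le hr (norm_nonneg a) n)
  rw [mul_comm]
  exact mul_le_mul_of_nonneg_left (Complex.norm_exp_sub_sum_le_exp_norm_sub_sum a n) (by positivity)

theorem norm_sum_pow_div_factorial_le (a : ℂ) (n : ℕ) :
    ‖∑ k ∈ Finset.range n, a ^ k / (k.factorial : ℂ)‖ ≤ Real.exp ‖a‖ := by
  refine (norm_sum_le _ _).trans (le_trans (le_of_eq ?_)
    (Real.sum_le_exp_of_nonneg (norm_nonneg a) n))
  simp

/-- The function `exp ((1 - b) u² + 2 π i ξ u)`. -/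
noncomputable def gaussWave (b ξ u : ℝ) : ℂ :=
  Complex.exp ((1 - b) * u ^ 2) * Complex.exp ((2 * Real.pi * ξ * u : ℝ) * Complex.I)

theorem norm_gaussWave (b ξ u : ℝ) : ‖gaussWave b ξ u‖ = Real.exp ((1 - b) * u ^ 2) := by
  rw [gaussWave, norm_mul, Complex.norm_exp_ofReal_mul_I, mul_one, Complex.norm_exp]
  congr 1
  norm_cast

theorem continuous_gaussWave (b ξ : ℝ) : Continuous (gaussWave b ξ) := by
  unfold gaussWave
  fun_prop

/-- The Taylor polynomials of `gaussWave`. -/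
noncomputable def gaussWavePoly (b ξ : ℝ) (n : ℕ) : ℂ[X] :=
  (∑ k ∈ Finset.range n, C (((1 - b : ℝ) : ℂ) ^ k / (k.factorial : ℂ)) * X ^ (2 * k)) *
    ∑ k ∈ Finset.range n, C (((2 * Real.pi * ξ : ℝ) * Complex.I) ^ k / (k.factorial : ℂ)) * X ^ k

theorem natDegree_gaussWavePoly_le (b ξ : ℝ) (n : ℕ) :
    (gaussWavePoly b ξ n).natDegree ≤ 3 * (n - 1) := by
  refine natDegree_mul_le.trans ?_
  have h1 := natDegree_sum_le_of_forall_le (n := 2 * (n - 1)) (Finset.range n)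
    (fun k => C (((1 - b : ℝ) : ℂ) ^ k / (k.factorial : ℂ)) * X ^ (2 * k)) fun k hk =>
      (natDegree_C_mul_X_pow_le _ _).trans (by have := Finset.mem_range.1 hk; omega)
  have h2 := natDegree_sum_le_of_forall_le (n := n - 1) (Finset.range n)
    (fun k => C (((2 * Real.pi * ξ : ℝ) * Complex.I) ^ k / (k.factorial : ℂ)) * X ^ k)
    fun k hk => (natDegree_C_mul_X_pow_le _ _).trans (by have := Finset.mem_range.1 hk; omega)
  omega

theorem eval_gaussWavePoly (b ξ u : ℝ) (n : ℕ) : (gaussWavePoly b ξ n).eval (u : ℂ) =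
    (∑ k ∈ Finset.range n, (((1 - b) * u ^ 2 : ℂ)) ^ k / (k.factorial : ℂ)) *
      ∑ k ∈ Finset.range n,
        (((2 * Real.pi * ξ * u : ℝ) * Complex.I)) ^ k / (k.factorial : ℂ) := by
  rw [gaussWavePoly, eval_mul, eval_finsetSum, eval_finsetSum]
  congr 1 <;> refine Finset.sum_congr rfl fun k _ => ?_
  · simp only [eval_mul, eval_C, eval_pow, eval_X]
    push_cast
    rw [mul_pow, pow_mul]
    ring
  · simp only [eval_mul, eval_C, eval_pow, eval_X]
    push_cast
    ring

/-- Telescope the product of the two exponentials. With r = 1 + b/2 each remainder gains r^(-n), and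
since r(1 - b) ≤ 1 - b/2 the growth in u stays below exp(u²), as the stability of the rule requires.
-/
theorem norm_gaussWave_sub_poly_le {b : ℝ} (hb : 0 < b) (hb1 : b ≤ 1) (ξ u : ℝ) (n : ℕ) :
    ‖gaussWave b ξ u - (gaussWavePoly b ξ n).eval (u : ℂ)‖ ≤
      2 / (1 + b / 2) ^ n * Real.exp ((2 * Real.pi * (1 + b / 2)) ^ 2 / (2 * b) * ξ ^ 2) *
        Real.exp ((1 - b / 2) * u ^ 2) := by
  set r := 1 + b / 2 with hr
  have hr1 : 1 ≤ r := by linarith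
  set a : ℂ := (1 - b) * u ^ 2 with ha
  set w : ℂ := (2 * Real.pi * ξ * u : ℝ) * Complex.I with hw
  have hna : ‖a‖ = (1 - b) * u ^ 2 := by
    have : a = (((1 - b) * u ^ 2 : ℝ) : ℂ) := by rw [ha]; push_cast; ring
    rw [this, Complex.norm_real, Real.norm_of_nonneg (mul_nonneg (by linarith) (sq_nonneg _))]
  have hnw : ‖w‖ = |2 * Real.pi * ξ * u| := by
    rw [hw, norm_mul, Complex.norm_I, mul_one, Complex.norm_real, Real.norm_eq_abs]
  rw [eval_gaussWavePoly, gaussWave, ← ha, ← hw]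
  set Ta := ∑ k ∈ Finset.range n, a ^ k / (k.factorial : ℂ)
  set Tw := ∑ k ∈ Finset.range n, w ^ k / (k.factorial : ℂ)
  have e : Complex.exp a * Complex.exp w - Ta * Tw =
      (Complex.exp a - Ta) * Complex.exp w + Ta * (Complex.exp w - Tw) := by ring
  have hew : ‖Complex.exp w‖ = 1 := Complex.norm_exp_ofReal_mul_I _
  have h1 : ‖(Complex.exp a - Ta) * Complex.exp w‖ ≤ Real.exp (r * ‖a‖) / r ^ n := by
    rw [norm_mul, hew, mul_one]
    exact norm_cexp_sub_sum_le hr1 a n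
  have h2 : ‖Ta * (Complex.exp w - Tw)‖ ≤ Real.exp ‖a‖ * (Real.exp (r * ‖w‖) / r ^ n) := by
    rw [norm_mul]
    exact mul_le_mul (norm_sum_pow_div_factorial_le a n) (norm_cexp_sub_sum_le hr1 w n)
      (norm_nonneg _) (Real.exp_pos _).le
  set K := (2 * Real.pi * r) ^ 2 / (2 * b) with hK
  have hK0 : 0 ≤ K := by positivity
  have h3 : Real.exp (r * ‖a‖) ≤ Real.exp (K * ξ ^ 2) * Real.exp ((1 - b / 2) * u ^ 2) := by
    rw [← Real.exp_add, Real.exp_le_exp, hna, hr]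
    have := mul_nonneg hK0 (sq_nonneg ξ)
    nlinarith [sq_nonneg u, sq_nonneg (b * u)]
  have h4 : Real.exp ‖a‖ * Real.exp (r * ‖w‖) ≤
      Real.exp (K * ξ ^ 2) * Real.exp ((1 - b / 2) * u ^ 2) := by
    rw [← Real.exp_add, ← Real.exp_add, Real.exp_le_exp, hna, hnw]
    -- Weighted arithmetic-geometric mean: K is the constant for which the difference is a perfect
    -- square over 2b.
    have h5 : r * |2 * Real.pi * ξ * u| ≤ K * ξ ^ 2 + b / 2 * u ^ 2 := by
      have h6 : r * |2 * Real.pi * ξ * u| = (2 * Real.pi * r * |ξ|) * |u| := by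
        rw [abs_mul, abs_mul, abs_of_pos (by positivity : 0 < 2 * Real.pi)]
        ring
      have h7 : K * ξ ^ 2 + b / 2 * u ^ 2 - (2 * Real.pi * r * |ξ|) * |u| =
          (2 * Real.pi * r * |ξ| - b * |u|) ^ 2 / (2 * b) := by
        rw [hK, ← sq_abs ξ, ← sq_abs u]
        field_simp
        ring
      have h8 : 0 ≤ (2 * Real.pi * r * |ξ| - b * |u|) ^ 2 / (2 * b) := by positivity
      linarith
    linarith
  rw [e]
  refine (norm_add_le_of_le h1 h2).trans ?_
  rw [mul_div_assoc', ← add_div, div_mul_eq_mul_div, div_mul_eq_mul_div]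
  gcongr
  linarith

/-- The polynomial has degree at most 3(n - 1), below the exactness limit 2N, so its defect vanishes
and only the remainder counts. -/
theorem norm_hermiteDefect_gaussWave_le {b : ℝ} (hb : 0 < b) (hb1 : b ≤ 1) (ξ : ℝ) {N n : ℕ}
    (hN : 0 < N) (hn : 3 * (n - 1) < 2 * N) :
    ‖hermiteDefect N (gaussWave b ξ)‖ ≤ 4 * √(Real.pi / (b / 2)) / (1 + b / 2) ^ n *
      Real.exp ((2 * Real.pi * (1 + b / 2)) ^ 2 / (2 * b) * ξ ^ 2) := by
  have hint1 := integrable_mul_exp_neg_sq (continuous_gaussWave b ξ) (B := 1) (θ := 1 - b)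
    (by linarith) (fun u => by rw [norm_gaussWave, one_mul])
  have hint2 := integrable_mul_exp_neg_sq (g := fun u =>
    gaussWave b ξ u - (gaussWavePoly b ξ n).eval (u : ℂ)) (θ := 1 - b / 2)
    ((continuous_gaussWave b ξ).sub ((gaussWavePoly b ξ n).continuous.comp
      Complex.continuous_ofReal)) (by linarith) (norm_gaussWave_sub_poly_le hb hb1 ξ · n)
  have e : hermiteDefect N (gaussWave b ξ) = hermiteDefect N fun u =>
      gaussWave b ξ u - (gaussWavePoly b ξ n).eval (u : ℂ) := by
    have h0 := hermiteDefect_polynomial (N := N) (p := gaussWavePoly b ξ n)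
      ((natDegree_gaussWavePoly_le b ξ n).trans_lt hn)
    rw [← sub_zero (hermiteDefect N (gaussWave b ξ)), ← h0]
    have hint3 : Integrable fun u : ℝ =>
        (gaussWavePoly b ξ n).eval (u : ℂ) * (Real.exp (-u ^ 2) : ℂ) := by
      refine (hint1.sub hint2).congr (Filter.Eventually.of_forall fun u => ?_)
      simp only [Pi.sub_apply]
      ring
    simp only [hermiteDefect, sub_mul, mul_sub, Finset.sum_sub_distrib]
    rw [integral_sub hint1 hint3]
    ring
  rw [e]
  refine (norm_hermiteDefect_le (by positivity) (by linarith) (by linarith)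
    (norm_gaussWave_sub_poly_le hb hb1 ξ · n) hN).trans (le_of_eq ?_)
  rw [show 1 - (1 - b / 2) = b / 2 by ring]
  ring

/-- Algebraic decay of the Gauss-Hermite error of modulated Gaussians. -/
theorem exists_norm_hermiteDefect_gaussWave_le {b : ℝ} (hb : 0 < b) (hb1 : b ≤ 1) (m : ℕ) :
    ∃ K > 0, ∀ (N : ℕ) (ξ : ℝ), 0 < N →
      ‖hermiteDefect N (gaussWave b ξ)‖ * (N : ℝ) ^ m ≤ K * (1 + |ξ| ^ (2 * m)) := by
  set C₀ := 4 * √(Real.pi / (b / 2)) with hC₀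
  set κ := (2 * Real.pi * (1 + b / 2)) ^ 2 / (2 * b) with hκ
  have hκ0 : 0 < κ := by positivity
  have hC0 : 0 < C₀ := by positivity
  -- Chosen so that (1 + b/2)^(N/2) = exp(2σN).
  set σ := Real.log (1 + b / 2) / 4 with hσ
  have hσ0 : 0 < σ := div_pos (Real.log_pos (by linarith)) (by norm_num)
  refine ⟨C₀ * (m.factorial / σ ^ m) + C₀ * (κ / σ) ^ m, by positivity, fun N ξ hN => ?_⟩
  have hN' : (0 : ℝ) < N := Nat.cast_pos.2 hN
  -- Low frequencies: about N/2 Taylor terms gain exp(-2σN), which beats exp(κξ²) ≤ exp(σN). High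
  -- frequencies: N ≤ (κ/σ) ξ², so the trivial bound times N^m is already of the required form.
  rcases le_total (κ * ξ ^ 2) (σ * N) with h | h
  · have h1 := norm_hermiteDefect_gaussWave_le hb hb1 ξ (n := (N + 1) / 2) hN (by omega)
    rw [← hκ, ← hC₀] at h1
    have h2 : Real.exp (2 * σ * N) ≤ (1 + b / 2) ^ ((N + 1) / 2) := by
      have h3 : (1 + b / 2) ^ ((N + 1) / 2) =
          Real.exp (((((N + 1) / 2 : ℕ) : ℝ)) * Real.log (1 + b / 2)) := by
        rw [Real.exp_nat_mul, Real.exp_log (by positivity)]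
      rw [h3, Real.exp_le_exp]
      have h4 : (N : ℝ) ≤ 2 * (((N + 1) / 2 : ℕ) : ℝ) := by
        exact_mod_cast (by omega : N ≤ 2 * ((N + 1) / 2))
      have h5 : Real.log (1 + b / 2) = 4 * σ := by rw [hσ]; ring
      rw [h5]
      nlinarith
    have h3 : ‖hermiteDefect N (gaussWave b ξ)‖ ≤ C₀ * Real.exp (-(σ * N)) := by
      refine h1.trans ?_
      rw [div_mul_eq_mul_div, div_le_iff₀ (by positivity), mul_assoc C₀]
      refine mul_le_mul_of_nonneg_left ?_ hC0.le
      calc Real.exp (κ * ξ ^ 2) ≤ Real.exp (σ * N) := Real.exp_le_exp.2 h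
        _ = Real.exp (-(σ * N)) * Real.exp (2 * σ * N) := by
          rw [← Real.exp_add]; congr 1; ring
        _ ≤ _ := mul_le_mul_of_nonneg_left h2 (Real.exp_pos _).le
    have h4 : Real.exp (-(σ * N)) * (N : ℝ) ^ m ≤ m.factorial / σ ^ m := by
      have h5 := Real.pow_div_factorial_le_exp (x := σ * N) (by positivity) m
      rw [div_le_iff₀ (by positivity)] at h5
      rw [le_div_iff₀ (by positivity), Real.exp_neg, mul_assoc, ← mul_pow, mul_comm (N : ℝ),
        inv_mul_le_iff₀ (Real.exp_pos _)]
      exact h5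
    calc _ ≤ C₀ * Real.exp (-(σ * N)) * (N : ℝ) ^ m :=
          mul_le_mul_of_nonneg_right h3 (by positivity)
      _ = C₀ * (Real.exp (-(σ * N)) * (N : ℝ) ^ m) := by ring
      _ ≤ C₀ * (m.factorial / σ ^ m) := mul_le_mul_of_nonneg_left h4 hC0.le
      _ ≤ _ := by
        have h6 : 0 ≤ C₀ * (m.factorial / σ ^ m) * |ξ| ^ (2 * m) := by positivity
        have h7 : 0 ≤ C₀ * (κ / σ) ^ m * (1 + |ξ| ^ (2 * m)) := by positivity
        nlinarith
  · have h1 : ‖hermiteDefect N (gaussWave b ξ)‖ ≤ C₀ := by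
      refine (norm_hermiteDefect_le (B := 1) (θ := 1 - b) zero_le_one (by linarith) (by linarith)
        (fun u => by rw [norm_gaussWave, one_mul]) hN).trans ?_
      rw [hC₀, show 1 - (1 - b) = b by ring]
      have : √(Real.pi / b) ≤ √(Real.pi / (b / 2)) := by
        gcongr
        linarith
      have := Real.sqrt_nonneg (Real.pi / (b / 2))
      linarith
    have h2 : (N : ℝ) ^ m ≤ (κ / σ) ^ m * |ξ| ^ (2 * m) := by
      rw [pow_mul, sq_abs, ← mul_pow]
      refine pow_le_pow_left₀ hN'.le ?_ m
      rw [div_mul_eq_mul_div, le_div_iff₀ hσ0]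
      linarith
    calc _ ≤ C₀ * ((κ / σ) ^ m * |ξ| ^ (2 * m)) :=
          mul_le_mul h1 h2 (by positivity) hC0.le
      _ ≤ _ := by
        have h6 : 0 ≤ C₀ * (m.factorial / σ ^ m) * (1 + |ξ| ^ (2 * m)) := by positivity
        have h7 : 0 ≤ C₀ * (κ / σ) ^ m := by positivity
        nlinarith

open FourierTransform in
-- Combines the bounds for the powers 0, 2, m and m + 2. The extra factor (1 + ξ²)⁻¹ is there to be
-- integrated over ξ.
theorem StripGaussian.exists_norm_fourier_le {c ρ : ℝ} (hρ : 0 < ρ) (hc : 0 < c) (m : ℕ) :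
    ∃ K > 0, ∀ (A : ℝ) (f : ℂ → ℂ), StripGaussian c ρ A f → ∀ ξ : ℝ,
      ‖𝓕 (fun x : ℝ => f x) ξ‖ * (1 + |ξ| ^ m) ≤ A * (K * (1 + ξ ^ 2)⁻¹) := by
  set D : ℕ → ℝ := fun n => n.factorial / ρ ^ n * Real.exp (c * ρ ^ 2) * √(Real.pi / (c / 2)) with hD
  have hD0 : ∀ n, 0 < D n := fun n => by
    have : 0 < √(Real.pi / (c / 2)) := Real.sqrt_pos.2 (by positivity)
    positivity
  refine ⟨D 0 + D 2 + D m + D (m + 2), by linarith [hD0 0, hD0 2, hD0 m, hD0 (m + 2)],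
    fun A f hf ξ => ?_⟩
  have h := hf.pow_mul_norm_fourier_le hρ hc
  have h0 := h 0 ξ
  have h2 := h 2 ξ
  have h3 := h m ξ
  have h4 := h (m + 2) ξ
  rw [← mul_assoc, ← div_eq_mul_inv, le_div_iff₀ (by positivity)]
  have e : ‖𝓕 (fun x : ℝ => f x) ξ‖ * (1 + |ξ| ^ m) * (1 + ξ ^ 2) =
      |ξ| ^ 0 * ‖𝓕 (fun x : ℝ => f x) ξ‖ + |ξ| ^ 2 * ‖𝓕 (fun x : ℝ => f x) ξ‖ +
      |ξ| ^ m * ‖𝓕 (fun x : ℝ => f x) ξ‖ + |ξ| ^ (m + 2) * ‖𝓕 (fun x : ℝ => f x) ξ‖ := by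
    rw [← sq_abs ξ]
    ring
  rw [e]
  simp only [hD]
  linarith

open FourierTransform in
/-- The Gauss-Hermite rule converges faster than any power of `1 / N`. -/
theorem exists_norm_gaussHermite_sub_integral_le {c ρ : ℝ} (hρ : 0 < ρ) (hc : 0 < c) (hc1 : c ≤ 1)
    (m : ℕ) : ∃ K > 0, ∀ (A : ℝ) (f : ℂ → ℂ) (N : ℕ), StripGaussian c ρ A f → 0 < N →
      ‖(∑ s ∈ hermiteZeros N, ((Real.exp (s ^ 2) * hermiteWeight N s : ℝ) : ℂ) * f s) -
        ∫ x : ℝ, f x‖ * (N : ℝ) ^ m ≤ A * K := by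
  -- Half of the decay becomes the explicit factor exp(-b u²), the other half stays in g, so that
  -- Fourier inversion applies to g. The assumption c ≤ 1 ensures 1 - b ≥ 0.
  set b := c / 2 with hb
  have hb0 : 0 < b := half_pos hc
  have hb1 : b ≤ 1 := by linarith
  obtain ⟨K₁, hK₁, hE⟩ := exists_norm_hermiteDefect_gaussWave_le hb0 hb1 m
  obtain ⟨K₂, hK₂, hF⟩ := StripGaussian.exists_norm_fourier_le hρ hb0 (2 * m)
  refine ⟨K₁ * K₂ * Real.pi, by positivity, fun A f N hf hN => ?_⟩
  have hA := hf.nonneg hρ.le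
  have hg : StripGaussian b ρ A fun z => f z * Complex.exp (b * z ^ 2) := by
    have := hf.mul_cexp hρ.le hb0.le
    rwa [show c - b = b by rw [hb]; ring] at this
  set g : ℂ → ℂ := fun z => f z * Complex.exp (b * z ^ 2) with hgdef
  set φ : ℝ → ℂ := 𝓕 (fun x : ℝ => g x) with hφ
  have hφb : ∀ ξ, ‖φ ξ‖ * (1 + |ξ| ^ (2 * m)) ≤ A * (K₂ * (1 + ξ ^ 2)⁻¹) := hF A g hg
  have hgint := hg.integrable_ofReal hρ hb0
  have hφc : Continuous φ := VectorFourier.fourierIntegral_continuous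
    Real.continuous_fourierChar (L := innerₗ ℝ) continuous_inner hgint
  have hφi : Integrable φ := by
    refine ((integrable_inv_one_add_sq.const_mul K₂).const_mul A).mono' hφc.aestronglyMeasurable
      (Filter.Eventually.of_forall fun ξ => le_trans ?_ (hφb ξ))
    exact le_mul_of_one_le_right (norm_nonneg _) (by simp)
  have hinv : ∀ u : ℝ, g u = ∫ ξ : ℝ, Complex.exp ((2 * Real.pi * ξ * u : ℝ) * Complex.I) * φ ξ := by
    intro u
    have h1 := congrFun (hg.continuous_ofReal.fourierInv_fourier_eq hgint hφi) u
    rw [Real.fourierInv_eq'] at h1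
    rw [← h1]
    refine integral_congr_ae (Filter.Eventually.of_forall fun ξ => ?_)
    simp only [smul_eq_mul, RCLike.inner_apply, conj_trivial, hφ]
    congr 4
    ring
  have hfg : ∀ u : ℝ, f u = Complex.exp (-b * u ^ 2) * g u := fun u => by
    rw [hgdef]
    simp only
    rw [mul_left_comm, ← Complex.exp_add]
    simp
  have hwave : ∀ ξ u : ℝ, gaussWave b ξ u * (Real.exp (-u ^ 2) : ℂ) =
      Complex.exp (-b * u ^ 2) * Complex.exp ((2 * Real.pi * ξ * u : ℝ) * Complex.I) := by
    intro ξ u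
    rw [gaussWave, mul_right_comm, Complex.ofReal_exp, ← Complex.exp_add]
    congr 2
    push_cast
    ring
  have hprod : Integrable (Function.uncurry fun u ξ : ℝ =>
      (gaussWave b ξ u * (Real.exp (-u ^ 2) : ℂ)) * φ ξ) (volume.prod volume) := by
    have h1 : Integrable (fun z : ℝ × ℝ => Real.exp (-b * z.1 ^ 2) * ‖φ z.2‖)
        (volume.prod volume) := (integrable_exp_neg_mul_sq hb0).mul_prod hφi.norm
    refine h1.mono' (Continuous.aestronglyMeasurable ?_) (Filter.Eventually.of_forall fun z => ?_)
    · unfold gaussWave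
      fun_prop
    · simp only [Function.uncurry]
      rw [hwave, norm_mul, norm_mul, Complex.norm_exp_ofReal_mul_I, mul_one, Complex.norm_exp]
      refine le_of_eq ?_
      congr 2
      norm_cast
  have hI : ∫ x : ℝ, f x =
      ∫ ξ : ℝ, (∫ u : ℝ, gaussWave b ξ u * (Real.exp (-u ^ 2) : ℂ)) * φ ξ := by
    calc ∫ x : ℝ, f x = ∫ u : ℝ, ∫ ξ : ℝ, (gaussWave b ξ u * (Real.exp (-u ^ 2) : ℂ)) * φ ξ := by
          refine integral_congr_ae (Filter.Eventually.of_forall fun u => ?_)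
          simp only [hwave]
          rw [hfg, hinv, ← integral_const_mul]
          simp only [mul_assoc]
      _ = _ := by
          rw [integral_integral_swap hprod]
          simp only [integral_mul_const]
  have hterm : ∀ s : ℝ, Integrable fun ξ : ℝ =>
      (hermiteWeight N s : ℂ) * gaussWave b ξ s * φ ξ := by
    intro s
    refine (hφi.norm.const_mul (hermiteWeight N s * Real.exp ((1 - b) * s ^ 2))).mono'
      (Continuous.aestronglyMeasurable ?_) (Filter.Eventually.of_forall fun ξ => ?_)
    · unfold gaussWave
      fun_prop
    · rw [norm_mul, norm_mul, norm_gaussWave, Complex.norm_real,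
        Real.norm_of_nonneg (hermiteWeight_nonneg _ _)]
  have hQ : ∑ s ∈ hermiteZeros N, ((Real.exp (s ^ 2) * hermiteWeight N s : ℝ) : ℂ) * f s =
      ∫ ξ : ℝ, (∑ s ∈ hermiteZeros N, (hermiteWeight N s : ℂ) * gaussWave b ξ s) * φ ξ := by
    simp only [Finset.sum_mul]
    rw [integral_finsetSum _ fun s _ => hterm s]
    refine Finset.sum_congr rfl fun s _ => ?_
    have h1 : Complex.exp ((s : ℂ) ^ 2) * Complex.exp (-b * (s : ℂ) ^ 2) =
        Complex.exp ((1 - b) * s ^ 2) := by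
      rw [← Complex.exp_add]
      congr 1
      ring
    rw [hfg, hinv]
    simp only [mul_assoc, gaussWave]
    rw [integral_const_mul, integral_const_mul, ← h1]
    push_cast
    ring
  -- The error of f is the superposition over ξ of the defects of the waves; their growth |ξ|^(2m)
  -- is absorbed by the amplitude φ.
  have hdiff : (∑ s ∈ hermiteZeros N, ((Real.exp (s ^ 2) * hermiteWeight N s : ℝ) : ℂ) * f s) -
      ∫ x : ℝ, f x = ∫ ξ : ℝ, hermiteDefect N (gaussWave b ξ) * φ ξ := by
    rw [hQ, hI, ← integral_sub]
    · simp only [hermiteDefect, sub_mul]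
    · simp only [Finset.sum_mul]
      exact integrable_finsetSum _ fun s _ => hterm s
    · simpa only [Function.uncurry, integral_mul_const] using hprod.integral_prod_right
  rw [hdiff]
  have hN0 : (0 : ℝ) ≤ (N : ℝ) ^ m := by positivity
  rw [← Real.norm_of_nonneg hN0, ← Complex.norm_real, ← norm_mul, ← integral_mul_const]
  refine (norm_integral_le_of_norm_le
    (integrable_inv_one_add_sq.const_mul (A * (K₁ * K₂)))
    (Filter.Eventually.of_forall fun ξ => ?_)).trans (le_of_eq ?_)
  · rw [norm_mul, norm_mul, Complex.norm_real, Real.norm_of_nonneg hN0]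
    have h1 := mul_le_mul_of_nonneg_right (hE N ξ hN) (norm_nonneg (φ ξ))
    have h2 := mul_le_mul_of_nonneg_left (hφb ξ) hK₁.le
    calc _ = ‖hermiteDefect N (gaussWave b ξ)‖ * (N : ℝ) ^ m * ‖φ ξ‖ := by ring
      _ ≤ _ := h1
      _ = K₁ * (‖φ ξ‖ * (1 + |ξ| ^ (2 * m))) := by ring
      _ ≤ _ := h2
      _ = _ := by ring
  · rw [integral_const_mul, integral_univ_inv_one_add_sq]
    ring


/-! ### Tensor products of quadrature rules -/

/-- Entire functions on `ℂ^d` bounded by `A exp (-c |Re z|²)` in the tube `|Im zₙ| ≤ ρ`. -/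
structure TubeGaussian {d : ℕ} (c ρ A : ℝ) (h : (Fin d → ℂ) → ℂ) : Prop where
  differentiable : Differentiable ℂ h
  bound : ∀ z : Fin d → ℂ, (∀ n, |(z n).im| ≤ ρ) → ‖h z‖ ≤ A * ∏ n, Real.exp (-c * (z n).re ^ 2)

namespace TubeGaussian

variable {d : ℕ} {c ρ A : ℝ}

theorem norm_ofReal_le {h : (Fin d → ℂ) → ℂ} (hh : TubeGaussian c ρ A h) (hρ : 0 ≤ ρ)
    (x : Fin d → ℝ) : ‖h fun n => x n‖ ≤ A * ∏ n, Real.exp (-c * x n ^ 2) := by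
  simpa using hh.bound (fun n => x n) fun n => by simpa using hρ

theorem nonneg {h : (Fin d → ℂ) → ℂ} (hh : TubeGaussian c ρ A h) (hρ : 0 ≤ ρ) : 0 ≤ A := by
  simpa using (norm_nonneg _).trans (hh.norm_ofReal_le hρ 0)

theorem slice_tail {h : (Fin (d + 1) → ℂ) → ℂ} (hh : TubeGaussian c ρ A h) (hρ : 0 ≤ ρ) (x : ℝ) :
    TubeGaussian c ρ (A * Real.exp (-c * x ^ 2)) fun w : Fin d → ℂ => h (Fin.cons (x : ℂ) w) where
  differentiable := hh.differentiable.comp (by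
    rw [differentiable_pi]
    intro i
    refine Fin.cases ?_ (fun i => ?_) i
    · simp
    · simpa using differentiable_apply i)
  bound w hw := by
    refine (hh.bound _ (Fin.cases (by simpa using hρ) fun i => by simpa using hw i)).trans
      (le_of_eq ?_)
    simp [Fin.prod_univ_succ, mul_assoc]

theorem slice_head {h : (Fin (d + 1) → ℂ) → ℂ} (hh : TubeGaussian c ρ A h) (hρ : 0 ≤ ρ)
    (y : Fin d → ℝ) : StripGaussian c ρ (A * ∏ n, Real.exp (-c * y n ^ 2))
      fun z : ℂ => h (Fin.cons z fun n => (y n : ℂ)) where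
  differentiable := hh.differentiable.comp (by
    rw [differentiable_pi]
    intro i
    refine Fin.cases ?_ (fun i => ?_) i
    · simp
    · simp)
  bound z hz := by
    refine (hh.bound _ (Fin.cases (by simpa using hz) fun i => by simpa using hρ)).trans
      (le_of_eq ?_)
    simp only [Fin.prod_univ_succ, Fin.cons_zero, Fin.cons_succ, Complex.ofReal_re]
    ring

end TubeGaussian

theorem integral_pi_succ {α E : Type} [MeasurableSpace α] (μ : Measure α) [SigmaFinite μ]
    [NormedAddCommGroup E] [NormedSpace ℝ E] {d : ℕ} (F : (Fin (d + 1) → α) → E) :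
    ∫ a, F a ∂(Measure.pi fun _ => μ) =
      ∫ z : α × (Fin d → α), F (Fin.cons z.1 z.2) ∂(μ.prod (Measure.pi fun _ => μ)) := by
  rw [← ((measurePreserving_piFinSuccAbove (fun _ : Fin (d + 1) => μ) 0).symm).integral_comp']
  simp_rw [MeasurableEquiv.piFinSuccAbove_symm_apply, Fin.insertNthEquiv, Equiv.coe_fn_mk,
    Fin.insertNth_zero]
  rfl

section Tensor

variable {α : Type} [MeasurableSpace α] {ν : Measure α} [SigmaFinite ν] {s : α → ℝ}
  {c ρ B δ : ℝ}

theorem TubeGaussian.integrable_comp {d : ℕ} {A : ℝ} {h : (Fin d → ℂ) → ℂ}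
    (hs : Measurable s) (hi : Integrable (fun a => Real.exp (-c * s a ^ 2)) ν) (hρ : 0 ≤ ρ)
    (hh : TubeGaussian c ρ A h) :
    Integrable (fun a : Fin d → α => h fun n => s (a n)) (Measure.pi fun _ => ν) := by
  refine ((Integrable.fintype_prod (μ := fun _ : Fin d => ν) fun _ => hi).const_mul A).mono' ?_
    (Filter.Eventually.of_forall fun a => hh.norm_ofReal_le hρ fun n => s (a n))
  refine (hh.differentiable.continuous.measurable.comp ?_).aestronglyMeasurable
  exact measurable_pi_lambda _ fun n =>
    Complex.measurable_ofReal.comp (hs.comp (measurable_pi_apply n))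

/-- The error of the `d`-fold tensor product of a stable one-dimensional rule. -/
theorem TubeGaussian.norm_integral_sub_integral_le (hs : Measurable s) (hρ : 0 < ρ) (hc : 0 < c)
    (hi : Integrable (fun a => Real.exp (-c * s a ^ 2)) ν)
    (hB : ∫ a, Real.exp (-c * s a ^ 2) ∂ν ≤ B) (hB' : √(Real.pi / c) ≤ B) (hδ : 0 ≤ δ)
    (h1 : ∀ (A : ℝ) (f : ℂ → ℂ), StripGaussian c ρ A f →
      ‖(∫ a, f (s a) ∂ν) - ∫ x : ℝ, f x‖ ≤ A * δ) {d : ℕ} {A : ℝ} {h : (Fin d → ℂ) → ℂ}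
    (hh : TubeGaussian c ρ A h) :
    ‖(∫ a : Fin d → α, h (fun n => s (a n)) ∂(Measure.pi fun _ => ν)) -
      ∫ x : Fin d → ℝ, h (fun n => x n)‖ ≤ A * (d * B ^ (d - 1) * δ) := by
  induction d generalizing A with
  | zero =>
    have : ∀ z, h z = h 0 := fun z => congrArg h (Subsingleton.elim _ _)
    simp only [this (fun _ => _), volume_pi]
    simp [measureReal_def, Measure.pi_empty_univ]
  | succ d ih =>
    have hA := hh.nonneg hρ.le
    have hB0 : 0 ≤ B := (Real.sqrt_nonneg _).trans hB'
    have hiv : Integrable fun x : ℝ => Real.exp (-c * x ^ 2) := integrable_exp_neg_mul_sq hc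
    set P : Measure (Fin d → α) := Measure.pi fun _ => ν with hP
    have hG : Integrable (fun y : Fin d → ℝ => ∏ n, Real.exp (-c * y n ^ 2)) :=
      Integrable.fintype_prod (μ := fun _ : Fin d => volume) fun _ => hiv
    have hc1 : ∀ (x : ℝ) {β : Type} (w : β → Fin d → ℝ) (b : β),
        (fun n => (((Fin.cons x (w b) : Fin (d + 1) → ℝ) n : ℝ) : ℂ)) =
          Fin.cons (x : ℂ) fun n => (w b n : ℂ) := by
      intro x β w b
      funext n
      refine Fin.cases ?_ (fun n => ?_) n <;> simp
    have hcα : ∀ (a : α) (v : Fin d → α),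
        (fun n => ((s ((Fin.cons a v : Fin (d + 1) → α) n) : ℝ) : ℂ)) =
          Fin.cons (s a : ℂ) fun n => (s (v n) : ℂ) := by
      intro a v
      funext n
      refine Fin.cases ?_ (fun n => ?_) n <;> simp
    have hmeas : ∀ {β γ : Type} [MeasurableSpace β] [MeasurableSpace γ] {t : β → ℝ}
        {v : γ → Fin d → ℝ}, Measurable t → Measurable v →
        Measurable fun z : β × γ => h (Fin.cons (t z.1 : ℂ) fun n => (v z.2 n : ℂ)) := by
      intro β γ _ _ t v ht hv
      refine hh.differentiable.continuous.measurable.comp (measurable_pi_lambda _ fun n => ?_)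
      refine Fin.cases ?_ (fun n => ?_) n
      · simp only [Fin.cons_zero]
        exact Complex.measurable_ofReal.comp (ht.comp measurable_fst)
      · simp only [Fin.cons_succ]
        exact Complex.measurable_ofReal.comp
          ((measurable_pi_apply n).comp (hv.comp measurable_snd))
    have hbd : ∀ (x : ℝ) (y : Fin d → ℝ), ‖h (Fin.cons (x : ℂ) fun n => (y n : ℂ))‖ ≤
        A * (Real.exp (-c * x ^ 2) * ∏ n, Real.exp (-c * y n ^ 2)) := by
      intro x y
      rw [← mul_assoc]
      exact (hh.slice_tail hρ.le x).norm_ofReal_le hρ.le y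
    have I1 : Integrable (fun z : α × (Fin d → α) =>
        h (Fin.cons (s z.1 : ℂ) fun n => (s (z.2 n) : ℂ))) (ν.prod P) := by
      refine ((hi.mul_prod (Integrable.fintype_prod (μ := fun _ : Fin d => ν)
        fun _ => hi)).const_mul A).mono' (hmeas (v := fun (v : Fin d → α) n => s (v n)) hs
          (measurable_pi_lambda _ fun n => hs.comp (measurable_pi_apply n))).aestronglyMeasurable
        (Filter.Eventually.of_forall fun z => hbd _ fun n => s (z.2 n))
    have I2 : Integrable (fun z : α × (Fin d → ℝ) =>
        h (Fin.cons (s z.1 : ℂ) fun n => (z.2 n : ℂ))) (ν.prod volume) :=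
      ((hi.mul_prod hG).const_mul A).mono' (hmeas hs measurable_id).aestronglyMeasurable
        (Filter.Eventually.of_forall fun z => hbd _ _)
    have I3 : Integrable (fun z : ℝ × (Fin d → ℝ) =>
        h (Fin.cons (z.1 : ℂ) fun n => (z.2 n : ℂ))) (volume.prod volume) :=
      ((hiv.mul_prod hG).const_mul A).mono' (hmeas measurable_id measurable_id).aestronglyMeasurable
        (Filter.Eventually.of_forall fun z => hbd _ _)
    have e1 : ∫ a : Fin (d + 1) → α, h (fun n => s (a n)) ∂(Measure.pi fun _ => ν) =
        ∫ a, ∫ v, h (Fin.cons (s a : ℂ) fun n => (s (v n) : ℂ)) ∂P ∂ν := by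
      rw [integral_pi_succ]
      simp only [hcα]
      exact integral_prod _ I1
    have e3 : ∫ x : Fin (d + 1) → ℝ, h (fun n => x n) =
        ∫ y : Fin d → ℝ, ∫ x : ℝ, h (Fin.cons (x : ℂ) fun n => (y n : ℂ)) := by
      rw [volume_pi, integral_pi_succ]
      simp only [fun (z : ℝ × (Fin d → ℝ)) => hc1 z.1 (fun z : ℝ × (Fin d → ℝ) => z.2) z]
      exact integral_prod_symm _ I3
    have e2 : ∫ a, (∫ y : Fin d → ℝ, h (Fin.cons (s a : ℂ) fun n => (y n : ℂ))) ∂ν =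
        ∫ y : Fin d → ℝ, ∫ a, h (Fin.cons (s a : ℂ) fun n => (y n : ℂ)) ∂ν :=
      integral_integral_swap I2
    -- Hybrid argument: the intermediate quantity uses the rule in the first coordinate and the
    -- exact integral in the others. Here the induction hypothesis acts on each slice, and the mass
    -- of the rule gives a factor B.
    have b1 : ‖(∫ a, ∫ v, h (Fin.cons (s a : ℂ) fun n => (s (v n) : ℂ)) ∂P ∂ν) -
        ∫ a, (∫ y : Fin d → ℝ, h (Fin.cons (s a : ℂ) fun n => (y n : ℂ))) ∂ν‖ ≤
        A * (d * B ^ d * δ) := by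
      rw [← integral_sub I1.integral_prod_left I2.integral_prod_left]
      refine (norm_integral_le_of_norm_le (hi.mul_const (A * (d * B ^ (d - 1) * δ)))
        (Filter.Eventually.of_forall fun a => ?_)).trans ?_
      · refine (ih (hh.slice_tail hρ.le (s a))).trans (le_of_eq ?_)
        ring
      · rw [integral_mul_const]
        refine (mul_le_mul_of_nonneg_right hB (by positivity)).trans (le_of_eq ?_)
        -- For d = 0 the truncated exponent `d - 1` is harmless because the factor d vanishes.
        cases d with
        | zero => simp
        | succ k => rw [Nat.add_sub_cancel, pow_succ]; ring
    -- After exchanging the order of integration, the one-dimensional error applies to the first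
    -- coordinate and the Gaussian integrals of the others give B^d.
    have b2 : ‖(∫ y : Fin d → ℝ, ∫ a, h (Fin.cons (s a : ℂ) fun n => (y n : ℂ)) ∂ν) -
        ∫ y : Fin d → ℝ, ∫ x : ℝ, h (Fin.cons (x : ℂ) fun n => (y n : ℂ))‖ ≤
        A * (B ^ d * δ) := by
      rw [← integral_sub I2.integral_prod_right I3.integral_prod_right]
      refine (norm_integral_le_of_norm_le (hG.const_mul (A * δ))
        (Filter.Eventually.of_forall fun y => ?_)).trans ?_
      · refine (h1 _ _ (hh.slice_head hρ.le y)).trans (le_of_eq ?_)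
        ring
      · rw [integral_const_mul,
          integral_fintype_prod_volume_eq_pow (fun x : ℝ => Real.exp (-c * x ^ 2)),
          integral_gaussian, Fintype.card_fin, mul_assoc, mul_comm δ]
        gcongr
    rw [e1, e3]
    have b3 := norm_add_le_of_le b1 b2
    rw [e2, sub_add_sub_cancel] at b3
    refine b3.trans (le_of_eq ?_)
    rw [Nat.add_sub_cancel]
    push_cast
    ring

end Tensor

/-- The error of tensor products of a stable one-dimensional quadrature rule with nodes `s` and
weights `ω`. -/
theorem TubeGaussian.norm_tsum_sub_integral_le {ι : Type} [Countable ι] {s ω : ι → ℝ}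
    {c ρ B δ : ℝ} (hρ : 0 < ρ) (hc : 0 < c) (hω : ∀ i, 0 ≤ ω i)
    (hi : Summable fun i => ω i * Real.exp (-c * s i ^ 2))
    (hB : ∑' i, ω i * Real.exp (-c * s i ^ 2) ≤ B) (hB' : √(Real.pi / c) ≤ B) (hδ : 0 ≤ δ)
    (h1 : ∀ (A : ℝ) (f : ℂ → ℂ), StripGaussian c ρ A f →
      ‖(∑' i, (ω i : ℂ) * f (s i)) - ∫ x : ℝ, f x‖ ≤ A * δ)
    {d : ℕ} {A : ℝ} {h : (Fin d → ℂ) → ℂ} (hh : TubeGaussian c ρ A h) :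
    (Summable fun j : Fin d → ι => ((∏ n, ω (j n) : ℝ) : ℂ) * h fun n => s (j n)) ∧
    ‖(∑' j : Fin d → ι, ((∏ n, ω (j n) : ℝ) : ℂ) * h fun n => s (j n)) -
      ∫ x : Fin d → ℝ, h (fun n => x n)‖ ≤ A * (d * B ^ (d - 1) * δ) := by
  -- The rule becomes the measure with mass ω i at i, so finite and infinite sums are both integrals
  -- and the tensor rule is a product measure.
  let _ : MeasurableSpace ι := ⊤
  set ν : Measure ι := Measure.count.withDensity fun i => ((ω i).toNNReal : ENNReal) with hν
  have hs : Measurable s := measurable_from_top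
  have hsing : ∀ i, ν.real {i} = ω i := fun i => by
    rw [measureReal_def, hν, withDensity_apply _ (measurableSet_singleton i)]
    simp [Measure.restrict_singleton, hω i]
  have hi' : Integrable (fun i => Real.exp (-c * s i ^ 2)) ν := by
    rw [hν, integrable_withDensity_iff_integrable_smul measurable_from_top, integrable_count_iff]
    refine hi.congr fun i => ?_
    rw [NNReal.smul_def, Real.coe_toNNReal _ (hω i), smul_eq_mul,
      Real.norm_of_nonneg (mul_nonneg (hω i) (Real.exp_pos _).le)]
  have hB1 : ∫ i, Real.exp (-c * s i ^ 2) ∂ν ≤ B := by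
    rw [integral_countable hi']
    simpa [hsing] using hB
  have hF : ∀ (A : ℝ) (f : ℂ → ℂ), StripGaussian c ρ A f →
      ‖(∫ i, f (s i) ∂ν) - ∫ x : ℝ, f x‖ ≤ A * δ := by
    intro A f hf
    have : Integrable (fun i => f (s i)) ν :=
      (hi'.const_mul A).mono' measurable_from_top.aestronglyMeasurable
        (Filter.Eventually.of_forall fun i => hf.norm_ofReal_le hρ.le (s i))
    rw [integral_countable this]
    simpa [hsing] using h1 A f hf
  have hpi : ∀ j : Fin d → ι, (Measure.pi fun _ : Fin d => ν).real {j} = ∏ n, ω (j n) := by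
    intro j
    rw [measureReal_def, Measure.pi_singleton, ENNReal.toReal_prod]
    exact Finset.prod_congr rfl fun n _ => hsing (j n)
  have hI := hh.integrable_comp (ν := ν) hs hi' hρ.le
  have key := hh.norm_integral_sub_integral_le hs hρ hc hi' hB1 hB' hδ hF
  rw [integral_countable hI] at key
  refine ⟨?_, by simpa only [hpi, Complex.real_smul] using key⟩
  rw [← Measure.sum_smul_dirac (Measure.pi fun _ : Fin d => ν)] at hI
  have := hI.summable_of_dirac
  refine Summable.of_norm (this.congr fun j => ?_)
  rw [← measureReal_def, hpi, norm_mul, Complex.norm_real,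
    Real.norm_of_nonneg (Finset.prod_nonneg fun n _ => hω (j n))]


/-! ### Multivariate complex Gaussian integrals -/

section GaussianIntegral

open Matrix

variable {d : ℕ}

theorem exists_orthogonal_diagonal {S : Matrix (Fin d) (Fin d) ℝ} (hS : S.IsHermitian) :
    ∃ (U : Matrix (Fin d) (Fin d) ℝ) (l : Fin d → ℝ), U.det ≠ 0 ∧ Uᵀ * U = 1 ∧
      Uᵀ * S * U = diagonal l := by
  have h : star (hS.eigenvectorUnitary : Matrix (Fin d) (Fin d) ℝ) *
      (hS.eigenvectorUnitary : Matrix (Fin d) (Fin d) ℝ) = 1 :=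
    Unitary.coe_star_mul_self hS.eigenvectorUnitary
  refine ⟨hS.eigenvectorUnitary, hS.eigenvalues, ?_, ?_, ?_⟩
  · intro h0
    have := congrArg Matrix.det h
    rw [det_mul, h0, mul_zero, det_one] at this
    exact zero_ne_one this
  · rwa [star_eq_conjTranspose, conjTranspose_eq_transpose_of_trivial] at h
  · have h := hS.conjStarAlgAut_star_eigenvectorUnitary
    rw [Unitary.conjStarAlgAut_star_apply] at h
    rw [star_eq_conjTranspose, conjTranspose_eq_transpose_of_trivial] at h
    simpa using h

/-- Simultaneous diagonalization of a positive definite and a symmetric matrix by congruence. -/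
theorem exists_simultaneous_diagonal {P S : Matrix (Fin d) (Fin d) ℝ} (hP : P.PosDef)
    (hS : S.IsHermitian) :
    ∃ (T : Matrix (Fin d) (Fin d) ℝ) (l : Fin d → ℝ), T.det ≠ 0 ∧ Tᵀ * P * T = 1 ∧
      Tᵀ * S * T = diagonal l := by
  obtain ⟨U, m, hU, -, hUP⟩ := exists_orthogonal_diagonal hP.1
  have hm : ∀ i, 0 < m i := by
    have h : (Uᵀ * P * U).PosDef := by
      have := hP.conjTranspose_mul_mul_same (B := U) (mulVec_injective_of_isUnit
        ((isUnit_iff_isUnit_det U).2 (isUnit_iff_ne_zero.2 hU)))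
      rwa [conjTranspose_eq_transpose_of_trivial] at this
    rw [hUP] at h
    intro i
    simpa using h.diag_pos (i := i)
  -- Rescaling the eigenvectors of P turns P into the identity; the later orthogonal diagonalization
  -- of the transformed S leaves it so.
  set D : Matrix (Fin d) (Fin d) ℝ := diagonal fun i => (√(m i))⁻¹ with hD
  have hDt : Dᵀ = D := diagonal_transpose _
  have hD0 : D.det ≠ 0 := by
    rw [hD, det_diagonal]
    exact Finset.prod_ne_zero_iff.2 fun i _ => inv_ne_zero (Real.sqrt_ne_zero'.2 (hm i))
  have h1 : (U * D)ᵀ * P * (U * D) = 1 := by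
    rw [transpose_mul, hDt]
    have : D * Uᵀ * P * (U * D) = D * (Uᵀ * P * U) * D := by simp only [Matrix.mul_assoc]
    rw [this, hUP, hD, diagonal_mul_diagonal, diagonal_mul_diagonal, ← diagonal_one]
    congr 1
    funext i
    have h2 := Real.mul_self_sqrt (hm i).le
    have h3 := (Real.sqrt_ne_zero'.2 (hm i))
    have h4 : (√(m i))⁻¹ * m i * (√(m i))⁻¹ = 1 := by
      nth_rewrite 2 [← h2]
      field_simp
    exact h4
  set S' := (U * D)ᵀ * S * (U * D) with hS'
  have hS'h : S'.IsHermitian := by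
    have := isHermitian_conjTranspose_mul_mul (U * D) hS
    rwa [conjTranspose_eq_transpose_of_trivial] at this
  obtain ⟨V, l, hV, hV1, hVS⟩ := exists_orthogonal_diagonal hS'h
  have e : ∀ X : Matrix (Fin d) (Fin d) ℝ, (U * D * V)ᵀ * X * (U * D * V) =
      Vᵀ * ((U * D)ᵀ * X * (U * D)) * V := fun X => by
    rw [transpose_mul (U * D) V]
    simp only [Matrix.mul_assoc]
  refine ⟨U * D * V, l, ?_, ?_, ?_⟩
  · rw [det_mul, det_mul]
    exact mul_ne_zero (mul_ne_zero hU hD0) hV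
  · rw [e, h1, Matrix.mul_one, hV1]
  · rw [e, ← hS', hVS]

/-- An invertible linear map is bounded below. -/
theorem exists_sum_sq_mulVec_ge {T : Matrix (Fin d) (Fin d) ℝ} (hT : T.det ≠ 0) :
    ∃ c > 0, ∀ y : Fin d → ℝ, c * ∑ n, y n ^ 2 ≤ ∑ n, (T *ᵥ y) n ^ 2 := by
  set K := ∑ n, ∑ m, T⁻¹ n m ^ 2 with hK
  have hK0 : 0 ≤ K := Finset.sum_nonneg fun n _ => Finset.sum_nonneg fun m _ => sq_nonneg _
  refine ⟨(K + 1)⁻¹, by positivity, fun y => ?_⟩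
  rw [inv_mul_le_iff₀ (by positivity)]
  have h1 : T⁻¹ *ᵥ (T *ᵥ y) = y := by
    rw [mulVec_mulVec, nonsing_inv_mul _ (isUnit_iff_ne_zero.2 hT), one_mulVec]
  have h2 : ∑ n, y n ^ 2 ≤ K * ∑ n, (T *ᵥ y) n ^ 2 := by
    rw [hK, Finset.sum_mul]
    refine Finset.sum_le_sum fun n _ => ?_
    have : y n = ∑ m, T⁻¹ n m * (T *ᵥ y) m := by
      conv_lhs => rw [← h1]
      rfl
    rw [this]
    exact Finset.sum_mul_sq_le_sq_mul_sq _ _ _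
  have : 0 ≤ ∑ n, (T *ᵥ y) n ^ 2 := Finset.sum_nonneg fun _ _ => sq_nonneg _
  linarith

theorem dotProduct_mulVec_mulVec (T P : Matrix (Fin d) (Fin d) ℝ) (u : Fin d → ℝ) :
    (T *ᵥ u) ⬝ᵥ (P *ᵥ (T *ᵥ u)) = u ⬝ᵥ ((Tᵀ * P * T) *ᵥ u) := by
  rw [Matrix.mul_assoc, ← mulVec_mulVec, dotProduct_mulVec u, vecMul_transpose, mulVec_mulVec]

/-- The exponential of a complex quadratic polynomial. -/
noncomputable def quadExp (P S : Matrix (Fin d) (Fin d) ℝ) (c : Fin d → ℂ) (y : Fin d → ℝ) : ℂ :=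
  Complex.exp (-((y ⬝ᵥ P *ᵥ y : ℝ) : ℂ) + Complex.I * ((y ⬝ᵥ S *ᵥ y : ℝ) : ℂ) + ∑ n, c n * y n)

theorem continuous_quadExp (P S : Matrix (Fin d) (Fin d) ℝ) (c : Fin d → ℂ) :
    Continuous (quadExp P S c) := by
  unfold quadExp
  have h : ∀ P : Matrix (Fin d) (Fin d) ℝ, Continuous fun y : Fin d → ℝ => y ⬝ᵥ P *ᵥ y := fun P => by
    unfold mulVec dotProduct
    fun_prop
  have h1 := h P
  have h2 := h S
  fun_prop

theorem norm_quadExp (P S : Matrix (Fin d) (Fin d) ℝ) (c : Fin d → ℂ) (y : Fin d → ℝ) :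
    ‖quadExp P S c y‖ = Real.exp (-(y ⬝ᵥ P *ᵥ y) + ∑ n, (c n).re * y n) := by
  rw [quadExp, Complex.norm_exp]
  congr 1
  simp

/-- In the coordinates T⁻¹y the form is the sum of squares, and T⁻¹ is bounded below. -/
theorem exists_posDef_ge {P : Matrix (Fin d) (Fin d) ℝ} (hP : P.PosDef) :
    ∃ c > 0, ∀ y : Fin d → ℝ, c * ∑ n, y n ^ 2 ≤ y ⬝ᵥ P *ᵥ y := by
  obtain ⟨T, l, hT, hTP, -⟩ := exists_simultaneous_diagonal hP hP.1
  have hu : IsUnit T.det := isUnit_iff_ne_zero.2 hT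
  obtain ⟨c, hc, h⟩ := exists_sum_sq_mulVec_ge (T := T⁻¹) (by
    rw [det_nonsing_inv]; exact hu.ringInverse.ne_zero)
  refine ⟨c, hc, fun y => (h y).trans (le_of_eq ?_)⟩
  have h1 : T *ᵥ (T⁻¹ *ᵥ y) = y := by
    rw [mulVec_mulVec, mul_nonsing_inv _ hu, one_mulVec]
  conv_rhs => rw [← h1, dotProduct_mulVec_mulVec, hTP, one_mulVec]
  simp [dotProduct, sq]

theorem integrable_quadExp {P : Matrix (Fin d) (Fin d) ℝ} (hP : P.PosDef)
    (S : Matrix (Fin d) (Fin d) ℝ) (c : Fin d → ℂ) : Integrable (quadExp P S c) := by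
  obtain ⟨a, ha, h⟩ := exists_posDef_ge hP
  have h1 : Integrable fun y : Fin d → ℝ =>
      ∏ n, Real.exp (-a * y n ^ 2 + (c n).re * y n) := by
    refine Integrable.fintype_prod (μ := fun _ : Fin d => volume)
      (f := fun n (x : ℝ) => Real.exp (-a * x ^ 2 + (c n).re * x)) fun n => ?_
    have h2 : Integrable fun x : ℝ => Real.exp ((c n).re ^ 2 / (2 * a)) *
        Real.exp (-(a / 2) * x ^ 2) := (integrable_exp_neg_mul_sq (half_pos ha)).const_mul _
    refine h2.mono' (Continuous.aestronglyMeasurable (by fun_prop))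
      (Filter.Eventually.of_forall fun x => ?_)
    rw [Real.norm_of_nonneg (Real.exp_pos _).le, ← Real.exp_add, Real.exp_le_exp]
    have : (c n).re ^ 2 / (2 * a) + -(a / 2) * x ^ 2 - (-a * x ^ 2 + (c n).re * x) =
        ((c n).re - a * x) ^ 2 / (2 * a) := by
      field_simp
      ring
    have : 0 ≤ ((c n).re - a * x) ^ 2 / (2 * a) := by positivity
    linarith
  refine h1.mono' (continuous_quadExp P S c).aestronglyMeasurable
    (Filter.Eventually.of_forall fun y => ?_)
  rw [norm_quadExp, ← Real.exp_sum, Real.exp_le_exp, Finset.sum_add_distrib, ← Finset.mul_sum]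
  linarith [h y]

theorem integral_mulVec {f : (Fin d → ℝ) → ℂ} (hf : Continuous f)
    {T : Matrix (Fin d) (Fin d) ℝ} (hT : T.det ≠ 0) :
    ∫ y, f y = ((|T.det| : ℝ) : ℂ) * ∫ u, f (T *ᵥ u) := by
  have h := Real.map_matrix_volume_pi_eq_smul_volume_pi hT
  have h1 : ∫ u, f (T *ᵥ u) = ∫ y, f y ∂(Measure.map (toLin' T) volume) := by
    rw [integral_map (by
      exact (LinearMap.continuous_of_finiteDimensional _).measurable.aemeasurable)
      hf.aestronglyMeasurable]
    rfl
  rw [h1, h, integral_smul_measure, ENNReal.toReal_ofReal (abs_nonneg _), Complex.real_smul,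
    ← mul_assoc, ← Complex.ofReal_mul, abs_inv, mul_inv_cancel₀ (abs_ne_zero.2 hT),
    Complex.ofReal_one, one_mul]

theorem quadExp_mulVec {P S T : Matrix (Fin d) (Fin d) ℝ} {l : Fin d → ℝ} (h1 : Tᵀ * P * T = 1)
    (h2 : Tᵀ * S * T = diagonal l) (c : Fin d → ℂ) (u : Fin d → ℝ) :
    quadExp P S c (T *ᵥ u) = Complex.exp (-∑ n, (1 - Complex.I * l n) * (u n : ℂ) ^ 2 +
      ∑ n, (∑ m, c m * T m n) * u n) := by
  rw [quadExp, dotProduct_mulVec_mulVec, dotProduct_mulVec_mulVec, h1, h2, one_mulVec]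
  congr 1
  have e1 : ∑ n, c n * ((T *ᵥ u) n : ℂ) = ∑ n, (∑ m, c m * T m n) * (u n : ℂ) := by
    simp only [mulVec, dotProduct, Complex.ofReal_sum, Finset.mul_sum, Finset.sum_mul]
    rw [Finset.sum_comm]
    refine Finset.sum_congr rfl fun n _ => Finset.sum_congr rfl fun m _ => ?_
    push_cast
    ring
  rw [e1]
  congr 1
  simp only [dotProduct, mulVec_diagonal, sub_mul, one_mul, Finset.sum_sub_distrib,
    Complex.ofReal_sum, Complex.ofReal_mul, Finset.mul_sum]
  rw [neg_sub, sub_eq_neg_add]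
  congr 1
  · simp only [sq]
  · exact Finset.sum_congr rfl fun n _ => by ring

/-- The integral of a complex Gaussian in diagonalizing coordinates. -/
noncomputable def quadInt (T : Matrix (Fin d) (Fin d) ℝ) (l : Fin d → ℝ) (c : Fin d → ℂ) : ℂ :=
  ((|T.det| : ℝ) : ℂ) * ∏ n, ((Real.pi / (1 - Complex.I * l n)) ^ (1 / 2 : ℂ) *
    Complex.exp ((∑ m, c m * T m n) ^ 2 / (4 * (1 - Complex.I * l n))))

theorem integral_quadExp {P S T : Matrix (Fin d) (Fin d) ℝ} {l : Fin d → ℝ} (hT : T.det ≠ 0)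
    (h1 : Tᵀ * P * T = 1) (h2 : Tᵀ * S * T = diagonal l) (c : Fin d → ℂ) :
    ∫ y, quadExp P S c y = quadInt T l c := by
  rw [integral_mulVec (continuous_quadExp P S c) hT, quadInt]
  simp only [quadExp_mulVec h1 h2]
  rw [GaussianFourier.integral_cexp_neg_sum_mul_add (fun n => by simp)]

/-- The closed form makes analyticity in the linear coefficient evident, without differentiating
under an integral. -/
theorem differentiable_quadInt (T : Matrix (Fin d) (Fin d) ℝ) (l : Fin d → ℝ) :
    Differentiable ℂ (quadInt T l) := by
  unfold quadInt
  fun_prop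

/-- With t = Im ρ - σ, the numerator of the real part is a² - t² - 2atl, where a = Re ρ. The term
-t² dominates; half of its σ² pays for the mixed terms, which explains 8 instead of 4 in the
denominator. -/
theorem re_sq_div_le {l σ R : ℝ} {ρ : ℂ} (hρ : ‖ρ‖ ≤ R) :
    ((ρ - Complex.I * σ) ^ 2 / (4 * (1 - Complex.I * l))).re ≤
      R ^ 2 * (1 + l ^ 2) - σ ^ 2 / (8 * (1 + l ^ 2)) := by
  set a := ρ.re
  set b := ρ.im
  set t := b - σ with ht
  have hR : a ^ 2 + b ^ 2 ≤ R ^ 2 := by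
    have h1 : ‖ρ‖ ^ 2 = a ^ 2 + b ^ 2 := by
      rw [← Complex.normSq_eq_norm_sq, Complex.normSq_apply]
      ring
    rw [← h1]
    exact pow_le_pow_left₀ (norm_nonneg _) hρ 2
  have hk : 0 < 1 + l ^ 2 := by positivity
  have e : ((ρ - Complex.I * σ) ^ 2 / (4 * (1 - Complex.I * l))).re =
      (a ^ 2 - t ^ 2 - 2 * a * t * l) / (4 * (1 + l ^ 2)) := by
    have hne : (1 - Complex.I * l : ℂ) ≠ 0 := fun h => by
      have := congrArg Complex.re h
      simp at this
    have hne2 : (1 + (l : ℂ) ^ 2) ≠ 0 := by exact_mod_cast hk.ne'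
    have e1 : (ρ - Complex.I * σ) ^ 2 / (4 * (1 - Complex.I * l)) =
        (ρ - Complex.I * σ) ^ 2 * (1 + Complex.I * l) * (((4 * (1 + l ^ 2))⁻¹ : ℝ) : ℂ) := by
      push_cast
      field_simp
      linear_combination ((ρ - Complex.I * σ) ^ 2 * l ^ 2) * Complex.I_sq
    rw [e1, Complex.re_mul_ofReal, div_eq_mul_inv]
    congr 1
    simp [sq]
    ring
  have key : 2 * (a ^ 2 - t ^ 2 - 2 * a * t * l) + σ ^ 2 ≤ 8 * (1 + l ^ 2) * R ^ 2 := by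
    have hσ : σ = b - t := by rw [ht]; ring
    rw [hσ]
    have h1 : l ^ 2 * (a ^ 2 + b ^ 2) ≤ l ^ 2 * R ^ 2 :=
      mul_le_mul_of_nonneg_left hR (sq_nonneg l)
    nlinarith [sq_nonneg (t + (2 * a * l + b)), sq_nonneg (2 * a * l - b), sq_nonneg (l * b),
      sq_nonneg a, sq_nonneg b]
  have h2 : R ^ 2 ≤ R ^ 2 * (1 + l ^ 2) := le_mul_of_one_le_right (sq_nonneg R) (by nlinarith)
  have h3 : (a ^ 2 - t ^ 2 - 2 * a * t * l) / (4 * (1 + l ^ 2)) + σ ^ 2 / (8 * (1 + l ^ 2)) =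
      (2 * (a ^ 2 - t ^ 2 - 2 * a * t * l) + σ ^ 2) / (8 * (1 + l ^ 2)) := by
    field_simp
    ring
  have h4 : (2 * (a ^ 2 - t ^ 2 - 2 * a * t * l) + σ ^ 2) / (8 * (1 + l ^ 2)) ≤ R ^ 2 := by
    rw [div_le_iff₀ (by positivity)]
    linarith
  rw [e]
  linarith

/-- Gaussian decay of Gaussian integrals in imaginary directions. -/
theorem exists_norm_quadInt_le {T : Matrix (Fin d) (Fin d) ℝ} (hT : T.det ≠ 0) (l : Fin d → ℝ)
    (R : ℝ) : ∃ A > 0, ∃ a > 0, ∀ (ρ : Fin d → ℂ) (ξ : Fin d → ℝ), (∀ n, ‖ρ n‖ ≤ R) →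
      ‖quadInt T l (fun n => ρ n - Complex.I * ξ n)‖ ≤ A * Real.exp (-a * ∑ n, ξ n ^ 2) := by
  obtain ⟨c, hc, hcT⟩ := exists_sum_sq_mulVec_ge (T := Tᵀ) (by rwa [det_transpose])
  set R' := ∑ n, ∑ m, |R| * |T m n| with hR'
  set L := ∑ n, l n ^ 2 with hL
  have hL0 : 0 ≤ L := Finset.sum_nonneg fun n _ => sq_nonneg _
  set Z := ∏ n, ‖((Real.pi / (1 - Complex.I * l n)) ^ (1 / 2 : ℂ) : ℂ)‖ with hZ
  have hZ0 : 0 ≤ Z := Finset.prod_nonneg fun n _ => norm_nonneg _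
  -- The rate combines the lower bound c for the transpose of T with the denominators 8(1 + l²), all
  -- at most 8(1 + L). The summand 1 secures positivity.
  refine ⟨|T.det| * (Z * Real.exp (∑ n, R' ^ 2 * (1 + l n ^ 2))) + 1, by positivity,
    c / (8 * (1 + L)), by positivity, fun ρ ξ hρ => ?_⟩
  have hsum : ∀ n, ∑ m, (ρ m - Complex.I * ξ m) * (T m n : ℂ) =
      (∑ m, ρ m * T m n) - Complex.I * (((Tᵀ *ᵥ ξ) n : ℝ) : ℂ) := fun n => by
    simp only [sub_mul, Finset.sum_sub_distrib, mulVec, dotProduct, transpose_apply,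
      Complex.ofReal_sum, Finset.mul_sum, Complex.ofReal_mul]
    congr 1
    exact Finset.sum_congr rfl fun m _ => by ring
  have hρ' : ∀ n, ‖∑ m, ρ m * (T m n : ℂ)‖ ≤ R' := fun n => by
    refine (norm_sum_le_of_le _ fun m _ => ?_).trans
      (Finset.single_le_sum (f := fun n => ∑ m, |R| * |T m n|)
        (fun n _ => Finset.sum_nonneg fun m _ => by positivity) (Finset.mem_univ n))
    rw [norm_mul, Complex.norm_real, Real.norm_eq_abs]
    exact mul_le_mul_of_nonneg_right ((hρ m).trans (le_abs_self R)) (abs_nonneg _)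
  have hexp : ∑ n, ((∑ m, (ρ m - Complex.I * ξ m) * (T m n : ℂ)) ^ 2 /
      (4 * (1 - Complex.I * l n))).re ≤
      ∑ n, R' ^ 2 * (1 + l n ^ 2) + -(c / (8 * (1 + L))) * ∑ n, ξ n ^ 2 := by
    have h1 : ∀ n, ((∑ m, (ρ m - Complex.I * ξ m) * (T m n : ℂ)) ^ 2 /
        (4 * (1 - Complex.I * l n))).re ≤
        R' ^ 2 * (1 + l n ^ 2) - (Tᵀ *ᵥ ξ) n ^ 2 / (8 * (1 + L)) := fun n => by
      rw [hsum]
      refine (re_sq_div_le (hρ' n)).trans (sub_le_sub_left ?_ _)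
      have : l n ^ 2 ≤ L := Finset.single_le_sum (f := fun n => l n ^ 2)
        (fun n _ => sq_nonneg _) (Finset.mem_univ n)
      gcongr
    refine (Finset.sum_le_sum fun n _ => h1 n).trans ?_
    rw [Finset.sum_sub_distrib, ← Finset.sum_div, sub_eq_add_neg, neg_mul, div_mul_eq_mul_div]
    gcongr
    exact hcT ξ
  rw [quadInt, norm_mul, norm_prod, Complex.norm_real, Real.norm_of_nonneg (abs_nonneg _)]
  simp only [norm_mul, Complex.norm_exp]
  rw [Finset.prod_mul_distrib, ← hZ, ← Real.exp_sum]
  calc |T.det| * (Z * Real.exp (∑ n, ((∑ m, (ρ m - Complex.I * ξ m) * (T m n : ℂ)) ^ 2 /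
      (4 * (1 - Complex.I * l n))).re)) ≤ |T.det| * (Z * (Real.exp (∑ n, R' ^ 2 * (1 + l n ^ 2)) *
        Real.exp (-(c / (8 * (1 + L))) * ∑ n, ξ n ^ 2))) := by
        rw [← Real.exp_add]
        gcongr
    _ = |T.det| * (Z * Real.exp (∑ n, R' ^ 2 * (1 + l n ^ 2))) *
        Real.exp (-(c / (8 * (1 + L))) * ∑ n, ξ n ^ 2) := by ring
    _ ≤ _ := by
        gcongr
        linarith

end GaussianIntegral


/-! ### Momentum representation of the reconstruction -/

section Momentum

open Matrix

variable {d : ℕ}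

open FourierTransform in
/-- Fourier inversion in coordinates, with the semiclassical scaling. -/
theorem integral_fourier_inversion {F : (Fin d → ℝ) → ℂ} (hc : Continuous F) (hi : Integrable F)
    {ε : ℝ} (hε : 0 < ε)
    (hF : Integrable fun η : Fin d → ℝ =>
      ∫ y : Fin d → ℝ, F y * Complex.exp (-(Complex.I / ε) * ∑ n, (η n : ℂ) * y n))
    (x : Fin d → ℝ) :
    ∫ η : Fin d → ℝ, Complex.exp (Complex.I / ε * ∑ n, (η n : ℂ) * x n) *
      ∫ y : Fin d → ℝ, F y * Complex.exp (-(Complex.I / ε) * ∑ n, (η n : ℂ) * y n) =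
      (2 * Real.pi * ε) ^ d * F x := by
  set H : (Fin d → ℝ) → ℂ := fun η =>
    ∫ y : Fin d → ℝ, F y * Complex.exp (-(Complex.I / ε) * ∑ n, (η n : ℂ) * y n) with hH
  -- Transport to Euclidean space with the kernel exp(-2πi⟨y, w⟩) and substitute η = 2πε w; the
  -- Jacobian is the factor (2πε)^d.
  set G : EuclideanSpace ℝ (Fin d) → ℂ := fun v => F v.ofLp with hG
  have hemb := (MeasurableEquiv.toLp 2 (Fin d → ℝ)).measurableEmbedding
  have hvol := PiLp.volume_preserving_toLp (Fin d)
  have hr : 0 < 2 * Real.pi * ε := by positivity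
  have hGi : Integrable G := (hvol.integrable_comp_emb hemb).1 hi
  have hGc : Continuous G := hc.comp (PiLp.continuous_ofLp 2 _)
  have hε' : (ε : ℂ) ≠ 0 := Complex.ofReal_ne_zero.2 hε.ne'
  have hFG : ∀ w : Fin d → ℝ, 𝓕 G (WithLp.toLp 2 w) = H ((2 * Real.pi * ε) • w) := by
    intro w
    rw [Real.fourier_eq', ← hvol.integral_comp hemb, hH]
    refine integral_congr_ae (Filter.Eventually.of_forall fun y => ?_)
    simp only [hG, smul_eq_mul, mul_comm (F y)]
    congr 2
    simp only [PiLp.inner_apply, RCLike.inner_apply, conj_trivial, Pi.smul_apply, smul_eq_mul]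
    push_cast
    simp only [Finset.mul_sum, Finset.sum_mul]
    refine Finset.sum_congr rfl fun n _ => ?_
    field_simp
  have hHi : Integrable fun w : Fin d → ℝ => H ((2 * Real.pi * ε) • w) :=
    hF.comp_smul hr.ne'
  have hFGi : Integrable (𝓕 G) := by
    rw [← hvol.integrable_comp_emb hemb]
    exact hHi.congr (Filter.Eventually.of_forall fun w => (hFG w).symm)
  have hinv := congrFun (hGc.fourierInv_fourier_eq hGi hFGi) (WithLp.toLp 2 x)
  rw [Real.fourierInv_eq', ← hvol.integral_comp hemb] at hinv
  have hs := Measure.integral_comp_smul (volume : Measure (Fin d → ℝ))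
    (fun η : Fin d → ℝ => Complex.exp (Complex.I / ε * ∑ n, (η n : ℂ) * x n) * H η)
    (2 * Real.pi * ε)
  rw [Module.finrank_fin_fun, abs_of_pos (by positivity)] at hs
  have hs2 : ∫ w : Fin d → ℝ, Complex.exp (Complex.I / ε *
      ∑ n, ((((2 * Real.pi * ε) • w) n : ℝ) : ℂ) * x n) * H ((2 * Real.pi * ε) • w) = F x := by
    rw [show F x = G (WithLp.toLp 2 x) from rfl, ← hinv]
    refine integral_congr_ae (Filter.Eventually.of_forall fun w => ?_)
    simp only [hFG, smul_eq_mul]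
    congr 2
    simp only [PiLp.inner_apply, RCLike.inner_apply, conj_trivial, Pi.smul_apply, smul_eq_mul]
    push_cast
    simp only [Finset.mul_sum, Finset.sum_mul]
    refine Finset.sum_congr rfl fun n _ => ?_
    field_simp
  rw [hs2, Complex.real_smul] at hs
  rw [hs, ← mul_assoc]
  push_cast
  rw [mul_inv_cancel₀ (pow_ne_zero _ (mul_ne_zero (mul_ne_zero two_ne_zero
    (Complex.ofReal_ne_zero.2 Real.pi_ne_zero)) hε')), one_mul]

/-! ### Wave packets, overlaps and the momentum kernel -/

theorem packet_eq_mul (ε : ℝ) (C : Matrix (Fin d) (Fin d) ℂ) (q p x : Fin d → ℝ) :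
    packet ε C q p x = packet ε C q 0 x *
      Complex.exp (Complex.I / ε * ∑ n, (p n : ℂ) * ((x n : ℂ) - q n)) := by
  have h : ((p ⬝ᵥ (x - q) : ℝ) : ℂ) = ∑ n, (p n : ℂ) * ((x n : ℂ) - q n) := by
    simp [dotProduct]
  rw [packet, packet, mul_assoc, ← Complex.exp_add, h]
  congr 2
  simp
  ring

theorem packet_add (ε : ℝ) (C : Matrix (Fin d) (Fin d) ℂ) (q p a x : Fin d → ℝ) :
    packet ε C q p (x + a) = packet ε C (q - a) p x := by
  have h : ∀ n, (x + a) n - q n = x n - (q - a) n := fun n => by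
    simp only [Pi.add_apply, Pi.sub_apply]
    ring
  have h2 : x + a - q = x - (q - a) := by abel
  simp only [packet, h, h2]

theorem continuous_packet (ε : ℝ) (C : Matrix (Fin d) (Fin d) ℂ) (q p : Fin d → ℝ) :
    Continuous (packet ε C q p) := by
  unfold packet mulVec dotProduct
  fun_prop

/-- The exponent matrix of the product of two packets: real part. -/
noncomputable def decayMatrix (ε : ℝ) (C C₀ : Matrix (Fin d) (Fin d) ℂ) :
    Matrix (Fin d) (Fin d) ℝ := (1 / (2 * ε)) • (C.map Complex.im + C₀.map Complex.im)

/-- The exponent matrix of the product of two packets: imaginary part. -/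
noncomputable def phaseMatrix (ε : ℝ) (C C₀ : Matrix (Fin d) (Fin d) ℂ) :
    Matrix (Fin d) (Fin d) ℝ := (1 / (2 * ε)) • (C₀.map Complex.re - C.map Complex.re)

/-- The constant factor of the product of two packets. -/
noncomputable def packetFactor (ε : ℝ) (C C₀ : Matrix (Fin d) (Fin d) ℂ) : ℝ :=
  ((Real.pi * ε) ^ (-(d : ℝ) / 4) * (C.map Complex.im).det ^ ((1 : ℝ) / 4)) *
    ((Real.pi * ε) ^ (-(d : ℝ) / 4) * (C₀.map Complex.im).det ^ ((1 : ℝ) / 4))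

theorem ofReal_dotProduct_mulVec (P : Matrix (Fin d) (Fin d) ℝ) (u v : Fin d → ℝ) :
    ((u ⬝ᵥ P *ᵥ v : ℝ) : ℂ) =
      (fun n => (u n : ℂ)) ⬝ᵥ ((P.map Complex.ofReal) *ᵥ fun n => (v n : ℂ)) := by
  simp [dotProduct, mulVec]

/-- Only C is conjugated, so imaginary parts add up to the decay and real parts subtract to the
phase. The centre q enters only through a constant factor and the linear coefficient, so one
diagonalization serves all grid points. -/
theorem conj_packet_mul_packet {ε : ℝ} (hε : 0 < ε) {C C₀ : Matrix (Fin d) (Fin d) ℂ}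
    (hC : C.IsSymm) (q y : Fin d → ℝ) :
    (starRingEnd ℂ) (packet ε C q 0 y) * packet ε C₀ 0 0 y =
      packetFactor ε C C₀ * Complex.exp (-(Complex.I / (2 * ε)) *
        ((fun n => (q n : ℂ)) ⬝ᵥ ((C.map (starRingEnd ℂ)) *ᵥ fun n => (q n : ℂ)))) *
      quadExp (decayMatrix ε C C₀) (phaseMatrix ε C C₀)
        (fun n => Complex.I / ε * ((C.map (starRingEnd ℂ)) *ᵥ fun m => (q m : ℂ)) n) y := by
  have hε' : (ε : ℂ) ≠ 0 := Complex.ofReal_ne_zero.2 hε.ne'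
  set D := C.map (starRingEnd ℂ) with hD
  have hDs : Dᵀ = D := by
    rw [hD, ← transpose_map, hC.eq]
  set v : Fin d → ℂ := fun n => (y n : ℂ) with hv
  set w : Fin d → ℂ := fun n => (q n : ℂ) with hw
  have e1 : (fun n => ((y n - q n : ℝ) : ℂ)) = v - w := by
    funext n
    simp [hv, hw]
  have e2 : (starRingEnd ℂ) ((v - w) ⬝ᵥ (C *ᵥ (v - w))) = (v - w) ⬝ᵥ (D *ᵥ (v - w)) := by
    simp [dotProduct, mulVec, hD, hv, hw]
  -- Symmetry of C merges the two cross terms.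
  have e3 : w ⬝ᵥ (D *ᵥ v) = v ⬝ᵥ (D *ᵥ w) := by
    rw [dotProduct_mulVec, ← mulVec_transpose, hDs, dotProduct_comm]
  have e4 : (v - w) ⬝ᵥ (D *ᵥ (v - w)) =
      v ⬝ᵥ (D *ᵥ v) - 2 * (v ⬝ᵥ (D *ᵥ w)) + w ⬝ᵥ (D *ᵥ w) := by
    rw [mulVec_sub, sub_dotProduct, dotProduct_sub, dotProduct_sub, e3]
    ring
  have e5 : -((y ⬝ᵥ decayMatrix ε C C₀ *ᵥ y : ℝ) : ℂ) +
      Complex.I * ((y ⬝ᵥ phaseMatrix ε C C₀ *ᵥ y : ℝ) : ℂ) =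
      Complex.I / (2 * ε) * (v ⬝ᵥ (C₀ *ᵥ v) - v ⬝ᵥ (D *ᵥ v)) := by
    rw [ofReal_dotProduct_mulVec, ofReal_dotProduct_mulVec]
    simp only [dotProduct, mulVec, ← Finset.sum_neg_distrib, Finset.mul_sum,
      ← Finset.sum_sub_distrib, ← Finset.sum_add_distrib]
    refine Finset.sum_congr rfl fun i _ => Finset.sum_congr rfl fun j _ => ?_
    have hc1 : (starRingEnd ℂ) (C i j) = (C i j).re - (C i j).im * Complex.I := by
      apply Complex.ext <;> simp
    have hc2 : C₀ i j = (C₀ i j).re + (C₀ i j).im * Complex.I := (Complex.re_add_im _).symm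
    simp only [decayMatrix, phaseMatrix, hD, map_apply, Matrix.smul_apply,
      Matrix.add_apply, Matrix.sub_apply, smul_eq_mul]
    rw [hc1]
    conv_rhs => rw [hc2]
    push_cast
    field_simp
    linear_combination (-(y i : ℂ) * y j * ((C i j).im + (C₀ i j).im)) * Complex.I_sq
  have e6 : ∑ n, Complex.I / ε * (D *ᵥ w) n * (y n : ℂ) = Complex.I / ε * (v ⬝ᵥ (D *ᵥ w)) := by
    simp only [dotProduct, Finset.mul_sum]
    exact Finset.sum_congr rfl fun n _ => by rw [hv]; ring
  have e7 : (fun n => ((y n - (0 : Fin d → ℝ) n : ℝ) : ℂ)) = v := by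
    funext n
    simp [hv]
  rw [quadExp, e5, e6, packet, packet, e1, e7, packetFactor]
  simp only [map_mul, Complex.conj_ofReal, ← Complex.exp_conj, zero_dotProduct, Complex.ofReal_zero,
    add_zero, map_div₀, Complex.conj_I, map_one, map_ofNat, e2, e4]
  push_cast
  rw [mul_mul_mul_comm, mul_assoc _ (Complex.exp _) (Complex.exp _), ← Complex.exp_add,
    ← Complex.exp_add]
  congr 2
  field_simp
  ring

theorem posDef_decayMatrix {ε : ℝ} (hε : 0 < ε) {C C₀ : Matrix (Fin d) (Fin d) ℂ}
    (hC : C ∈ SiegelUpperHalfSpace d) (hC₀ : C₀ ∈ SiegelUpperHalfSpace d) :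
    (decayMatrix ε C C₀).PosDef :=
  (hC.2.add hC₀.2).smul (by positivity)

theorem isHermitian_phaseMatrix (ε : ℝ) {C C₀ : Matrix (Fin d) (Fin d) ℂ}
    (hC : C ∈ SiegelUpperHalfSpace d) (hC₀ : C₀ ∈ SiegelUpperHalfSpace d) :
    (phaseMatrix ε C C₀).IsHermitian := by
  have h1 := hC.1
  have h2 := hC₀.1
  rw [IsHermitian, conjTranspose_eq_transpose_of_trivial, phaseMatrix, transpose_smul,
    transpose_sub, ← transpose_map, ← transpose_map, h1.eq, h2.eq]

/-- The overlap of a packet at rest with the centred initial packet, at complex momentum `z`. -/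
noncomputable def overlap (ε : ℝ) (C C₀ : Matrix (Fin d) (Fin d) ℂ) (q : Fin d → ℝ)
    (z : Fin d → ℂ) : ℂ :=
  ∫ y, (starRingEnd ℂ) (packet ε C q 0 y) * packet ε C₀ 0 0 y *
    Complex.exp (-(Complex.I / ε) * ∑ n, z n * y n)

/-- The integrand of the momentum integral that reproduces the initial packet. -/
noncomputable def momentumKernel (ε : ℝ) (C C₀ : Matrix (Fin d) (Fin d) ℂ) (q x : Fin d → ℝ)
    (z : Fin d → ℂ) : ℂ :=
  ((2 * Real.pi * ε : ℝ) ^ d : ℂ)⁻¹ * Complex.exp (Complex.I / ε * ∑ n, z n * x n) *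
    overlap ε C C₀ q z

theorem quadExp_mul_exp (P S : Matrix (Fin d) (Fin d) ℝ) (c b : Fin d → ℂ) (y : Fin d → ℝ) :
    quadExp P S c y * Complex.exp (∑ n, b n * y n) = quadExp P S (fun n => c n + b n) y := by
  rw [quadExp, quadExp, ← Complex.exp_add]
  congr 1
  simp only [add_mul, Finset.sum_add_distrib]
  ring

theorem overlap_eq {ε : ℝ} (hε : 0 < ε) {C C₀ : Matrix (Fin d) (Fin d) ℂ}
    (hC : C.IsSymm) {T : Matrix (Fin d) (Fin d) ℝ} {l : Fin d → ℝ} (hT : T.det ≠ 0)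
    (h1 : Tᵀ * decayMatrix ε C C₀ * T = 1) (h2 : Tᵀ * phaseMatrix ε C C₀ * T = diagonal l)
    (q : Fin d → ℝ) (z : Fin d → ℂ) :
    overlap ε C C₀ q z = packetFactor ε C C₀ * Complex.exp (-(Complex.I / (2 * ε)) *
        ((fun n => (q n : ℂ)) ⬝ᵥ ((C.map (starRingEnd ℂ)) *ᵥ fun n => (q n : ℂ)))) *
      quadInt T l (fun n => Complex.I / ε *
        ((C.map (starRingEnd ℂ)) *ᵥ fun m => (q m : ℂ)) n + -(Complex.I / ε) * z n) := by
  rw [← integral_quadExp hT h1 h2, ← integral_const_mul, overlap]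
  refine integral_congr_ae (Filter.Eventually.of_forall fun y => ?_)
  simp only
  rw [conj_packet_mul_packet hε hC, mul_assoc, ← quadExp_mul_exp]
  congr 3
  rw [Finset.mul_sum]
  exact Finset.sum_congr rfl fun n _ => by ring

theorem norm_dotProduct_mulVec_le (D : Matrix (Fin d) (Fin d) ℂ) {q : Fin d → ℝ} {R : ℝ}
    (hq : ∀ n, |q n| ≤ R) :
    ‖(fun n => (q n : ℂ)) ⬝ᵥ (D *ᵥ fun n => (q n : ℂ))‖ ≤ R ^ 2 * ∑ n, ∑ m, ‖D n m‖ := by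
  simp only [dotProduct, mulVec, Finset.mul_sum]
  refine norm_sum_le_of_le _ fun n _ => norm_sum_le_of_le _ fun m _ => ?_
  rw [norm_mul, norm_mul, Complex.norm_real, Complex.norm_real, Real.norm_eq_abs, Real.norm_eq_abs]
  have := mul_le_mul (hq n) (hq m) (abs_nonneg _) ((abs_nonneg _).trans (hq n))
  calc _ = |q n| * |q m| * ‖D n m‖ := by ring
    _ ≤ R * R * ‖D n m‖ := mul_le_mul_of_nonneg_right this (norm_nonneg _)
    _ = _ := by ring

theorem norm_mulVec_le (D : Matrix (Fin d) (Fin d) ℂ) {q : Fin d → ℝ} {R : ℝ}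
    (hq : ∀ n, |q n| ≤ R) (n : Fin d) :
    ‖(D *ᵥ fun n => (q n : ℂ)) n‖ ≤ |R| * ∑ n, ∑ m, ‖D n m‖ := by
  refine le_trans ?_ (mul_le_mul_of_nonneg_left (Finset.single_le_sum
    (f := fun n => ∑ m, ‖D n m‖) (fun n _ => Finset.sum_nonneg fun m _ => norm_nonneg _)
    (Finset.mem_univ n)) (abs_nonneg R))
  simp only [mulVec, dotProduct, Finset.mul_sum]
  refine norm_sum_le_of_le _ fun m _ => ?_
  rw [norm_mul, Complex.norm_real, Real.norm_eq_abs, mul_comm]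
  exact mul_le_mul_of_nonneg_right ((hq m).trans (le_abs_self R)) (norm_nonneg _)

/-- The momentum enters the Gaussian integral as the linear coefficient -(i/ε) z. Its real part is
the direction of Gaussian decay; Im z and q only add a bounded perturbation, uniformly over the cube
of radius R. -/
theorem exists_tubeGaussian_momentumKernel {ε : ℝ} (hε : 0 < ε)
    {C C₀ : Matrix (Fin d) (Fin d) ℂ} (hC : C ∈ SiegelUpperHalfSpace d)
    (hC₀ : C₀ ∈ SiegelUpperHalfSpace d) (R : ℝ) :
    ∃ A > 0, ∃ a > 0, ∀ q x : Fin d → ℝ, (∀ n, |q n| ≤ R) → (∀ n, |x n| ≤ R) →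
      TubeGaussian a 1 A (momentumKernel ε C C₀ q x) := by
  obtain ⟨T, l, hT, h1, h2⟩ := exists_simultaneous_diagonal (posDef_decayMatrix hε hC hC₀)
    (isHermitian_phaseMatrix ε hC hC₀)
  set D := C.map (starRingEnd ℂ) with hD
  set κ := ∑ n, ∑ m, ‖D n m‖ with hκ
  obtain ⟨A, hA, a, ha, hb⟩ := exists_norm_quadInt_le hT l (1 / ε * (|R| * κ) + 1 / ε)
  set B := ‖((2 * Real.pi * ε : ℝ) ^ d : ℂ)⁻¹‖ * Real.exp (1 / ε * ∑ _ : Fin d, |R|) *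
    ((‖(packetFactor ε C C₀ : ℂ)‖ + 1) * Real.exp (1 / (2 * ε) * (R ^ 2 * κ)) * A) with hB
  have hW : 0 < ‖((2 * Real.pi * ε : ℝ) ^ d : ℂ)⁻¹‖ :=
    norm_pos_iff.2 (inv_ne_zero (pow_ne_zero _ (Complex.ofReal_ne_zero.2 (by positivity))))
  have hεn : ‖(Complex.I / ε : ℂ)‖ = 1 / ε := by
    rw [norm_div, Complex.norm_I, Complex.norm_real, Real.norm_of_nonneg hε.le]
  have hεn2 : ‖(-(Complex.I / (2 * ε)) : ℂ)‖ = 1 / (2 * ε) := by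
    rw [norm_neg, norm_div, norm_mul, Complex.norm_I, Complex.norm_real, Real.norm_of_nonneg hε.le]
    norm_num
  have hε' : (ε : ℂ) ≠ 0 := Complex.ofReal_ne_zero.2 hε.ne'
  refine ⟨B, by positivity, a / ε ^ 2, by positivity, fun q x hq hx => ⟨?_, fun z hz => ?_⟩⟩
  · have hd : Differentiable ℂ (overlap ε C C₀ q) := by
      rw [funext (overlap_eq hε hC.1 hT h1 h2 q)]
      exact ((differentiable_quadInt T l).comp (by fun_prop)).const_mul _
    unfold momentumKernel
    fun_prop
  · have e1 : (fun n => Complex.I / ε * (D *ᵥ fun m => (q m : ℂ)) n + -(Complex.I / ε) * z n) =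
        fun n => (Complex.I / ε * (D *ᵥ fun m => (q m : ℂ)) n + ((z n).im / ε : ℝ)) -
          Complex.I * (((z n).re / ε : ℝ) : ℂ) := by
      funext n
      conv_lhs => rw [← Complex.re_add_im (z n)]
      push_cast
      field_simp
      linear_combination (-((z n).im : ℂ)) * Complex.I_sq
    have e2 := hb (fun n => Complex.I / ε * (D *ᵥ fun m => (q m : ℂ)) n + ((z n).im / ε : ℝ))
      (fun n => (z n).re / ε) fun n => by
        refine norm_add_le_of_le ?_ ?_
        · rw [norm_mul, hεn]
          exact mul_le_mul_of_nonneg_left (norm_mulVec_le D hq n) (by positivity)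
        · rw [Complex.norm_real, norm_div, Real.norm_of_nonneg hε.le, Real.norm_eq_abs]
          exact div_le_div_of_nonneg_right (hz n) hε.le
    have e3 : Real.exp (-a * ∑ n, ((z n).re / ε) ^ 2) =
        ∏ n, Real.exp (-(a / ε ^ 2) * (z n).re ^ 2) := by
      rw [← Real.exp_sum, Finset.mul_sum]
      congr 1
      exact Finset.sum_congr rfl fun n _ => by field_simp
    have e4 : ‖Complex.exp (Complex.I / ε * ∑ n, z n * x n)‖ ≤
        Real.exp (1 / ε * ∑ _ : Fin d, |R|) := by
      have e : (Complex.I / ε * ∑ n, z n * x n).re = 1 / ε * ∑ n, -(z n).im * x n := by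
        rw [Finset.mul_sum, Complex.re_sum, Finset.mul_sum]
        refine Finset.sum_congr rfl fun n _ => ?_
        have : Complex.I / ε * (z n * x n) = ((1 / ε : ℝ) : ℂ) * (Complex.I * z n * (x n : ℂ)) := by
          push_cast
          ring
        rw [this, Complex.re_ofReal_mul]
        simp
      rw [Complex.norm_exp, e, Real.exp_le_exp]
      refine mul_le_mul_of_nonneg_left (Finset.sum_le_sum fun n _ => ?_) (by positivity)
      refine (le_abs_self _).trans ?_
      rw [abs_mul, abs_neg]
      exact (mul_le_mul (hz n) ((hx n).trans (le_abs_self R)) (abs_nonneg _) zero_le_one).trans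
        (one_mul _).le
    have e5 : ‖Complex.exp (-(Complex.I / (2 * ε)) *
        ((fun n => (q n : ℂ)) ⬝ᵥ (D *ᵥ fun n => (q n : ℂ))))‖ ≤
        Real.exp (1 / (2 * ε) * (R ^ 2 * κ)) := by
      refine (Complex.norm_exp_le_exp_norm _).trans (Real.exp_le_exp.2 ?_)
      rw [norm_mul, hεn2]
      exact mul_le_mul_of_nonneg_left (norm_dotProduct_mulVec_le D hq) (by positivity)
    rw [momentumKernel, overlap_eq hε hC.1 hT h1 h2, e1, norm_mul, norm_mul, norm_mul, norm_mul, hB,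
      ← e3, mul_assoc _ _ (Real.exp _), mul_assoc _ A]
    gcongr
    linarith

/-- The momentum integral reproduces the product of the two packets. -/
theorem integral_momentumKernel {ε : ℝ} (hε : 0 < ε)
    {C C₀ : Matrix (Fin d) (Fin d) ℂ} (hC : C ∈ SiegelUpperHalfSpace d)
    (hC₀ : C₀ ∈ SiegelUpperHalfSpace d) (q x : Fin d → ℝ) :
    ∫ η : Fin d → ℝ, momentumKernel ε C C₀ q x (fun n => η n) =
      (starRingEnd ℂ) (packet ε C q 0 x) * packet ε C₀ 0 0 x := by
  have hε' : (ε : ℂ) ≠ 0 := Complex.ofReal_ne_zero.2 hε.ne'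
  have hw : ((2 * Real.pi * ε : ℝ) ^ d : ℂ) ≠ 0 :=
    pow_ne_zero _ (Complex.ofReal_ne_zero.2 (by positivity))
  have hcont : Continuous fun y => (starRingEnd ℂ) (packet ε C q 0 y) * packet ε C₀ 0 0 y :=
    (Complex.continuous_conj.comp (continuous_packet ε C q 0)).mul (continuous_packet ε C₀ 0 0)
  have hint : Integrable fun y => (starRingEnd ℂ) (packet ε C q 0 y) * packet ε C₀ 0 0 y := by
    rw [funext (conj_packet_mul_packet (C₀ := C₀) hε hC.1 q)]
    exact (integrable_quadExp (posDef_decayMatrix hε hC hC₀) _ _).const_mul _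
  -- The kernel at x = 0 is a multiple of the overlap, so the tube bound also provides the
  -- integrability needed for inversion.
  have hF : Integrable fun η : Fin d → ℝ => overlap ε C C₀ q fun n => η n := by
    obtain ⟨A, -, a, ha, hK⟩ := exists_tubeGaussian_momentumKernel hε hC hC₀ (∑ n, |q n|)
    have hq : ∀ n, |q n| ≤ ∑ n, |q n| := fun n =>
      Finset.single_le_sum (f := fun n => |q n|) (fun n _ => abs_nonneg _) (Finset.mem_univ n)
    have h0 := hK q 0 hq fun n => by
      simpa using (abs_nonneg _).trans (hq n)
    have h := (h0.integrable_comp (ν := volume) (s := id) measurable_id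
      (integrable_exp_neg_mul_sq ha) zero_le_one).const_mul ((2 * Real.pi * ε : ℝ) ^ d : ℂ)
    refine h.congr (Filter.Eventually.of_forall fun η => ?_)
    simp [momentumKernel]
    field_simp
  have h := integral_fourier_inversion hcont hint hε hF x
  have e : ∀ η : Fin d → ℝ, momentumKernel ε C C₀ q x (fun n => η n) =
      ((2 * Real.pi * ε : ℝ) ^ d : ℂ)⁻¹ * (Complex.exp (Complex.I / ε * ∑ n, (η n : ℂ) * x n) *
        overlap ε C C₀ q fun n => η n) := fun η => mul_assoc _ _ _
  simp only [e, integral_const_mul]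
  unfold overlap
  rw [h]
  push_cast at hw ⊢
  rw [inv_mul_cancel_left₀ hw]

/-- Each term of the reconstruction samples the momentum kernel at a quadrature node. -/
theorem recTerm_eq {ι κ : Type} (ε : ℝ) (C C₀ : Matrix (Fin d) (Fin d) ℂ) (q₀ p₀ : Fin d → ℝ)
    (Q : κ → Fin d → ℝ) (p : ι → Fin d → ℝ) (ω : ι → ℝ) (x : Fin d → ℝ) (k : κ) (j : ι) :
    recTerm ε C (packet ε C₀ q₀ p₀) Q p ω x k j =
      packet ε C (Q k) 0 x * Complex.exp (Complex.I / ε * ∑ n, (p₀ n : ℂ) * ((x n : ℂ) - q₀ n)) *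
        (ω j * momentumKernel ε C C₀ (Q k - q₀) (x - q₀) fun n => ((p j n - p₀ n : ℝ) : ℂ)) := by
  have h1 : braket (packet ε C (Q k) (p j)) (packet ε C₀ q₀ p₀) =
      Complex.exp (Complex.I / ε * ∑ n, (p j n : ℂ) * ((Q k n : ℂ) - q₀ n)) *
        overlap ε C C₀ (Q k - q₀) fun n => ((p j n - p₀ n : ℝ) : ℂ) := by
    rw [braket, ← integral_add_right_eq_self _ q₀, overlap, ← integral_const_mul]
    refine integral_congr_ae (Filter.Eventually.of_forall fun y => ?_)
    simp only [packet_add, sub_self]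
    rw [packet_eq_mul ε C _ (p j), packet_eq_mul ε C₀ _ p₀]
    simp only [map_mul, ← Complex.exp_conj, map_div₀, Complex.conj_I, Complex.conj_ofReal, map_sum,
      map_sub]
    have : ∀ u v w a b c : ℂ, a + b = c + w → u * Complex.exp a * (v * Complex.exp b) =
        Complex.exp c * (u * v * Complex.exp w) := fun u v w a b c h => by
      have h' : Complex.exp a * Complex.exp b = Complex.exp c * Complex.exp w := by
        rw [← Complex.exp_add, ← Complex.exp_add, h]
      linear_combination u * v * h'
    refine this _ _ _ _ _ _ ?_
    simp only [Finset.mul_sum, ← Finset.sum_add_distrib]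
    refine Finset.sum_congr rfl fun n _ => ?_
    simp
    ring
  -- The phases of the coefficient and of the packet cancel their dependence on the grid point. What
  -- remains is a global phase and a wave in p_j - p₀, which is why the constants do not depend on
  -- p₀.
  have h2 : Complex.exp (Complex.I / ε * ∑ n, (p j n : ℂ) * ((Q k n : ℂ) - q₀ n)) *
      Complex.exp (Complex.I / ε * ∑ n, (p j n : ℂ) * ((x n : ℂ) - Q k n)) =
      Complex.exp (Complex.I / ε * ∑ n, (p₀ n : ℂ) * ((x n : ℂ) - q₀ n)) *
      Complex.exp (Complex.I / ε * ∑ n, ((p j n - p₀ n : ℝ) : ℂ) * ((x - q₀) n : ℝ)) := by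
    rw [← Complex.exp_add, ← Complex.exp_add]
    congr 1
    simp only [Finset.mul_sum, ← Finset.sum_add_distrib]
    refine Finset.sum_congr rfl fun n _ => ?_
    simp
    ring
  rw [recTerm, h1, packet_eq_mul ε C (Q k) (p j), momentumKernel]
  push_cast at h2 ⊢
  linear_combination (ω j / (2 * Real.pi * ε) ^ d) * overlap ε C C₀ (Q k - q₀)
    (fun n => ((p j n : ℂ) - p₀ n)) * packet ε C (Q k) 0 x * h2

end Momentum


/-! ### Reconstruction error of tensorized rules -/

/-- A one-dimensional rule with nodes `s` and non-negative weights `ω` that integrates functions in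
a strip class with error `δ` and satisfies the stability bound `B`. -/
structure StableRule {ι : Type} (c ρ B δ : ℝ) (s ω : ι → ℝ) : Prop where
  weight_nonneg : ∀ i, 0 ≤ ω i
  summable : Summable fun i => ω i * Real.exp (-c * s i ^ 2)
  tsum_le : ∑' i, ω i * Real.exp (-c * s i ^ 2) ≤ B
  integral_le : √(Real.pi / c) ≤ B
  error_nonneg : 0 ≤ δ
  error : ∀ (A : ℝ) (f : ℂ → ℂ), StripGaussian c ρ A f →
    ‖(∑' i, (ω i : ℂ) * f (s i)) - ∫ x : ℝ, f x‖ ≤ A * δ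

theorem TubeGaussian.mono {d : ℕ} {c c' ρ A : ℝ} {h : (Fin d → ℂ) → ℂ}
    (hh : TubeGaussian c ρ A h) (hρ : 0 ≤ ρ) (hc : c' ≤ c) : TubeGaussian c' ρ A h where
  differentiable := hh.differentiable
  bound z hz := (hh.bound z hz).trans (mul_le_mul_of_nonneg_left
    (Finset.prod_le_prod (fun _ _ => (Real.exp_pos _).le) fun _ _ => Real.exp_le_exp.2
      (mul_le_mul_of_nonneg_right (neg_le_neg hc) (sq_nonneg _))) (hh.nonneg hρ))

section Reconstruction

open Matrix

variable {d : ℕ}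

/-- Entries of an orthogonal matrix are at most 1 in modulus, so the bound is uniform in U. -/
theorem abs_mulVec_orthogonal_le {U : Matrix (Fin d) (Fin d) ℝ}
    (hU : U ∈ Matrix.orthogonalGroup (Fin d) ℝ) {y : Fin d → ℝ} {L : ℝ} (hy : ∀ n, |y n| ≤ L)
    (n : Fin d) : |(U *ᵥ y) n| ≤ d * L := by
  calc |(U *ᵥ y) n| ≤ ∑ m, |U n m * y m| := by
        rw [mulVec, dotProduct]
        exact Finset.abs_sum_le_sum_abs (fun m => U n m * y m) Finset.univ
    _ ≤ ∑ _m : Fin d, L := Finset.sum_le_sum fun m _ => by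
        rw [abs_mul]
        have h := entry_norm_bound_of_unitary hU n m
        rw [Real.norm_eq_abs] at h
        calc |U n m| * |y m| ≤ 1 * |y m| := mul_le_mul_of_nonneg_right h (abs_nonneg _)
          _ ≤ L := by rw [one_mul]; exact hy m
    _ = d * L := by simp

theorem abs_sub_le_of_mem_posBox {U : Matrix (Fin d) (Fin d) ℝ}
    (hU : U ∈ Matrix.orthogonalGroup (Fin d) ℝ) {q₀ x : Fin d → ℝ} {L : ℝ}
    (hx : x ∈ posBox U q₀ L) (n : Fin d) : |(x - q₀) n| ≤ d * L := by
  obtain ⟨y, hy, rfl⟩ := hx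
  simpa using abs_mulVec_orthogonal_le hU (fun m => abs_le.2 ⟨hy.1 m, hy.2 m⟩) n

theorem abs_posGrid_sub_le {U : Matrix (Fin d) (Fin d) ℝ}
    (hU : U ∈ Matrix.orthogonalGroup (Fin d) ℝ) (q₀ : Fin d → ℝ) {L : ℝ} (hL : 0 ≤ L) {M : ℕ}
    (k : Fin d → Fin M) (n : Fin d) : |(posGrid U q₀ L M k - q₀) n| ≤ d * L := by
  have h : posGrid U q₀ L M k - q₀ =
      U *ᵥ fun n => -L + (2 * ((k n : ℕ) : ℝ) + 1) / 2 * (2 * L / M) := by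
    simp [posGrid]
  rw [h]
  refine abs_mulVec_orthogonal_le hU (fun m => ?_) n
  have hk : ((k m : ℕ) : ℝ) + 1 ≤ M := by exact_mod_cast (k m).2
  have hk0 : (0 : ℝ) ≤ ((k m : ℕ) : ℝ) := Nat.cast_nonneg _
  have hM : (0 : ℝ) < M := by linarith
  have e : (2 * ((k m : ℕ) : ℝ) + 1) / 2 * (2 * L / M) =
      (2 * ((k m : ℕ) : ℝ) + 1) / M * L := by
    field_simp
  have h1 : (2 * ((k m : ℕ) : ℝ) + 1) / M * L ≤ 2 * L :=
    mul_le_mul_of_nonneg_right ((div_le_iff₀ hM).2 (by linarith)) hL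
  have h2 : 0 ≤ (2 * ((k m : ℕ) : ℝ) + 1) / M * L := by positivity
  rw [e, abs_le]
  constructor <;> linarith

theorem packet_ne_zero {ε : ℝ} (hε : 0 < ε) {C : Matrix (Fin d) (Fin d) ℂ}
    (hC : C ∈ SiegelUpperHalfSpace d) (q p x : Fin d → ℝ) : packet ε C q p x ≠ 0 := by
  have hdet := hC.2.det_pos
  refine mul_ne_zero (Complex.ofReal_ne_zero.2 ?_) (Complex.exp_ne_zero _)
  positivity

/-- A continuous function without zeros on a compact cube. -/
theorem exists_le_norm_packet {ε : ℝ} (hε : 0 < ε) {C : Matrix (Fin d) (Fin d) ℂ}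
    (hC : C ∈ SiegelUpperHalfSpace d) {R : ℝ} (hR : 0 ≤ R) :
    ∃ c > 0, ∀ v : Fin d → ℝ, (∀ n, |v n| ≤ R) → c ≤ ‖packet ε C 0 0 v‖ := by
  obtain ⟨v, -, hv⟩ := (isCompact_Icc (a := fun _ : Fin d => -R) (b := fun _ => R)).exists_isMinOn
    (Set.nonempty_Icc.2 fun _ => by linarith) (continuous_packet ε C 0 0).norm.continuousOn
  exact ⟨_, norm_pos_iff.2 (packet_ne_zero hε hC 0 0 v), fun w hw =>
    hv ⟨fun n => (abs_le.1 (hw n)).1, fun n => (abs_le.1 (hw n)).2⟩⟩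

theorem packet_eq_sub (ε : ℝ) (C : Matrix (Fin d) (Fin d) ℂ) (q p a x : Fin d → ℝ) :
    packet ε C q p x = packet ε C (q - a) p (x - a) := by
  rw [← packet_add, sub_add_cancel]

theorem norm_cexp_I_div (ε : ℝ) (q p x : Fin d → ℝ) :
    ‖Complex.exp (Complex.I / ε * ∑ n, (p n : ℂ) * ((x n : ℂ) - q n))‖ = 1 := by
  have : Complex.I / ε * ∑ n, (p n : ℂ) * ((x n : ℂ) - q n) =
      ((1 / ε * ∑ n, p n * (x n - q n) : ℝ) : ℂ) * Complex.I := by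
    push_cast
    ring
  rw [this, Complex.norm_exp_ofReal_mul_I]

/-- A weighted average of perturbed values differs from the value by at most the perturbation. -/
theorem norm_weighted_sub_le {κ : Type} [Fintype κ] [Nonempty κ] {g E : κ → ℂ} {ψ : ℂ}
    {c η : ℝ} (hc : 0 < c) (hg : ∀ k, c ≤ ‖g k‖) (hE : ∀ k, ‖E k - ‖g k‖ ^ 2 * ψ‖ ≤ ‖g k‖ * η) :
    ‖ψ - 1 / ((∑ k, ‖g k‖ ^ 2 : ℝ) : ℂ) * ∑ k, E k‖ ≤ η / c := by
  have hpos : ∀ k, 0 < ‖g k‖ := fun k => hc.trans_le (hg k)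
  have hη : 0 ≤ η := by
    obtain ⟨k⟩ := ‹Nonempty κ›
    exact nonneg_of_mul_nonneg_right ((norm_nonneg _).trans (hE k)) (hpos k)
  set S := ∑ k, ‖g k‖ ^ 2 with hS
  have hS0 : 0 < S := Finset.sum_pos (fun k _ => pow_pos (hpos k) 2) Finset.univ_nonempty
  have hS' : (S : ℂ) ≠ 0 := Complex.ofReal_ne_zero.2 hS0.ne'
  have e : ψ - 1 / (S : ℂ) * ∑ k, E k = -(1 / (S : ℂ) * ∑ k, (E k - ‖g k‖ ^ 2 * ψ)) := by
    rw [Finset.sum_sub_distrib, ← Finset.sum_mul]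
    have : ∑ k, (‖g k‖ : ℂ) ^ 2 = S := by
      rw [hS]
      push_cast
      rfl
    rw [this]
    field_simp
    ring
  rw [e, norm_neg, norm_mul, norm_div, norm_one, Complex.norm_real, Real.norm_of_nonneg hS0.le,
    one_div, inv_mul_le_iff₀ hS0, mul_div_assoc', le_div_iff₀ hc]
  calc ‖∑ k, (E k - ‖g k‖ ^ 2 * ψ)‖ * c ≤ (∑ k, ‖g k‖ * η) * c :=
        mul_le_mul_of_nonneg_right (norm_sum_le_of_le _ fun k _ => hE k) hc.le
    _ = (∑ k, ‖g k‖ * c) * η := by rw [← Finset.sum_mul, ← Finset.sum_mul]; ring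
    _ ≤ S * η := mul_le_mul_of_nonneg_right (Finset.sum_le_sum fun k _ => by
        rw [sq]
        exact mul_le_mul_of_nonneg_left (hg k) (hpos k).le) hη

theorem StableRule.norm_tsum_sub_integral_le {ι : Type} [Countable ι] {c ρ B δ A : ℝ}
    {s ω : ι → ℝ} (hr : StableRule c ρ B δ s ω) (hρ : 0 < ρ) (hc : 0 < c)
    {h : (Fin d → ℂ) → ℂ} (hh : TubeGaussian c ρ A h) :
    (Summable fun j : Fin d → ι => ((∏ n, ω (j n) : ℝ) : ℂ) * h fun n => s (j n)) ∧
      ‖(∑' j : Fin d → ι, ((∏ n, ω (j n) : ℝ) : ℂ) * h fun n => s (j n)) -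
        ∫ x : Fin d → ℝ, h (fun n => x n)‖ ≤ A * (d * B ^ (d - 1) * δ) :=
  hh.norm_tsum_sub_integral_le hρ hc hr.weight_nonneg hr.summable hr.tsum_le hr.integral_le
    hr.error_nonneg hr.error

theorem recTerm_tensor_eq {ι κ : Type} (ε : ℝ) (C C₀ : Matrix (Fin d) (Fin d) ℂ)
    (q₀ p₀ : Fin d → ℝ) (Q : κ → Fin d → ℝ) (s ω : ι → ℝ) (x : Fin d → ℝ) (k : κ) :
    recTerm ε C (packet ε C₀ q₀ p₀) Q (fun j n => p₀ n + s (j n))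
      (fun j : Fin d → ι => ∏ n, ω (j n)) x k = fun j =>
      packet ε C (Q k) 0 x * Complex.exp (Complex.I / ε * ∑ n, (p₀ n : ℂ) * ((x n : ℂ) - q₀ n)) *
        (((∏ n, ω (j n) : ℝ) : ℂ) *
          momentumKernel ε C C₀ (Q k - q₀) (x - q₀) fun n => s (j n)) := by
  funext j
  rw [recTerm_eq]
  simp only [add_sub_cancel_left]

/-- Here x need not lie in the box, so the cube and the decay rate of the kernel depend on the
point; hence stability is required at every rate c. -/
theorem summable_recTerm {ε : ℝ} (hε : 0 < ε) {C C₀ : Matrix (Fin d) (Fin d) ℂ}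
    (hC : C ∈ SiegelUpperHalfSpace d) (hC₀ : C₀ ∈ SiegelUpperHalfSpace d) {ι κ : Type}
    [Countable ι] {s ω : ι → ℝ} (hr : ∀ c > 0, ∃ B δ, StableRule c 1 B δ s ω)
    (q₀ p₀ : Fin d → ℝ) (Q : κ → Fin d → ℝ) (x : Fin d → ℝ) (k : κ) :
    Summable (recTerm ε C (packet ε C₀ q₀ p₀) Q (fun j n => p₀ n + s (j n))
      (fun j : Fin d → ι => ∏ n, ω (j n)) x k) := by
  obtain ⟨A, -, a, ha, hK⟩ := exists_tubeGaussian_momentumKernel hε hC hC₀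
    (∑ n, (|(Q k - q₀) n| + |(x - q₀) n|))
  have h : ∀ n, |(Q k - q₀) n| + |(x - q₀) n| ≤ ∑ n, (|(Q k - q₀) n| + |(x - q₀) n|) := fun n =>
    Finset.single_le_sum (f := fun n => |(Q k - q₀) n| + |(x - q₀) n|)
      (fun n _ => by positivity) (Finset.mem_univ n)
  obtain ⟨B, δ, hB⟩ := hr a ha
  rw [recTerm_tensor_eq]
  exact (hB.norm_tsum_sub_integral_le zero_lt_one ha (hK _ _
    (fun n => (le_add_of_nonneg_right (abs_nonneg _)).trans (h n))
    (fun n => (le_add_of_nonneg_left (abs_nonneg _)).trans (h n)))).1.mul_left _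

/-- The reconstruction error is controlled by the one-dimensional quadrature error. -/
theorem exists_supError_le {ε : ℝ} (hε : 0 < ε) {C C₀ : Matrix (Fin d) (Fin d) ℂ}
    (hC : C ∈ SiegelUpperHalfSpace d) (hC₀ : C₀ ∈ SiegelUpperHalfSpace d) {L : ℝ} (hL : 0 ≤ L)
    {a₀ : ℝ} (ha₀ : 0 < a₀) :
    ∃ A > 0, ∃ a > 0, a ≤ a₀ ∧ ∀ (ι : Type) [Countable ι] (s ω : ι → ℝ) (B δ : ℝ),
      StableRule a 1 B δ s ω →
      ∀ (q₀ p₀ : Fin d → ℝ) (U : Matrix (Fin d) (Fin d) ℝ) (M : ℕ),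
        U ∈ Matrix.orthogonalGroup (Fin d) ℝ → 1 ≤ M →
        supError (posBox U q₀ L) (packet ε C₀ q₀ p₀)
          (psiRec ε C (packet ε C₀ q₀ p₀) (posGrid U q₀ L M) (fun j n => p₀ n + s (j n))
            (fun j : Fin d → ι => ∏ n, ω (j n))) ≤
          ENNReal.ofReal (A * (B ^ (d - 1) * δ)) := by
  obtain ⟨A, hA, a, ha, hK⟩ := exists_tubeGaussian_momentumKernel hε hC hC₀ (d * L)
  -- Both x - q₀ and q_k - q₀ lie in the cube of radius dL, so x - q_k lies in that of radius 2dL.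
  obtain ⟨c, hc, hg⟩ := exists_le_norm_packet hε hC (R := d * L + d * L) (by positivity)
  -- Lowering the rate to `a₀` costs nothing and lets the Gauss-Hermite rule demand a small one.
  refine ⟨A * (d + 1) / c, by positivity, min a a₀, lt_min ha ha₀, min_le_right _ _, ?_⟩
  intro ι _ s ω B δ hr q₀ p₀ U M hU hM
  refine iSup₂_le fun x hx => ?_
  rw [← ofReal_norm]
  refine ENNReal.ofReal_le_ofReal ?_
  have : NeZero M := ⟨by omega⟩
  have hB : 0 ≤ B := (Real.sqrt_nonneg _).trans hr.integral_le
  have hδ := hr.error_nonneg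
  have hxq := abs_sub_le_of_mem_posBox hU hx
  have hQ := abs_posGrid_sub_le hU q₀ hL (M := M)
  set Q := posGrid U q₀ L M with hQdef
  have hgk : ∀ k, packet ε C 0 0 (x - Q k) = packet ε C (Q k) 0 x := fun k => by
    rw [packet_eq_sub ε C (Q k) 0 (Q k) x, sub_self]
  have main := norm_weighted_sub_le (g := fun k => packet ε C (Q k) 0 x)
    (E := fun k => ∑' j, recTerm ε C (packet ε C₀ q₀ p₀) Q (fun j n => p₀ n + s (j n))
      (fun j : Fin d → ι => ∏ n, ω (j n)) x k j)
    (ψ := packet ε C₀ q₀ p₀ x) (η := A * (d * B ^ (d - 1) * δ)) hc (fun k => by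
      rw [← hgk]
      refine hg _ fun n => ?_
      have e : (x - Q k) n = (x - q₀) n - (Q k - q₀) n := by simp
      rw [e]
      exact (abs_sub _ _).trans (add_le_add (hxq n) (hQ k n))) fun k => by
      simp only [recTerm_tensor_eq]
      rw [tsum_mul_left, packet_eq_mul ε C₀ q₀ p₀, packet_eq_sub ε C₀ q₀ 0 q₀ x,
        sub_self]
      set e := Complex.exp (Complex.I / ε * ∑ n, (p₀ n : ℂ) * ((x n : ℂ) - q₀ n)) with he
      have he1 : ‖e‖ = 1 := norm_cexp_I_div ε q₀ p₀ x
      have h := (hr.norm_tsum_sub_integral_le zero_lt_one (lt_min ha ha₀)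
        ((hK (Q k - q₀) (x - q₀) (hQ k) hxq).mono zero_le_one (min_le_left _ _))).2
      rw [integral_momentumKernel hε hC hC₀, ← packet_eq_sub] at h
      set g := packet ε C (Q k) 0 x with hgd
      have hgg : ((‖g‖ : ℝ) : ℂ) ^ 2 = g * (starRingEnd ℂ) g := by
        rw [Complex.mul_conj, Complex.normSq_eq_norm_sq]
        push_cast
        rfl
      have e2 : ∀ T w : ℂ, g * e * T - (‖g‖ : ℂ) ^ 2 * (w * e) =
          g * e * (T - (starRingEnd ℂ) g * w) := fun T w => by
        rw [hgg]
        ring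
      rw [e2, norm_mul, norm_mul, he1, mul_one]
      exact mul_le_mul_of_nonneg_left h (norm_nonneg _)
  have e3 : psiRec ε C (packet ε C₀ q₀ p₀) Q (fun j n => p₀ n + s (j n))
      (fun j : Fin d → ι => ∏ n, ω (j n)) x =
      1 / ((∑ k, ‖packet ε C (Q k) 0 x‖ ^ 2 : ℝ) : ℂ) *
        ∑ k, ∑' j, recTerm ε C (packet ε C₀ q₀ p₀) Q (fun j n => p₀ n + s (j n))
      (fun j : Fin d → ι => ∏ n, ω (j n)) x k j := by
    simp only [psiRec, sumCurve, hgk]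
  rw [e3]
  refine main.trans ?_
  have h5 : (d : ℝ) ≤ d + 1 := by linarith
  calc A * (d * B ^ (d - 1) * δ) / c ≤ A * ((d + 1) * B ^ (d - 1) * δ) / c := by gcongr
    _ = _ := by ring

end Reconstruction


/-! ### The three quadrature rules -/

/-- The total weight 2L is a crude stability constant; its growth in L is later absorbed by the
Gaussian tail. -/
theorem exists_stableRule_midpoint {c : ℝ} (hc : 0 < c) :
    ∃ b > 0, ∃ K₁ > 0, ∃ K₂ > 0, ∀ (L : ℝ) (N : ℕ), 0 < L → 0 < N →
      StableRule c 1 (2 * L + b) (K₁ * Real.exp (-(c / 2) * L ^ 2) + K₂ * L ^ 3 / N ^ 2)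
        (fun j : Fin N => -L + (2 * ((j : ℕ) : ℝ) + 1) / 2 * (2 * L / N))
        (fun _ : Fin N => 2 * L / N) := by
  refine ⟨√(Real.pi / c), by positivity, √(Real.pi / (c / 2)), by positivity,
    4 / 1 ^ 2 * Real.exp (c * 1 ^ 2), by positivity, fun L N hL hN => ?_⟩
  have hN' : (0 : ℝ) < N := Nat.cast_pos.2 hN
  have hb := Real.sqrt_nonneg (Real.pi / c)
  refine ⟨fun _ => by positivity, Summable.of_finite, ?_, by linarith, by positivity,
    fun A f hf => ?_⟩
  · rw [tsum_fintype]
    calc ∑ j : Fin N, 2 * L / N * Real.exp (-c *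
          (-L + (2 * ((j : ℕ) : ℝ) + 1) / 2 * (2 * L / N)) ^ 2) ≤ ∑ _j : Fin N, 2 * L / N :=
          Finset.sum_le_sum fun j _ => mul_le_of_le_one_right (by positivity)
            (Real.exp_le_one_iff.2 (by nlinarith [sq_nonneg (-L + (2 * ((j : ℕ) : ℝ) + 1) / 2 *
              (2 * L / N))]))
      _ = 2 * L := by
          rw [Finset.sum_const, Finset.card_univ, Fintype.card_fin, nsmul_eq_mul]
          field_simp
      _ ≤ _ := by linarith
  · rw [tsum_fintype]
    exact hf.norm_midpoint_sub_integral_le zero_lt_one hc hL hN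

/-- The second error bound is just sum plus integral. It is the useful one for coarse meshes, where
h^k is too large to be multiplied by powers of 1 + h. -/
theorem exists_stableRule_riemann {c : ℝ} (hc : 0 < c) {k : ℕ} (hk : 2 ≤ k) :
    ∃ K > 0, ∀ h : ℝ, 0 < h →
      StableRule c 1 (K * (1 + h)) (K * h ^ k) (fun j : ℤ => (j : ℝ) * h) (fun _ => h) ∧
      StableRule c 1 (K * (1 + h)) (2 * (K * (1 + h))) (fun j : ℤ => (j : ℝ) * h)
        (fun _ => h) := by
  obtain ⟨K₁, hK₁, h1⟩ := exists_norm_riemann_sub_integral_le zero_lt_one hc hk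
  obtain ⟨K₂, hK₂, h2⟩ := exists_tsum_exp_neg_le hc
  refine ⟨K₁ + K₂ + √(Real.pi / c), by positivity, fun h hh => ?_⟩
  have hb := Real.sqrt_nonneg (Real.pi / c)
  have hs : Summable fun j : ℤ => h * Real.exp (-c * ((j : ℝ) * h) ^ 2) := by
    refine ((summable_exp_neg_mul_int_sq (a := c * h ^ 2) (by positivity)).mul_left h).congr
      fun j => ?_
    ring_nf
  have hB : ∑' j : ℤ, h * Real.exp (-c * ((j : ℝ) * h) ^ 2) ≤
      (K₁ + K₂ + √(Real.pi / c)) * (1 + h) :=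
    (h2 h hh).trans (mul_le_mul_of_nonneg_right (by linarith) (by linarith))
  have hB' : √(Real.pi / c) ≤ (K₁ + K₂ + √(Real.pi / c)) * (1 + h) := by
    have := mul_pos (add_pos hK₁ hK₂) hh
    nlinarith
  refine ⟨⟨fun _ => hh.le, hs, hB, hB', by positivity, fun A f hf => ?_⟩,
    ⟨fun _ => hh.le, hs, hB, hB', by positivity, fun A f hf => ?_⟩⟩
  · refine (h1 A f h hf hh).trans (mul_le_mul_of_nonneg_left ?_ (hf.nonneg zero_le_one))
    exact mul_le_mul_of_nonneg_right (by linarith) (by positivity)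
  · have hA := hf.nonneg zero_le_one
    have h3 : ‖∑' j : ℤ, (h : ℂ) * f (((j : ℝ) * h : ℝ) : ℂ)‖ ≤
        A * ((K₁ + K₂ + √(Real.pi / c)) * (1 + h)) := by
      refine (tsum_of_norm_bounded (hs.mul_left A).hasSum fun j => ?_).trans ?_
      · rw [norm_mul, Complex.norm_real, Real.norm_of_nonneg hh.le, mul_left_comm]
        exact mul_le_mul_of_nonneg_left (hf.norm_ofReal_le zero_le_one _) hh.le
      · rw [tsum_mul_left]
        exact mul_le_mul_of_nonneg_left hB hA
    have h4 := (hf.norm_integral_le zero_lt_one hc).trans (mul_le_mul_of_nonneg_left hB' hA)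
    refine (norm_sub_le_of_le h3 h4).trans (le_of_eq ?_)
    ring

/-- Substituting x = √(2ε) u changes the rate to 2εc. The bound on c keeps this at most 1, so that
exp((1 - 2εc) u²) has a non-negative exponent as the moment comparison requires. -/
theorem exists_stableRule_hermite {ε c : ℝ} (hε : 0 < ε) (hc : 0 < c) (hcε : c ≤ 1 / (2 * ε))
    (m : ℕ) :
    ∃ b > 0, ∃ K > 0, ∀ N : ℕ, 0 < N →
      StableRule c 1 b (K / N ^ m) (fun s : hermiteZeros N => (s : ℝ) * √(2 * ε))
        (fun s : hermiteZeros N => Real.exp ((s : ℝ) ^ 2) * hermiteWeight N s * √(2 * ε)) := by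
  set a := √(2 * ε) with ha
  have ha0 : 0 < a := Real.sqrt_pos.2 (by positivity)
  have ha2 : a ^ 2 = 2 * ε := Real.sq_sqrt (by positivity)
  have hca : 0 < c * a ^ 2 := by positivity
  have hca1 : c * a ^ 2 ≤ 1 := by
    rw [ha2]
    exact (le_div_iff₀ (by positivity)).1 hcε
  obtain ⟨K, hK, h⟩ := exists_norm_gaussHermite_sub_integral_le (ρ := 1 / a) (by positivity) hca
    hca1 m
  refine ⟨√(Real.pi / c), by positivity, a * K, by positivity, fun N hN => ?_⟩
  have hN' : (0 : ℝ) < N := Nat.cast_pos.2 hN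
  refine ⟨fun s => ?_, Summable.of_finite, ?_, le_rfl, by positivity, fun A f hf => ?_⟩
  · have := hermiteWeight_nonneg N (s : ℝ)
    positivity
  · rw [tsum_fintype]
    have h1 := gaussHermite_exp_le (θ := 1 - c * a ^ 2) (by linarith) (by linarith) hN
    have h2 : ∑ s : hermiteZeros N, Real.exp ((s : ℝ) ^ 2) * hermiteWeight N s * a *
        Real.exp (-c * ((s : ℝ) * a) ^ 2) =
        a * gaussHermite N fun x => Real.exp ((1 - c * a ^ 2) * x ^ 2) := by
      rw [gaussHermite, Finset.mul_sum, ← Finset.sum_coe_sort (hermiteZeros N)]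
      refine Finset.sum_congr rfl fun s _ => ?_
      have : Real.exp ((1 - c * a ^ 2) * (s : ℝ) ^ 2) =
          Real.exp ((s : ℝ) ^ 2) * Real.exp (-c * ((s : ℝ) * a) ^ 2) := by
        rw [← Real.exp_add]
        ring_nf
      rw [this]
      ring
    rw [h2]
    refine (mul_le_mul_of_nonneg_left h1 ha0.le).trans (le_of_eq ?_)
    rw [sub_sub_cancel]
    nth_rewrite 1 [← Real.sqrt_sq ha0.le]
    rw [← Real.sqrt_mul (sq_nonneg a)]
    congr 1
    field_simp
  · have h1 := h A _ N (hf.comp_mul ha0) hN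
    have h2 : ∫ x : ℝ, f x = a * ∫ x : ℝ, f (a * x) := by
      have := Measure.integral_comp_mul_left (fun x : ℝ => f x) a
      simp only [Complex.ofReal_mul] at this
      rw [this, abs_of_pos (inv_pos.2 ha0), Complex.real_smul, Complex.ofReal_inv,
        mul_inv_cancel_left₀ (Complex.ofReal_ne_zero.2 ha0.ne')]
    have h3 : ∑' s : hermiteZeros N, ((Real.exp ((s : ℝ) ^ 2) * hermiteWeight N s * a : ℝ) : ℂ) *
        f (((s : ℝ) * a : ℝ) : ℂ) = a * ∑ s ∈ hermiteZeros N,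
          ((Real.exp (s ^ 2) * hermiteWeight N s : ℝ) : ℂ) * f (a * s) := by
      rw [tsum_fintype, Finset.mul_sum, ← Finset.sum_coe_sort (hermiteZeros N)]
      refine Finset.sum_congr rfl fun s _ => ?_
      push_cast
      rw [mul_comm (s : ℂ)]
      ring
    rw [h3, h2, ← mul_sub, norm_mul, Complex.norm_real, Real.norm_of_nonneg ha0.le, mul_div_assoc',
      le_div_iff₀ (by positivity), mul_assoc]
    calc _ ≤ a * (A * K) := mul_le_mul_of_nonneg_left h1 ha0.le
      _ = _ := by ring

/-! ### Error bounds for the three reconstructions -/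

/-- A power is dominated by the exponential of its base, and 2L ≤ cL² + 1/c by completing the
square. -/
theorem exists_pow_add_le_exp (n : ℕ) {b c : ℝ} (hb : 0 ≤ b) (hc : 0 < c) :
    ∃ K > 0, ∀ L : ℝ, 0 < L → (2 * L + b) ^ n ≤ K * Real.exp (c * L ^ 2) := by
  refine ⟨n.factorial * Real.exp (b + 1 / c), by positivity, fun L hL => ?_⟩
  have h1 := Real.pow_div_factorial_le_exp (2 * L + b) (by positivity) n
  rw [div_le_iff₀ (by positivity)] at h1
  refine h1.trans ?_
  rw [mul_comm, mul_assoc, ← Real.exp_add]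
  refine mul_le_mul_of_nonneg_left (Real.exp_le_exp.2 ?_) (by positivity)
  have h2 : c * L ^ 2 + 1 / c - 2 * L = (c * L - 1) ^ 2 / c := by
    field_simp
    ring
  have : 0 ≤ (c * L - 1) ^ 2 / c := by positivity
  linarith

/-- Error of the truncated compound midpoint rule. -/
theorem exists_supError_midpoint_lt (d : ℕ) (ε : ℝ) (hε : 0 < ε)
    (C C₀ : Matrix (Fin d) (Fin d) ℂ)
    (hC : C ∈ SiegelUpperHalfSpace d) (hC₀ : C₀ ∈ SiegelUpperHalfSpace d)
    (Lq : ℝ) (hLq : 0 < Lq) :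
    (∃ K > 0, ∃ c > 0, ∀ Lp : ℝ, 0 < Lp →
      ∃ CT > 0, ∃ CcM > 0, CT ≤ K * Real.exp (-c * Lp ^ 2) ∧
        ∀ (q₀ p₀ : Fin d → ℝ) (U : Matrix (Fin d) (Fin d) ℝ) (M N : ℕ),
          U ∈ Matrix.orthogonalGroup (Fin d) ℝ → 1 ≤ M → 1 ≤ N →
          supError (posBox U q₀ Lq) (packet ε C₀ q₀ p₀)
              (psiRec ε C (packet ε C₀ q₀ p₀)
                (posGrid U q₀ Lq M) (midpointNode p₀ Lp N)
                (fun _ => (2 * Lp / N) ^ d))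
            < ENNReal.ofReal (CT + CcM * (N : ℝ) ^ (-2 : ℝ))) := by
  obtain ⟨A, hA, a, ha, -, hE⟩ := exists_supError_le hε hC hC₀ hLq.le one_pos
  obtain ⟨b, hb, K₁, hK₁, K₂, hK₂, hr⟩ := exists_stableRule_midpoint ha
  obtain ⟨K₃, hK₃, hexp⟩ := exists_pow_add_le_exp (d - 1) hb.le (show 0 < a / 4 by positivity)
  -- The tail exp(-(a/2)L²) gives up half of its rate to absorb the tensor factor (2L + b)^(d-1).
  -- The summand 1 in the second constant makes the inequality strict.
  refine ⟨A * K₃ * K₁, by positivity, a / 4, by positivity, fun L hL =>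
    ⟨A * K₃ * K₁ * Real.exp (-(a / 4) * L ^ 2), by positivity,
      A * (2 * L + b) ^ (d - 1) * K₂ * L ^ 3 + 1, by positivity, le_rfl, ?_⟩⟩
  intro q₀ p₀ U M N hU hM hN
  have hN' : (0 : ℝ) < N := Nat.cast_pos.2 hN
  have h := hE _ _ _ _ _ (hr L N hL hN) q₀ p₀ U M hU hM
  have e1 : midpointNode p₀ L N = fun (j : Fin d → Fin N) n =>
      p₀ n + (-L + (2 * ((j n : ℕ) : ℝ) + 1) / 2 * (2 * L / N)) := by
    funext j n
    rw [midpointNode]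
    ring
  have e2 : (fun _ : Fin d → Fin N => (2 * L / N) ^ d) = fun _ => ∏ _n : Fin d, 2 * L / N := by
    simp only [Finset.prod_const, Finset.card_univ, Fintype.card_fin]
  rw [e1, e2]
  have e3 : (N : ℝ) ^ (-2 : ℝ) = 1 / (N : ℝ) ^ 2 := by
    rw [Real.rpow_neg hN'.le, one_div]
    norm_cast
  have e4 : Real.exp (a / 4 * L ^ 2) * Real.exp (-(a / 2) * L ^ 2) =
      Real.exp (-(a / 4) * L ^ 2) := by
    rw [← Real.exp_add]
    ring_nf
  refine h.trans_lt ((ENNReal.ofReal_lt_ofReal_iff (by positivity)).2 ?_)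
  rw [e3]
  have h1 := mul_le_mul_of_nonneg_left (hexp L hL)
    (show 0 ≤ A * K₁ * Real.exp (-(a / 2) * L ^ 2) by positivity)
  have h2 : 0 < 1 / (N : ℝ) ^ 2 := by positivity
  calc A * ((2 * L + b) ^ (d - 1) * (K₁ * Real.exp (-(a / 2) * L ^ 2) + K₂ * L ^ 3 / N ^ 2))
      = A * K₁ * Real.exp (-(a / 2) * L ^ 2) * (2 * L + b) ^ (d - 1) +
        A * (2 * L + b) ^ (d - 1) * K₂ * L ^ 3 * (1 / (N : ℝ) ^ 2) := by ring
    _ < A * K₁ * Real.exp (-(a / 2) * L ^ 2) * (K₃ * Real.exp (a / 4 * L ^ 2)) +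
        (A * (2 * L + b) ^ (d - 1) * K₂ * L ^ 3 + 1) * (1 / (N : ℝ) ^ 2) := by
      rw [add_mul _ 1]
      linarith
    _ = _ := by rw [← e4]; ring

/-- Convergence and error of the infinite Riemann sums. -/
theorem exists_supError_riemann_lt (d : ℕ) (hd : 1 ≤ d) (ε : ℝ) (hε : 0 < ε)
    (C C₀ : Matrix (Fin d) (Fin d) ℂ)
    (hC : C ∈ SiegelUpperHalfSpace d) (hC₀ : C₀ ∈ SiegelUpperHalfSpace d)
    (Lq : ℝ) (hLq : 0 < Lq) :
    (∀ s : ℕ, 1 ≤ s → ∀ P : ℝ, 0 < P → ∃ CRS > 0,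
      ∀ (q₀ p₀ : Fin d → ℝ) (U : Matrix (Fin d) (Fin d) ℝ) (M : ℕ) (Δp : ℝ),
        U ∈ Matrix.orthogonalGroup (Fin d) ℝ → 1 ≤ M → 0 < Δp → (Δp ≤ P ∨ d ≤ 2 * s + 1) →
        (∀ (x : Fin d → ℝ) (k : Fin d → Fin M),
          Summable (recTerm ε C (packet ε C₀ q₀ p₀)
            (posGrid U q₀ Lq M) (riemannNode p₀ Δp)
            (fun _ => Δp ^ d) x k)) ∧
        supError (posBox U q₀ Lq) (packet ε C₀ q₀ p₀)
            (psiRec ε C (packet ε C₀ q₀ p₀)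
              (posGrid U q₀ Lq M) (riemannNode p₀ Δp)
              (fun _ => Δp ^ d))
          < ENNReal.ofReal (CRS * Δp ^ (2 * s + 1))) := by
  intro s hs P hP
  obtain ⟨A, hA, a, ha, -, hE⟩ := exists_supError_le hε hC hC₀ hLq.le one_pos
  obtain ⟨K, hK, hr⟩ := exists_stableRule_riemann ha (show 2 ≤ 2 * s + 1 by omega)
  -- One summand for each range of the mesh size; the remaining summands give strictness.
  refine ⟨A * (K * (1 + max P 1)) ^ (d - 1) * K + A * 2 * (K * 2) ^ d + 1, by positivity, ?_⟩
  intro q₀ p₀ U M h hU hM hh hcase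
  have e2 : (fun _ : Fin d → ℤ => h ^ d) = fun _ => ∏ _n : Fin d, h := by
    simp
  have e1 : riemannNode p₀ h = fun (j : Fin d → ℤ) n => p₀ n + (j n : ℝ) * h := rfl
  rw [e1, e2]
  refine ⟨fun x k => ?_, ?_⟩
  · refine summable_recTerm hε hC hC₀ (s := fun j : ℤ => (j : ℝ) * h) (ω := fun _ => h)
      (fun c hc => ?_) q₀ p₀ _ x k
    obtain ⟨K', -, h'⟩ := exists_stableRule_riemann hc le_rfl
    exact ⟨_, _, (h' h hh).1⟩
  -- Below the threshold (1 + h)^(d-1) is bounded. Above it h > 1, so the trivial bound of order h^d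
  -- is at most of order h^(2s+1) when d ≤ 2s + 1.
  · by_cases hle : h ≤ max P 1
    · refine (hE _ _ _ _ _ (hr h hh).1 q₀ p₀ U M hU hM).trans_lt
        ((ENNReal.ofReal_lt_ofReal_iff (by positivity)).2 ?_)
      have h1 : (K * (1 + h)) ^ (d - 1) ≤ (K * (1 + max P 1)) ^ (d - 1) := by gcongr
      calc A * ((K * (1 + h)) ^ (d - 1) * (K * h ^ (2 * s + 1)))
          ≤ A * ((K * (1 + max P 1)) ^ (d - 1) * (K * h ^ (2 * s + 1))) := by gcongr
        _ = A * (K * (1 + max P 1)) ^ (d - 1) * K * h ^ (2 * s + 1) := by ring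
        _ < _ := by
          refine mul_lt_mul_of_pos_right ?_ (by positivity)
          have : 0 < A * 2 * (K * 2) ^ d := by positivity
          linarith
    · rw [not_le, max_lt_iff] at hle
      have hds : d ≤ 2 * s + 1 := hcase.resolve_left (not_le.2 hle.1)
      refine (hE _ _ _ _ _ (hr h hh).2 q₀ p₀ U M hU hM).trans_lt
        ((ENNReal.ofReal_lt_ofReal_iff (by positivity)).2 ?_)
      calc A * ((K * (1 + h)) ^ (d - 1) * (2 * (K * (1 + h))))
          = A * 2 * (K * (1 + h)) ^ d := by
            rw [← Nat.sub_add_cancel hd, Nat.add_sub_cancel, pow_succ]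
            ring
        _ ≤ A * 2 * (K * (2 * h)) ^ d := by
            gcongr
            linarith
        _ = A * 2 * (K * 2) ^ d * h ^ d := by rw [← mul_assoc, mul_pow _ h, mul_assoc (A * 2)]
        _ ≤ A * 2 * (K * 2) ^ d * h ^ (2 * s + 1) := by
            gcongr
            exact hle.2.le
        _ < _ := by
          refine mul_lt_mul_of_pos_right ?_ (by positivity)
          have : 0 < A * (K * (1 + max P 1)) ^ (d - 1) * K := by positivity
          linarith

/-- Error of the tensorized Gauss-Hermite rule. -/
theorem exists_supError_hermite_lt (d : ℕ) (ε : ℝ) (hε : 0 < ε)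
    (C C₀ : Matrix (Fin d) (Fin d) ℂ)
    (hC : C ∈ SiegelUpperHalfSpace d) (hC₀ : C₀ ∈ SiegelUpperHalfSpace d)
    (Lq : ℝ) (hLq : 0 < Lq) :
    (∀ s : ℕ, 1 ≤ s → ∃ CGH > 0,
      ∀ (q₀ p₀ : Fin d → ℝ) (U : Matrix (Fin d) (Fin d) ℝ) (M N : ℕ),
        U ∈ Matrix.orthogonalGroup (Fin d) ℝ → 1 ≤ M → 1 ≤ N →
        supError (posBox U q₀ Lq) (packet ε C₀ q₀ p₀)
            (psiRec ε C (packet ε C₀ q₀ p₀)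
              (posGrid U q₀ Lq M) (hermiteNode ε p₀ N)
              (hermiteTensorWeight ε N))
          < ENNReal.ofReal (CGH * (N : ℝ) ^ (-(s : ℝ) / 2))) := by
  intro s _
  obtain ⟨A, hA, a, ha, haε, hE⟩ := exists_supError_le hε hC hC₀ hLq.le
    (show 0 < 1 / (2 * ε) by positivity)
  obtain ⟨b, hb, K, hK, hr⟩ := exists_stableRule_hermite hε ha haε s
  refine ⟨A * (b ^ (d - 1) * K) + 1, by positivity, fun q₀ p₀ U M N hU hM hN => ?_⟩
  have hN' : (0 : ℝ) < N := Nat.cast_pos.2 hN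
  have hN1 : (1 : ℝ) ≤ N := Nat.one_le_cast.2 hN
  refine (hE _ _ _ _ _ (hr N hN) q₀ p₀ U M hU hM).trans_lt
    ((ENNReal.ofReal_lt_ofReal_iff (by positivity)).2 ?_)
  have h1 : 1 / (N : ℝ) ^ s ≤ (N : ℝ) ^ (-(s : ℝ) / 2) := by
    rw [one_div, ← Real.rpow_natCast, ← Real.rpow_neg hN'.le]
    refine Real.rpow_le_rpow_of_exponent_le hN1 ?_
    have : (0 : ℝ) ≤ s := Nat.cast_nonneg s
    linarith
  have h2 : 0 < (N : ℝ) ^ (-(s : ℝ) / 2) := by positivity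
  calc A * (b ^ (d - 1) * (K / N ^ s)) = A * (b ^ (d - 1) * K) * (1 / (N : ℝ) ^ s) := by ring
    _ ≤ A * (b ^ (d - 1) * K) * (N : ℝ) ^ (-(s : ℝ) / 2) := by gcongr
    _ < _ := mul_lt_mul_of_pos_right (by linarith) h2

/-- Size of the tensor grids. -/
theorem card_tensor_grids (d : ℕ) (hd : 1 ≤ d) :
    (∀ N : ℕ, 1 ≤ N →
      Nat.card (Fin d → Fin N) = N ^ d ∧
      Nat.card (Fin d → hermiteZeros N) = N ^ d ∧
      (N : ℝ) ^ (-2 : ℝ) = ((N ^ d : ℕ) : ℝ) ^ (-2 / (d : ℝ)) ∧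
      ∀ s : ℕ, 1 ≤ s →
        (N : ℝ) ^ (-(s : ℝ) / 2) = ((N ^ d : ℕ) : ℝ) ^ (-(s : ℝ) / (2 * (d : ℝ)))) := by
  intro N _
  have hd' : (d : ℝ) ≠ 0 := Nat.cast_ne_zero.2 (by omega)
  have h : ∀ r : ℝ, ((N ^ d : ℕ) : ℝ) ^ r = (N : ℝ) ^ (d * r) := fun r => by
    rw [Nat.cast_pow, ← Real.rpow_natCast, ← Real.rpow_mul (Nat.cast_nonneg N)]
  refine ⟨by simp, by simp [card_hermiteZeros], ?_, fun s _ => ?_⟩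
  · rw [h]
    congr 1
    field_simp
  · rw [h]
    congr 1
    field_simp

end WavePacket

theorem theorem3p1 (d : ℕ) (hd : 1 ≤ d) (ε : ℝ) (hε : 0 < ε)
    (C C₀ : Matrix (Fin d) (Fin d) ℂ)
    (hC : C ∈ WavePacket.SiegelUpperHalfSpace d) (hC₀ : C₀ ∈ WavePacket.SiegelUpperHalfSpace d)
    (Lq : ℝ) (hLq : 0 < Lq) :
    -- truncation and compound midpoint rule
    (∃ K > 0, ∃ c > 0, ∀ Lp : ℝ, 0 < Lp →
      ∃ CT > 0, ∃ CcM > 0, CT ≤ K * Real.exp (-c * Lp ^ 2) ∧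
        ∀ (q₀ p₀ : Fin d → ℝ) (U : Matrix (Fin d) (Fin d) ℝ) (M N : ℕ),
          U ∈ Matrix.orthogonalGroup (Fin d) ℝ → 1 ≤ M → 1 ≤ N →
          WavePacket.supError (WavePacket.posBox U q₀ Lq) (WavePacket.packet ε C₀ q₀ p₀)
              (WavePacket.psiRec ε C (WavePacket.packet ε C₀ q₀ p₀)
                (WavePacket.posGrid U q₀ Lq M) (WavePacket.midpointNode p₀ Lp N)
                (fun _ => (2 * Lp / N) ^ d))
            < ENNReal.ofReal (CT + CcM * (N : ℝ) ^ (-2 : ℝ))) ∧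
    -- infinite Riemann sums
    (∀ s : ℕ, 1 ≤ s → ∀ P : ℝ, 0 < P → ∃ CRS > 0,
      ∀ (q₀ p₀ : Fin d → ℝ) (U : Matrix (Fin d) (Fin d) ℝ) (M : ℕ) (Δp : ℝ),
        U ∈ Matrix.orthogonalGroup (Fin d) ℝ → 1 ≤ M → 0 < Δp → (Δp ≤ P ∨ d ≤ 2 * s + 1) →
        (∀ (x : Fin d → ℝ) (k : Fin d → Fin M),
          Summable (WavePacket.recTerm ε C (WavePacket.packet ε C₀ q₀ p₀)
            (WavePacket.posGrid U q₀ Lq M) (WavePacket.riemannNode p₀ Δp)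
            (fun _ => Δp ^ d) x k)) ∧
        WavePacket.supError (WavePacket.posBox U q₀ Lq) (WavePacket.packet ε C₀ q₀ p₀)
            (WavePacket.psiRec ε C (WavePacket.packet ε C₀ q₀ p₀)
              (WavePacket.posGrid U q₀ Lq M) (WavePacket.riemannNode p₀ Δp)
              (fun _ => Δp ^ d))
          < ENNReal.ofReal (CRS * Δp ^ (2 * s + 1))) ∧
    -- Gauss-Hermite quadrature
    (∀ s : ℕ, 1 ≤ s → ∃ CGH > 0,
      ∀ (q₀ p₀ : Fin d → ℝ) (U : Matrix (Fin d) (Fin d) ℝ) (M N : ℕ),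
        U ∈ Matrix.orthogonalGroup (Fin d) ℝ → 1 ≤ M → 1 ≤ N →
        WavePacket.supError (WavePacket.posBox U q₀ Lq) (WavePacket.packet ε C₀ q₀ p₀)
            (WavePacket.psiRec ε C (WavePacket.packet ε C₀ q₀ p₀)
              (WavePacket.posGrid U q₀ Lq M) (WavePacket.hermiteNode ε p₀ N)
              (WavePacket.hermiteTensorWeight ε N))
          < ENNReal.ofReal (CGH * (N : ℝ) ^ (-(s : ℝ) / 2))) ∧
    -- total number of grid points of the tensorized finite rules
    (∀ N : ℕ, 1 ≤ N →
      Nat.card (Fin d → Fin N) = N ^ d ∧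
      Nat.card (Fin d → WavePacket.hermiteZeros N) = N ^ d ∧
      (N : ℝ) ^ (-2 : ℝ) = ((N ^ d : ℕ) : ℝ) ^ (-2 / (d : ℝ)) ∧
      ∀ s : ℕ, 1 ≤ s →
        (N : ℝ) ^ (-(s : ℝ) / 2) = ((N ^ d : ℕ) : ℝ) ^ (-(s : ℝ) / (2 * (d : ℝ)))) := by
  exact ⟨WavePacket.exists_supError_midpoint_lt d ε hε C C₀ hC hC₀ Lq hLq,
    WavePacket.exists_supError_riemann_lt d hd ε hε C C₀ hC hC₀ Lq hLq,
    WavePacket.exists_supError_hermite_lt d ε hε C C₀ hC hC₀ Lq hLq,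
    WavePacket.card_tensor_grids d hd⟩
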